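/- **Theorem 1 (Convergence Theorem).** *The model.* Let $k_1,k_2,K_1,K_2,r_1,r_2,\lambda,\mu_1,\mu_2,D,\delta,M_0,\alpha,\beta,L_0,H_0$ be real constants with $D>0$, $M_0\ne 0$, and let $T>0$. Given $R,v_0$, write $E_a=\exp(a(1-R)(1-\rho)^2/2)$, $\hat L=L_0+E_\alpha L$, $\hat H=H_0+E_\alpha H$, $\hat F=E_\beta F$, $A_d=\frac{-2d}{\rho(1-R)^2+R(1-R)}+\frac{v_0(\rho-1)}{1-R}$, $G_L=A_1+\frac{2(1-\rho)\alpha}{1-R}$, $G_F=A_D+\frac{v}{1-R}+\frac{2D(1-\rho)\beta}{1-R}$, $Z(d,a,A)=\frac{a v_0(1-\rho)^2}{2}+d\left(\frac{a}{1-R}+a^2(1-\rho)^2\right)+a(1-R)(1-\rho)A$, and $$f^L=\frac1{E_\alpha}\Big(-k_1\frac{(M_0-\hat F)\hat L}{K_1+\hat L}-r_1\hat L\Big)+Z(1,\alpha,A_1)L,\qquad f^H=\frac1{E_\alpha}\Big(-k_2\frac{\hat H\hat F}{K_2+\hat F}-r_2\hat H\Big)+Z(1,\alpha,A_1)H,$$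 $$f^F=\frac1{E_\beta}\Big(k_1\frac{(M_0-\hat F)\hat L}{K_1+\hat L}-k_2\frac{\hat H\hat F}{K_2+\hat F}-\lambda\frac{\hat F(M_0-\hat F)\hat L}{M_0(\delta+\hat H)}+\frac{\mu_1-\mu_2}{M_0}\hat F(M_0-\hat F)\Big)+Z\Big(D,\beta,A_D+\frac{v}{1-R}\Big)F,$$ $$f^v=\frac1{M_0}\Big(\lambda\frac{(M_0-\hat F)\hat L}{\delta+\hat H}-\mu_1(M_0-\hat F)-\mu_2\hat F\Big).$$ Let $L,H,F,v$ (functions of $(\rho,t)\in[0,1]\times[0,T]$) and $R$ (a function of $t$) solve, with $v_0=v(0,t)$, the front-fixed atherosclerosis system with Neumann conditions $$L_t-\tfrac{1}{(1-R)^2}L_{\rho\rho}+G_LL_\rho=f^L,\quad H_t-\tfrac{1}{(1-R)^2}H_{\rho\rho}+G_LH_\rho=f^H,\quad F_t-\tfrac{D}{(1-R)^2}F_{\rho\rho}+G_FF_\rho=f^F,$$ $$\tfrac1{1-R}v_\rho=f^v,\quad v(1,t)=0,\quad R'(t)=v(0,t),$$ $$L_\rho=H_\rho=F_\rho=0\ \text{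 at }\rho=0,1,\qquad (L,H,F)(\cdot,0)=(\varphi_L,\varphi_H,\varphi_F),\quad R(0)=\varepsilon,$$ for given initial data (for example $\varphi_L=\varphi_H=\varphi_F=0$). Assume that $0<R<1$ on $[0,T]$; that $K_1+\hat L$, $K_2+\hat F$, $\delta+\hat H$ do not vanish on $[0,1]\times[0,T]$; and that each $u\in\{L,H,F\}$ is smooth: $u$ is $C^2$ in $\rho$ with $u_{\rho\rho}$ of class $C^1$ on $[0,1]\times[0,T]$, and $u$ is $C^3$ in $t$ with $u_{ttt}$ bounded. *The scheme.* Let $h=T/M$, $t_n=nh$, $h^*=\frac{2h}{3}$, and $\|u\|=(\int_0^1u^2\,d\rho)^{1/2}$. Let $V_N$ be the space of polynomials $u$ of degree at most $N+2$ with $u'(0)=u'(1)=0$, $\Pi_N$ the $L^2(0,1)$-orthogonal projection onto polynomials of degree at most $N$, and $I_N$ the interpolation by such polynomials at the $N+1$ Legendre–Gauss–Lobatto nodes of $[0,1]$. For $0\le n<M$, $v_n^{ap}$ is defined on $[0,1]$ by $\frac{1}{1-R_n^{ap}}\partial_\rho v_n^{ap}=f^v(L_n^{ap},H_n^{ap},F_n^{ap};R_n^{ap})$,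 $v_n^{ap}(1)=0$. For $1\le n<M$, $$R_{n+1}^{ap}=R_n^{ap}-\frac{R_{n-1}^{ap}-R_n^{ap}}{3}+h^*\big(2v_n^{ap}(0)-v_{n-1}^{ap}(0)\big),$$ and $F_{n+1}^{ap}\in V_N$ satisfies $$\Pi_N\Big(F_{n+1}^{ap}-\frac{h^*D}{(1-R_{n+1}^{ap})^2}\partial_\rho^2F_{n+1}^{ap}+h^*G\,\partial_\rho F_{n+1}^{ap}\Big)=I_N\Big(\Pi_N\Big(F_n^{ap}-\frac{F_{n-1}^{ap}-F_n^{ap}}{3}\Big)+h^*\big(2f^F_n-f^F_{n-1}\big)\Big),$$ where $G$ is $G_F$ with $R=R^{ap}_{n+1}$, $v=2v_n^{ap}-v_{n-1}^{ap}$, $v_0=2v_n^{ap}(0)-v_{n-1}^{ap}(0)$, and $f^F_j$ is $f^F$ evaluated at the numerical values of level $j$; $L_{n+1}^{ap},H_{n+1}^{ap}\in V_N$ satisfy the same equations with $f^L$, respectively $f^H$, with $G_L$ in place of $G_F$, and with diffusion coefficient $1$. *The error.* With $L_k=L(\cdot,t_k)$ and so on, put $$\xi_k=\|\partial_\rho(L_k^{ap}-L_k)\|+\|\partial_\rho(H_k^{ap}-H_k)\|+\|\partial_\rho(F_k^{ap}-F_k)\|+|R_k^{ap}-R_k|.$$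 *Conclusion.* Let $C_0\in\mathbb R$ and let $\kappa(N)\to0$ as $N\to\infty$ (read $\kappa(N)^{1/2}$ as $0$ if $\kappa(N)<0$). Then there are constants $M_1,M_2>0$, a function $K\ge0$ with $\lim_{N\to\infty}K(N)=0$, and $h_0>0$, $N_0\in\mathbb N$, all independent of $h$, $N$ and the starting values, such that the following holds whenever $h=T/M\le h_0$ and $N\ge N_0$. Let starting values $L_j^{ap},H_j^{ap},F_j^{ap}\in V_N$, $R_j^{ap}$ ($j=0,1$) be given with $R_0^{ap}=\varepsilon$ and $$\xi_j+\|L_j^{ap}-L_j\|+\|H_j^{ap}-H_j\|+\|F_j^{ap}-F_j\|\le C_0\big({h^*}^2+\kappa(N)^{1/2}\big)\qquad(j=0,1).$$ Then the scheme has a solution with these starting values, and every such solution satisfies $$\max_{0\le k\le M}\xi_k\le M_1e^{M_2T}\big({h^*}^2+K(N)^{1/2}\big).$$ -/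

import Mathlib

open Set Filter Topology Polynomial

noncomputable section

namespace Plaque

/-! ### The front-fixed model with Neumann boundary conditions -/

/-- The constants of the model. -/
structure Params where
  (k1 k2 K1 K2 r1 r2 lam mu1 mu2 D del M0 alpha beta L0 H0 : ℝ)

/-- The weight `exp (a (1 - R) (1 - ρ)² / 2)` of the change of variables which turns the mixed
condition with coefficient `a` at the free boundary into a Neumann condition. -/
def weight (a ρ R : ℝ) : ℝ := Real.exp (a * (1 - R) * (1 - ρ) ^ 2 / 2)

/-- LDL concentration recovered from the transformed unknown. -/
def hatL (p : Params) (ρ R L : ℝ) : ℝ := p.L0 + weight p.alpha ρ R * L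

/-- HDL concentration recovered from the transformed unknown. -/
def hatH (p : Params) (ρ R H : ℝ) : ℝ := p.H0 + weight p.alpha ρ R * H

/-- Foam cell density recovered from the transformed unknown. -/
def hatF (p : Params) (ρ R F : ℝ) : ℝ := weight p.beta ρ R * F

/-- The reaction term of the LDL equation. -/
def reactL (p : Params) (Lh Fh : ℝ) : ℝ :=
  -p.k1 * ((p.M0 - Fh) * Lh / (p.K1 + Lh)) - p.r1 * Lh

/-- The reaction term of the HDL equation. -/
def reactH (p : Params) (Hh Fh : ℝ) : ℝ :=
  -p.k2 * (Hh * Fh / (p.K2 + Fh)) - p.r2 * Hh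

/-- The reaction term of the foam cell equation. -/
def reactF (p : Params) (Lh Hh Fh : ℝ) : ℝ :=
  p.k1 * ((p.M0 - Fh) * Lh / (p.K1 + Lh)) - p.k2 * (Hh * Fh / (p.K2 + Fh))
    - p.lam * (Fh * (p.M0 - Fh) * Lh / (p.M0 * (p.del + Hh)))
    + p.mu1 / p.M0 * (p.M0 - Fh) * Fh - p.mu2 / p.M0 * Fh * (p.M0 - Fh)

/-- The part `2 / (r (1 - R))`, `r = R + ρ (1 - R)`, of the convection coefficient that stems from
the radial Laplacian, together with the transport `R' (ρ - 1) / (1 - R)` due to front fixing;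
`d` is the diffusion coefficient, `v0` the velocity `R' = v(0, t)` of the front. -/
def drift (d ρ R v0 : ℝ) : ℝ :=
  -(2 * d) / (ρ * (1 - R) ^ 2 + R * (1 - R)) + v0 * (ρ - 1) / (1 - R)

/-- Coefficient of `∂L/∂ρ` and of `∂H/∂ρ`. -/
def convL (p : Params) (ρ R v0 : ℝ) : ℝ :=
  drift 1 ρ R v0 + 2 * (1 - ρ) * p.alpha / (1 - R)

/-- Coefficient of `∂F/∂ρ`; here `v` is the velocity at `ρ`. -/
def convF (p : Params) (ρ R v0 v : ℝ) : ℝ :=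
  drift p.D ρ R v0 + v / (1 - R) + 2 * p.D * (1 - ρ) * p.beta / (1 - R)

/-- Zeroth order coefficient created by the change of variables with exponent `a` in an equation
with diffusion coefficient `d` and original convection coefficient `A`. -/
def zeroth (d a A ρ R v0 : ℝ) : ℝ :=
  a * v0 * (1 - ρ) ^ 2 / 2 + d * (a / (1 - R) + a ^ 2 * (1 - ρ) ^ 2) + A * (a * (1 - R) * (1 - ρ))

/-- Right-hand side of the transformed `L` equation. -/
def fL (p : Params) (ρ R v0 L F : ℝ) : ℝ :=
  reactL p (hatL p ρ R L) (hatF p ρ R F) / weight p.alpha ρ R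
    + zeroth 1 p.alpha (drift 1 ρ R v0) ρ R v0 * L

/-- Right-hand side of the transformed `H` equation. -/
def fH (p : Params) (ρ R v0 H F : ℝ) : ℝ :=
  reactH p (hatH p ρ R H) (hatF p ρ R F) / weight p.alpha ρ R
    + zeroth 1 p.alpha (drift 1 ρ R v0) ρ R v0 * H

/-- Right-hand side of the transformed `F` equation. -/
def fF (p : Params) (ρ R v0 v L H F : ℝ) : ℝ :=
  reactF p (hatL p ρ R L) (hatH p ρ R H) (hatF p ρ R F) / weight p.beta ρ R
    + zeroth p.D p.beta (drift p.D ρ R v0 + v / (1 - R)) ρ R v0 * F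

/-- Right-hand side of the velocity equation. -/
def fv (p : Params) (ρ R L H F : ℝ) : ℝ :=
  (p.lam * ((p.M0 - hatF p ρ R F) * hatL p ρ R L / (p.del + hatH p ρ R H))
    - p.mu1 * (p.M0 - hatF p ρ R F) - p.mu2 * hatF p ρ R F) / p.M0

/-- `∂u/∂ρ` on `[0, 1]` (one-sided at the end points). -/
def dρ (u : ℝ → ℝ → ℝ) (ρ t : ℝ) : ℝ := derivWithin (fun x => u x t) (Icc 0 1) ρ

/-- `∂²u/∂ρ²` on `[0, 1]` (one-sided at the end points). -/
def dρρ (u : ℝ → ℝ → ℝ) (ρ t : ℝ) : ℝ := iteratedDerivWithin 2 (fun x => u x t) (Icc 0 1) ρ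

/-- `∂u/∂t` on `[0, T]` (one-sided at the end points). -/
def dt (T : ℝ) (u : ℝ → ℝ → ℝ) (ρ t : ℝ) : ℝ := derivWithin (u ρ) (Icc 0 T) t

/-- `u(ρ, t)` is of class `C²` in `ρ` with `∂²u/∂ρ²` of class `C¹` on `[0, 1] × [0, T]`, and it is
of class `C³` in `t` with `∂³u/∂t³` bounded. -/
structure Smooth (T : ℝ) (u : ℝ → ℝ → ℝ) : Prop where
  space : ∀ t ∈ Icc 0 T, ContDiffOn ℝ 2 (fun ρ => u ρ t) (Icc 0 1)
  second : ContDiffOn ℝ 1 (fun q : ℝ × ℝ => dρρ u q.1 q.2) (Icc 0 1 ×ˢ Icc 0 T)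
  time : ∀ ρ ∈ Icc (0 : ℝ) 1, ContDiffOn ℝ 3 (u ρ) (Icc 0 T)
  time_bdd : ∃ C : ℝ, ∀ ρ ∈ Icc (0 : ℝ) 1, ∀ t ∈ Icc 0 T,
    |iteratedDerivWithin 3 (u ρ) (Icc 0 T) t| ≤ C

/-- Smooth solutions `(L, H, F, v, R)` on `[0, 1] × [0, T]` of the front-fixed system with Neumann
conditions, with initial data `(φL, φH, φF, ε)`. -/
structure IsSolution (p : Params) (T ε : ℝ) (φL φH φF : ℝ → ℝ)
    (L H F v : ℝ → ℝ → ℝ) (R : ℝ → ℝ) : Prop where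
  smoothL : Smooth T L
  smoothH : Smooth T H
  smoothF : Smooth T F
  /-- The front stays inside the artery. -/
  front_mem : ∀ t ∈ Icc 0 T, R t ∈ Ioo (0 : ℝ) 1
  /-- The denominators of the reaction terms do not vanish. -/
  denL : ∀ ρ ∈ Icc (0 : ℝ) 1, ∀ t ∈ Icc 0 T, p.K1 + hatL p ρ (R t) (L ρ t) ≠ 0
  denF : ∀ ρ ∈ Icc (0 : ℝ) 1, ∀ t ∈ Icc 0 T, p.K2 + hatF p ρ (R t) (F ρ t) ≠ 0
  denH : ∀ ρ ∈ Icc (0 : ℝ) 1, ∀ t ∈ Icc 0 T, p.del + hatH p ρ (R t) (H ρ t) ≠ 0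
  eqL : ∀ ρ ∈ Ioo (0 : ℝ) 1, ∀ t ∈ Ioo 0 T,
    dt T L ρ t - 1 / (1 - R t) ^ 2 * dρρ L ρ t + convL p ρ (R t) (v 0 t) * dρ L ρ t
      = fL p ρ (R t) (v 0 t) (L ρ t) (F ρ t)
  eqH : ∀ ρ ∈ Ioo (0 : ℝ) 1, ∀ t ∈ Ioo 0 T,
    dt T H ρ t - 1 / (1 - R t) ^ 2 * dρρ H ρ t + convL p ρ (R t) (v 0 t) * dρ H ρ t
      = fH p ρ (R t) (v 0 t) (H ρ t) (F ρ t)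
  eqF : ∀ ρ ∈ Ioo (0 : ℝ) 1, ∀ t ∈ Ioo 0 T,
    dt T F ρ t - p.D / (1 - R t) ^ 2 * dρρ F ρ t + convF p ρ (R t) (v 0 t) (v ρ t) * dρ F ρ t
      = fF p ρ (R t) (v 0 t) (v ρ t) (L ρ t) (H ρ t) (F ρ t)
  eqv : ∀ t ∈ Icc 0 T, ∀ ρ ∈ Icc (0 : ℝ) 1,
    HasDerivWithinAt (fun x => v x t)
      ((1 - R t) * fv p ρ (R t) (L ρ t) (H ρ t) (F ρ t)) (Icc 0 1) ρ
  eqR : ∀ t ∈ Icc 0 T, HasDerivWithinAt R (v 0 t) (Icc 0 T) t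
  bcL : ∀ t ∈ Icc 0 T, dρ L 0 t = 0 ∧ dρ L 1 t = 0
  bcH : ∀ t ∈ Icc 0 T, dρ H 0 t = 0 ∧ dρ H 1 t = 0
  bcF : ∀ t ∈ Icc 0 T, dρ F 0 t = 0 ∧ dρ F 1 t = 0
  bcv : ∀ t ∈ Icc 0 T, v 1 t = 0
  initL : ∀ ρ ∈ Icc (0 : ℝ) 1, L ρ 0 = φL ρ
  initH : ∀ ρ ∈ Icc (0 : ℝ) 1, H ρ 0 = φH ρ
  initF : ∀ ρ ∈ Icc (0 : ℝ) 1, F ρ 0 = φF ρ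
  initR : R 0 = ε

/-! ### The numerical scheme -/

/-- Membership in the trial space: polynomials of degree at most `N + 2` whose derivative vanishes
at `0` and at `1`. -/
def IsTrial (N : ℕ) (u : ℝ[X]) : Prop :=
  u ∈ degreeLE ℝ (N + 2 : ℕ) ∧ u.derivative.eval 0 = 0 ∧ u.derivative.eval 1 = 0

/-- `q` is the orthogonal projection of `u` in `L²(0, 1)` onto the polynomials of degree at most
`N`. -/
def IsOrthProj (N : ℕ) (u : ℝ → ℝ) (q : ℝ[X]) : Prop :=
  q ∈ degreeLE ℝ N ∧
    ∀ w ∈ degreeLE ℝ N, ∫ ρ in (0 : ℝ)..1, (q.eval ρ - u ρ) * w.eval ρ = 0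

/-- The Legendre–Gauss–Lobatto nodes of `[0, 1]`: the end points and the zeros of the derivative of
the shifted Legendre polynomial of degree `N` (in all `N + 1` nodes, for `N ≥ 1`). -/
def lglNodes (N : ℕ) : Finset ℝ :=
  (X * (1 - X) * derivative ((shiftedLegendre N).map (Int.castRingHom ℝ))).roots.toFinset

/-- The Legendre–Gauss–Lobatto interpolation operator. -/
def lglInterp (N : ℕ) (g : ℝ → ℝ) : ℝ[X] := Lagrange.interpolate (lglNodes N) id g

/-- One step of the discretisation of `∂u/∂t - d ∂²u/∂ρ² + G ∂u/∂ρ = f`: from the values `u0`, `u1`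
and the right-hand sides `f0`, `f1` at two consecutive time levels to the trial function `u2` at
the next one, namely `Π (u2 - h* d u2'' + h* G u2') = I (Π (u1 - (u0 - u1) / 3) + h* (2 f1 - f0))`
with the projection `Π` and the interpolation `I`. -/
def CollocStep (N : ℕ) (hs d : ℝ) (G : ℝ → ℝ) (u0 u1 : ℝ[X]) (f0 f1 : ℝ → ℝ) (u2 : ℝ[X]) : Prop :=
  IsTrial N u2 ∧ ∃ q : ℝ[X],
    IsOrthProj N (fun ρ => u1.eval ρ - (u0.eval ρ - u1.eval ρ) / 3) q ∧
    IsOrthProj N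
      (fun ρ => u2.eval ρ - hs * d * (derivative (derivative u2)).eval ρ
        + hs * (G ρ * (derivative u2).eval ρ))
      (lglInterp N fun ρ => q.eval ρ + hs * (2 * f1 ρ - f0 ρ))

/-- The numerical unknowns at one time level. -/
structure Level where
  (L H F : ℝ[X])
  R : ℝ

/-- The scheme with `M` steps, `h* = hs`, and polynomials of size `N`: `S n` and `v n` approximate
`(L, H, F, R)` and `v` at time `t_n`. -/
structure IsScheme (p : Params) (M N : ℕ) (hs : ℝ) (S : ℕ → Level) (v : ℕ → ℝ → ℝ) : Prop where
  eqv : ∀ n < M, ∀ ρ ∈ Icc (0 : ℝ) 1,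
    HasDerivWithinAt (v n)
      ((1 - (S n).R) * fv p ρ (S n).R ((S n).L.eval ρ) ((S n).H.eval ρ) ((S n).F.eval ρ))
      (Icc 0 1) ρ
  bcv : ∀ n < M, v n 1 = 0
  eqR : ∀ n, n + 2 ≤ M →
    (S (n + 2)).R = (S (n + 1)).R - ((S n).R - (S (n + 1)).R) / 3
      + hs * (2 * v (n + 1) 0 - v n 0)
  eqL : ∀ n, n + 2 ≤ M →
    CollocStep N hs (1 / (1 - (S (n + 2)).R) ^ 2)
      (fun ρ => convL p ρ (S (n + 2)).R (2 * v (n + 1) 0 - v n 0))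
      (S n).L (S (n + 1)).L
      (fun ρ => fL p ρ (S n).R (v n 0) ((S n).L.eval ρ) ((S n).F.eval ρ))
      (fun ρ => fL p ρ (S (n + 1)).R (v (n + 1) 0) ((S (n + 1)).L.eval ρ) ((S (n + 1)).F.eval ρ))
      (S (n + 2)).L
  eqH : ∀ n, n + 2 ≤ M →
    CollocStep N hs (1 / (1 - (S (n + 2)).R) ^ 2)
      (fun ρ => convL p ρ (S (n + 2)).R (2 * v (n + 1) 0 - v n 0))
      (S n).H (S (n + 1)).H
      (fun ρ => fH p ρ (S n).R (v n 0) ((S n).H.eval ρ) ((S n).F.eval ρ))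
      (fun ρ => fH p ρ (S (n + 1)).R (v (n + 1) 0) ((S (n + 1)).H.eval ρ) ((S (n + 1)).F.eval ρ))
      (S (n + 2)).H
  eqF : ∀ n, n + 2 ≤ M →
    CollocStep N hs (p.D / (1 - (S (n + 2)).R) ^ 2)
      (fun ρ => convF p ρ (S (n + 2)).R (2 * v (n + 1) 0 - v n 0) (2 * v (n + 1) ρ - v n ρ))
      (S n).F (S (n + 1)).F
      (fun ρ => fF p ρ (S n).R (v n 0) (v n ρ)
        ((S n).L.eval ρ) ((S n).H.eval ρ) ((S n).F.eval ρ))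
      (fun ρ => fF p ρ (S (n + 1)).R (v (n + 1) 0) (v (n + 1) ρ)
        ((S (n + 1)).L.eval ρ) ((S (n + 1)).H.eval ρ) ((S (n + 1)).F.eval ρ))
      (S (n + 2)).F

/-! ### Errors -/

/-- The norm of `L²(0, 1)` with weight `1`. -/
def norm2 (u : ℝ → ℝ) : ℝ := Real.sqrt (∫ ρ in (0 : ℝ)..1, u ρ ^ 2)

/-- The error `ξ` of a numerical level `A` at time `t`. -/
def xi (L H F : ℝ → ℝ → ℝ) (R : ℝ → ℝ) (A : Level) (t : ℝ) : ℝ :=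
  norm2 (fun ρ => A.L.derivative.eval ρ - dρ L ρ t)
    + norm2 (fun ρ => A.H.derivative.eval ρ - dρ H ρ t)
    + norm2 (fun ρ => A.F.derivative.eval ρ - dρ F ρ t)
    + |A.R - R t|

/-- The `L²` error of the values of a numerical level `A` at time `t`. -/
def xiZero (L H F : ℝ → ℝ → ℝ) (A : Level) (t : ℝ) : ℝ :=
  norm2 (fun ρ => A.L.eval ρ - L ρ t) + norm2 (fun ρ => A.H.eval ρ - H ρ t)
    + norm2 (fun ρ => A.F.eval ρ - F ρ t)

/-- The level `A` consists of trial functions and is within `b` of the exact solution at time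
`t`. -/
def IsStart (N : ℕ) (L H F : ℝ → ℝ → ℝ) (R : ℝ → ℝ) (b : ℝ) (A : Level) (t : ℝ) : Prop :=
  IsTrial N A.L ∧ IsTrial N A.H ∧ IsTrial N A.F ∧ xi L H F R A t + xiZero L H F A t ≤ b

end Plaque

end

open Plaque

noncomputable section

namespace Plaque

/-! ### Integrals of polynomials over `[0, 1]` -/

/-! The scheme is the two-step backward difference method (BDF2), implicit in diffusion and
convection, with velocities and reactions extrapolated from the two old levels. The new front is
therefore explicit and each step amounts to three square linear systems, for which existence follows
from uniqueness; uniqueness holds for small `h` (`exists_collocStep`).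

The numerical levels are compared with auxiliary trial functions `U t` rather than with the exact
solution. These arise by integrating twice a Bernstein polynomial of `∂²u/∂ρ²` from which its mean
has been subtracted, so the Neumann conditions hold exactly. They are `ω N`-close to `u` in `C²`,
and `U t - u` is Lipschitz in time with constant `ω N`. The Lipschitz bound is essential because the
backward difference quotient divides by `h` (`Smooth.exists_approx`). No rate is needed, only `ω N →
0`.

The error `e = u - U` is again a trial function, so `e''` has degree at most `N` and is a legitimate
test function despite the projection. Testing with `e''`, the `G`-stability identity of BDF2 for the
gradients leaves a telescoping energy, and the diffusion term `d ‖e''‖²` absorbs the pairing of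
`e''` with convection and residual. Testing with `1` controls the mean of `e` (`energy_step`,
`component_step`). Together this controls `e` in `H¹`, hence uniformly on `[0, 1]`.

Uniform closeness tames the nonlinearities. Reactions, coefficients and the velocity field are `C²`
near the compact set of exact states, hence Lipschitz there, and their second differences along the
exact solution are `O(h²)`, which makes extrapolation and front equation second order accurate
(`IsSolution.pre_step`). Interpolation turns uniform bounds into `L²` bounds with constant one,
because the Gauss–Lobatto weights are nonnegative, sum to one, and the quadrature overestimates
squares of polynomials of degree `N` (`intg_lglInterp_sq_le`).

One step thus yields `E₂ ≤ E₁ + C h (E₂ + E₁ + (h² + ω)²)` as long as `E₁` is small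
(`IsSolution.step_estimate`). The discrete Gronwall inequality preserves smallness, so error bound,
existence of the velocities and solvability propagate together up to time `T`
(`IsSolution.scheme_estimate`). The final rate is `K = (ω + √κ)²`. -/

lemma intervalIntegrable_eval (p : ℝ[X]) (a b : ℝ) :
    IntervalIntegrable (fun x => p.eval x) MeasureTheory.volume a b :=
  p.continuous.intervalIntegrable a b

/-- The integral over `[0, 1]` as a linear functional on polynomials. -/
def intg : ℝ[X] →ₗ[ℝ] ℝ where
  toFun p := ∫ ρ in (0 : ℝ)..1, p.eval ρ
  map_add' p q := by
    simp only [eval_add]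
    exact intervalIntegral.integral_add (intervalIntegrable_eval p 0 1)
      (intervalIntegrable_eval q 0 1)
  map_smul' c p := by simp

lemma intg_apply (p : ℝ[X]) : intg p = ∫ ρ in (0 : ℝ)..1, p.eval ρ := rfl

lemma intg_derivative (p : ℝ[X]) : intg (derivative p) = p.eval 1 - p.eval 0 := by
  rw [intg_apply]
  exact intervalIntegral.integral_eq_sub_of_hasDerivAt (fun x _ => p.hasDerivAt x)
    (intervalIntegrable_eval _ 0 1)

lemma intg_nonneg {p : ℝ[X]} (h : ∀ x ∈ Icc (0 : ℝ) 1, 0 ≤ p.eval x) : 0 ≤ intg p :=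
  intervalIntegral.integral_nonneg zero_le_one h

lemma intg_mono {p q : ℝ[X]} (h : ∀ x ∈ Icc (0 : ℝ) 1, p.eval x ≤ q.eval x) :
    intg p ≤ intg q :=
  intervalIntegral.integral_mono_on zero_le_one (intervalIntegrable_eval p 0 1)
    (intervalIntegrable_eval q 0 1) h

lemma intg_C (c : ℝ) : intg (C c) = c := by simp [intg_apply]

lemma intg_sq_nonneg (p : ℝ[X]) : 0 ≤ intg (p ^ 2) :=
  intg_nonneg fun x _ => by simpa using sq_nonneg (p.eval x)

lemma eq_zero_of_intg_sq {p : ℝ[X]} (h : intg (p ^ 2) = 0) : p = 0 := by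
  by_contra hp
  obtain ⟨x, hx, hpx⟩ : ∃ x ∈ Icc (0 : ℝ) 1, p.eval x ≠ 0 := by
    by_contra! hcon
    exact hp (eq_zero_of_infinite_isRoot p
      ((Icc_infinite (zero_lt_one' ℝ)).mono fun x hx => hcon x hx))
  have : 0 < ∫ ρ in (0 : ℝ)..1, (p ^ 2).eval ρ :=
    intervalIntegral.integral_pos zero_lt_one (p ^ 2).continuous.continuousOn
      (fun y _ => by simpa using sq_nonneg (p.eval y)) ⟨x, hx, by simpa using pow_pos_of_ne hpx⟩
  rw [← intg_apply, h] at this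
  exact lt_irrefl _ this
where
  pow_pos_of_ne {a : ℝ} (h : a ≠ 0) : 0 < a ^ 2 := by positivity

/-! ### Legendre–Gauss–Lobatto nodes -/

/-- Rolle's theorem for finite sets of roots of a polynomial. -/
lemma exists_roots_derivative (p : ℝ[X]) {m : ℕ} (s : Finset ℝ) (hs : s.card = m + 1)
    (hp : ∀ x ∈ s, p.eval x = 0) :
    ∃ t : Finset ℝ, t.card = m ∧ ∀ y ∈ t, (derivative p).eval y = 0 ∧
      (∃ a ∈ s, a < y) ∧ ∃ b ∈ s, y < b := by
  set e := s.orderEmbOfFin hs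
  have key : ∀ i : Fin m, ∃ y, e i.castSucc < y ∧ y < e i.succ ∧ (derivative p).eval y = 0 := by
    intro i
    have hlt : e i.castSucc < e i.succ := e.strictMono i.castSucc_lt_succ
    obtain ⟨y, hy, hy'⟩ := exists_deriv_eq_zero (f := fun x => p.eval x) hlt
      p.continuous.continuousOn
      (by rw [hp _ (s.orderEmbOfFin_mem hs _), hp _ (s.orderEmbOfFin_mem hs _)])
    exact ⟨y, hy.1, hy.2, by simpa using hy'⟩
  choose y hy1 hy2 hy3 using key
  have hmono : StrictMono y := by
    intro i j hij
    exact (hy2 i).trans_le ((e.monotone (by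
      rw [Fin.le_def]; simpa using hij)).trans (hy1 j).le)
  refine ⟨Finset.univ.image y, ?_, ?_⟩
  · rw [Finset.card_image_of_injective _ hmono.injective, Finset.card_univ, Fintype.card_fin]
  · intro z hz
    obtain ⟨i, -, rfl⟩ := Finset.mem_image.1 hz
    exact ⟨hy3 i, ⟨_, s.orderEmbOfFin_mem hs _, hy1 i⟩, ⟨_, s.orderEmbOfFin_mem hs _, hy2 i⟩⟩

/-- The iterated derivatives in Rodrigues' formula. -/
def rodrigues (N k : ℕ) : ℝ[X] := derivative^[k] (X ^ N * (1 - X) ^ N)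

lemma rodrigues_succ (N k : ℕ) : rodrigues N (k + 1) = derivative (rodrigues N k) :=
  Function.iterate_succ_apply' _ _ _

/-- After `k < N` derivatives the factors `X ^ (N - k)` and `(1 - X) ^ (N - k)` survive. -/
lemma rodrigues_eval {N k : ℕ} (h : k < N) :
    (rodrigues N k).eval 0 = 0 ∧ (rodrigues N k).eval 1 = 0 := by
  have h0 : (X : ℝ[X]) ^ (N - k) ∣ rodrigues N k :=
    pow_sub_dvd_iterate_derivative_of_pow_dvd k (Dvd.intro _ rfl)
  have h1 : (1 - X : ℝ[X]) ^ (N - k) ∣ rodrigues N k :=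
    pow_sub_dvd_iterate_derivative_of_pow_dvd k (Dvd.intro_left _ rfl)
  have hk : N - k ≠ 0 := by omega
  constructor
  · obtain ⟨q, hq⟩ := h0
    simp [hq, hk]
  · obtain ⟨q, hq⟩ := h1
    simp [hq, hk]

/-- Each derivative gains one interior zero: the `k` interior zeros together with the two end points
are `k + 2` zeros, between which Rolle finds `k + 1`. -/
lemma rodrigues_roots {N k : ℕ} (h : k ≤ N) :
    ∃ t : Finset ℝ, t.card = k ∧ ∀ y ∈ t, (rodrigues N k).eval y = 0 ∧ y ∈ Ioo (0 : ℝ) 1 := by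
  induction k with
  | zero => exact ⟨∅, rfl, by simp⟩
  | succ k ih =>
    obtain ⟨t, ht, hroot⟩ := ih (by omega)
    have h1 : (1 : ℝ) ∉ t := fun hm => lt_irrefl _ (hroot 1 hm).2.2
    have h0 : (0 : ℝ) ∉ insert (1 : ℝ) t := by
      rw [Finset.mem_insert, not_or]
      exact ⟨zero_ne_one, fun hm => lt_irrefl _ (hroot 0 hm).2.1⟩
    have hev := rodrigues_eval (N := N) (k := k) (by omega)
    obtain ⟨t', ht', hroot'⟩ := exists_roots_derivative (rodrigues N k) (m := k + 1)
      (insert 0 (insert 1 t)) (by rw [Finset.card_insert_of_notMem h0,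
        Finset.card_insert_of_notMem h1, ht])
      (by
        intro x hx
        simp only [Finset.mem_insert] at hx
        rcases hx with rfl | rfl | hx
        exacts [hev.1, hev.2, (hroot x hx).1])
    have hS : ∀ x ∈ insert (0 : ℝ) (insert 1 t), x ∈ Icc (0 : ℝ) 1 := by
      intro x hx
      simp only [Finset.mem_insert] at hx
      rcases hx with rfl | rfl | hx
      exacts [⟨le_rfl, zero_le_one⟩, ⟨zero_le_one, le_rfl⟩, Ioo_subset_Icc_self (hroot x hx).2]
    refine ⟨t', ht', fun y hy => ?_⟩
    obtain ⟨h1, ⟨a, ha, hay⟩, b, hb, hyb⟩ := hroot' y hy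
    exact ⟨by rw [rodrigues_succ]; exact h1, (hS a ha).1.trans_lt hay, hyb.trans_le (hS b hb).2⟩

/-- Repeated integration by parts: the boundary terms vanish, and `q` loses one degree for each
derivative moved onto it. -/
lemma intg_rodrigues_mul {N k : ℕ} (h : k ≤ N) (q : ℝ[X]) (hq : q.degree < k) :
    intg (rodrigues N k * q) = 0 := by
  induction k generalizing q with
  | zero =>
    have : q = 0 := by
      by_contra h0
      rw [degree_eq_natDegree h0] at hq
      exact absurd (by exact_mod_cast hq) (Nat.not_lt_zero q.natDegree)
    simp [this]
  | succ k ih =>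
    have hev := rodrigues_eval (N := N) (k := k) (by omega)
    have hsplit : rodrigues N (k + 1) * q
        = derivative (rodrigues N k * q) - rodrigues N k * derivative q := by
      rw [rodrigues_succ, derivative_mul]; ring
    have hq' : (derivative q).degree < k := by
      rcases eq_or_ne q 0 with rfl | h0
      · simp
      · rcases Nat.eq_zero_or_pos q.natDegree with hd | hd
        · rw [eq_C_of_natDegree_eq_zero hd]; simp
        · have h1 := degree_derivative_lt h0
          rw [degree_eq_natDegree h0] at h1 hq
          have h2 : q.natDegree ≤ k := by
            have : q.natDegree < k + 1 := by exact_mod_cast hq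
            omega
          exact h1.trans_le (by exact_mod_cast h2)
    rw [hsplit, map_sub, ih (by omega) _ hq', intg_derivative]
    simp [hev.1, hev.2]

/-- The shifted Legendre polynomial with real coefficients. -/
abbrev legendre (N : ℕ) : ℝ[X] := (shiftedLegendre N).map (Int.castRingHom ℝ)

lemma rodrigues_eq (N : ℕ) : rodrigues N N = C (N.factorial : ℝ) * legendre N := by
  have h := congrArg (Polynomial.map (Int.castRingHom ℝ)) (factorial_mul_shiftedLegendre_eq N)
  rw [Polynomial.map_mul, ← iterate_derivative_map] at h
  simp only [Polynomial.map_mul, Polynomial.map_pow, Polynomial.map_sub, Polynomial.map_X,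
    Polynomial.map_one, Polynomial.map_natCast] at h
  rw [rodrigues, ← h]
  simp

lemma natDegree_legendre (N : ℕ) : (legendre N).natDegree = N := by
  rw [legendre, natDegree_map_eq_of_injective (RingHom.injective_int _), natDegree_shiftedLegendre]

lemma intg_legendre_mul {N : ℕ} (q : ℝ[X]) (hq : q.degree < N) : intg (legendre N * q) = 0 := by
  have h := intg_rodrigues_mul le_rfl q hq
  rw [rodrigues_eq, mul_assoc, ← smul_eq_C_mul, map_smul, smul_eq_mul] at h
  exact (mul_eq_zero.1 h).resolve_left (by positivity)

/-- Rolle between the `N` zeros of the Legendre polynomial gives `N - 1` zeros of its derivative.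
Since the derivative has degree `N - 1`, there are no others and all are simple. -/
lemma exists_derivative_legendre {N : ℕ} (hN : 1 ≤ N) :
    ∃ t : Finset ℝ, ∃ c : ℝ, c ≠ 0 ∧ t.card + 1 = N ∧ (∀ y ∈ t, y ∈ Ioo (0 : ℝ) 1) ∧
      derivative (legendre N) = C c * ∏ y ∈ t, (X - C y) := by
  obtain ⟨s, hs, hroot⟩ := rodrigues_roots (le_refl N)
  obtain ⟨m, rfl⟩ : ∃ m, N = m + 1 := ⟨N - 1, by omega⟩
  obtain ⟨t, ht, hroot'⟩ := exists_roots_derivative (legendre (m + 1)) s hs (fun x hx => by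
    have := (hroot x hx).1
    rw [rodrigues_eq, eval_mul, eval_C] at this
    exact (mul_eq_zero.1 this).resolve_left (by positivity))
  have hdeg : (derivative (legendre (m + 1))).natDegree = m := by
    rw [natDegree_derivative, natDegree_legendre]; rfl
  have hne : derivative (legendre (m + 1)) ≠ 0 := by
    intro h0
    have := derivative_eq_zero.1 h0
    rw [natDegree_legendre] at this
    omega
  have hsub : t ⊆ (derivative (legendre (m + 1))).roots.toFinset := fun y hy => by
    rw [Multiset.mem_toFinset, mem_roots hne]
    exact (hroot' y hy).1
  have hval : t.val = (derivative (legendre (m + 1))).roots := by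
    refine Multiset.eq_of_le_of_card_le ?_ ?_
    · exact (Multiset.le_iff_subset t.nodup).2 fun y hy => Multiset.mem_toFinset.1 (hsub hy)
    · exact (card_roots' _).trans (by rw [hdeg]; exact ht.ge)
  refine ⟨t, (derivative (legendre (m + 1))).leadingCoeff, leadingCoeff_ne_zero.2 hne, by omega,
    fun y hy => ?_, ?_⟩
  · obtain ⟨-, ⟨a, ha, hay⟩, b, hb, hyb⟩ := hroot' y hy
    exact ⟨(hroot a ha).2.1.trans hay, hyb.trans (hroot b hb).2.2⟩
  · have h := C_leadingCoeff_mul_prod_multiset_X_sub_C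
      (p := derivative (legendre (m + 1))) (by rw [← hval, hdeg]; exact ht)
    rw [← hval] at h
    exact h.symm

/-- Description of the nodes: the end points and `N - 1` interior points, whose nodal polynomial is
orthogonal to all polynomials of degree less than `N - 1`. -/
lemma exists_lglNodes {N : ℕ} (hN : 1 ≤ N) :
    ∃ t : Finset ℝ, t.card + 1 = N ∧ (∀ y ∈ t, y ∈ Ioo (0 : ℝ) 1) ∧
      lglNodes N = insert 0 (insert 1 t) ∧
      ∀ s : ℝ[X], s.natDegree + 2 ≤ N → intg (X * (1 - X) * (∏ y ∈ t, (X - C y)) * s) = 0 := by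
  obtain ⟨t, c, hc, ht, hmem, hder⟩ := exists_derivative_legendre hN
  refine ⟨t, ht, hmem, ?_, fun s hs => ?_⟩
  · have hX : (1 - X : ℝ[X]) = C (-1) * (X - C 1) := by simp
    have hW : X * (1 - X) * derivative (legendre N)
        = C (-c) * ∏ y ∈ insert 0 (insert 1 t), (X - C y) := by
      have h1 : (1 : ℝ) ∉ t := fun hm => lt_irrefl _ (hmem 1 hm).2
      have h0 : (0 : ℝ) ∉ insert (1 : ℝ) t := by
        rw [Finset.mem_insert, not_or]
        exact ⟨zero_ne_one, fun hm => lt_irrefl _ (hmem 0 hm).1⟩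
      rw [Finset.prod_insert h0, Finset.prod_insert h1, hder, hX]
      simp only [C_neg, C_0, C_1, sub_zero]
      ring
    change (X * (1 - X) * derivative (legendre N)).roots.toFinset = _
    rw [hW, roots_C_mul _ (neg_ne_zero.2 hc), roots_prod_X_sub_C, Finset.val_toFinset]
  -- Orthogonality of the nodal polynomial: `X (1 - X)` kills the boundary terms, and `(X (1 - X)
  -- s)'` has degree below `N`, hence is orthogonal to the Legendre polynomial.
  · have h1 : intg (derivative (legendre N * (X * (1 - X) * s))) = 0 := by
      rw [intg_derivative]; simp
    rw [derivative_mul, map_add, intg_legendre_mul, add_zero, hder] at h1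
    · have h2 : C c * (∏ y ∈ t, (X - C y)) * (X * (1 - X) * s)
          = c • (X * (1 - X) * (∏ y ∈ t, (X - C y)) * s) := by
        rw [smul_eq_C_mul]; ring
      rw [h2, map_smul, smul_eq_mul] at h1
      exact (mul_eq_zero.1 h1).resolve_left hc
    · have hd : (X * (1 - X) * s).natDegree ≤ N := by
        have h1 : (1 - X : ℝ[X]).natDegree ≤ 1 := (natDegree_sub_le _ _).trans (by simp)
        have h2 := natDegree_mul_le (p := X * (1 - X)) (q := s)
        have h3 := natDegree_mul_le (p := (X : ℝ[X])) (q := 1 - X)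
        rw [natDegree_X] at h3
        omega
      rcases eq_or_ne (X * (1 - X) * s) 0 with h0 | h0
      · rw [h0]; simp
      · refine (degree_derivative_lt h0).trans_le ?_
        exact degree_le_of_natDegree_le hd

lemma card_lglNodes {N : ℕ} (hN : 1 ≤ N) : (lglNodes N).card = N + 1 := by
  obtain ⟨t, ht, hmem, hS, -⟩ := exists_lglNodes hN
  have h1 : (1 : ℝ) ∉ t := fun hm => lt_irrefl _ (hmem 1 hm).2
  have h0 : (0 : ℝ) ∉ insert (1 : ℝ) t := by
    rw [Finset.mem_insert, not_or]
    exact ⟨zero_ne_one, fun hm => lt_irrefl _ (hmem 0 hm).1⟩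
  rw [hS, Finset.card_insert_of_notMem h0, Finset.card_insert_of_notMem h1]
  omega

lemma lglNodes_subset {N : ℕ} (hN : 1 ≤ N) {x : ℝ} (hx : x ∈ lglNodes N) : x ∈ Icc (0 : ℝ) 1 := by
  obtain ⟨t, ht, hmem, hS, -⟩ := exists_lglNodes hN
  rw [hS] at hx
  simp only [Finset.mem_insert] at hx
  rcases hx with rfl | rfl | hx
  exacts [⟨le_rfl, zero_le_one⟩, ⟨zero_le_one, le_rfl⟩, Ioo_subset_Icc_self (hmem x hx)]

/-! ### Legendre–Gauss–Lobatto interpolation -/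

lemma degree_lglInterp {N : ℕ} (hN : 1 ≤ N) (g : ℝ → ℝ) : (lglInterp N g).degree ≤ N := by
  have h := Lagrange.degree_interpolate_lt g (s := lglNodes N) (v := id) (injOn_id _)
  rw [card_lglNodes hN] at h
  rw [lglInterp]
  exact degree_le_iff_coeff_zero _ _ |>.2 fun m hm => coeff_eq_zero_of_degree_lt
    (h.trans_le (by exact_mod_cast hm))

lemma lglInterp_mem {N : ℕ} (hN : 1 ≤ N) (g : ℝ → ℝ) : lglInterp N g ∈ degreeLE ℝ N :=
  mem_degreeLE.2 (degree_lglInterp hN g)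

lemma lglInterp_eval {N : ℕ} {q : ℝ[X]} (hN : 1 ≤ N) (hq : q ∈ degreeLE ℝ N) :
    lglInterp N (fun ρ => q.eval ρ) = q := by
  refine (Lagrange.eq_interpolate_of_eval_eq (s := lglNodes N) (v := id) (fun ρ => q.eval ρ)
    (injOn_id _) ?_ fun i _ => rfl).symm
  rw [card_lglNodes hN]
  exact (mem_degreeLE.1 hq).trans_lt (by exact_mod_cast Nat.lt_succ_self N)

lemma lglInterp_add (N : ℕ) (f g : ℝ → ℝ) :
    lglInterp N (f + g) = lglInterp N f + lglInterp N g := map_add _ _ _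

lemma lglInterp_smul (N : ℕ) (c : ℝ) (f : ℝ → ℝ) :
    lglInterp N (c • f) = c • lglInterp N f := map_smul _ _ _

lemma eval_lglInterp {N : ℕ} (g : ℝ → ℝ) {x : ℝ} (hx : x ∈ lglNodes N) :
    (lglInterp N g).eval x = g x :=
  Lagrange.eval_interpolate_at_node (v := id) g (injOn_id _) hx

/-! ### Legendre–Gauss–Lobatto quadrature -/

lemma monic_nodal (s : Finset ℝ) : (∏ y ∈ s, (X - C y)).Monic :=
  monic_prod_of_monic _ _ fun y _ => monic_X_sub_C y

lemma natDegree_nodal (s : Finset ℝ) : (∏ y ∈ s, (X - C y)).natDegree = s.card := by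
  rw [natDegree_prod_of_monic _ _ fun y _ => monic_X_sub_C y]; simp

lemma eval_nodal {s : Finset ℝ} {x : ℝ} (hx : x ∈ s) : (∏ y ∈ s, (X - C y)).eval x = 0 := by
  rw [eval_prod]; exact Finset.prod_eq_zero hx (by simp)

/-- The weights of the Legendre–Gauss–Lobatto quadrature. -/
def lglWeight (N : ℕ) (x : ℝ) : ℝ := intg (Lagrange.basis (lglNodes N) id x)

/-- Exactness of the quadrature for polynomials of degree at most `2 N - 1`. -/
lemma intg_eq_sum {N : ℕ} (hN : 2 ≤ N) (p : ℝ[X]) (hp : p.natDegree + 1 ≤ 2 * N) :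
    intg p = ∑ x ∈ lglNodes N, p.eval x * lglWeight N x := by
  obtain ⟨t, ht, hmem, hS, horth⟩ := exists_lglNodes (by omega : 1 ≤ N)
  set W : ℝ[X] := ∏ y ∈ lglNodes N, (X - C y) with hW
  have hWm : W.Monic := monic_nodal _
  have hWd : W.natDegree = N + 1 := by rw [hW, natDegree_nodal, card_lglNodes (by omega)]
  have h1 : (1 : ℝ) ∉ t := fun hm => lt_irrefl _ (hmem 1 hm).2
  have h0 : (0 : ℝ) ∉ insert (1 : ℝ) t := by
    rw [Finset.mem_insert, not_or]
    exact ⟨zero_ne_one, fun hm => lt_irrefl _ (hmem 0 hm).1⟩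
  have hW' : W = (-1 : ℝ) • (X * (1 - X) * ∏ y ∈ t, (X - C y)) := by
    rw [hW, hS, Finset.prod_insert h0, Finset.prod_insert h1, neg_one_smul]
    simp only [C_0, C_1, sub_zero]
    ring
  -- Division by the nodal polynomial: the quotient has degree at most `N - 2`, so its product with
  -- `W` integrates to zero, while the remainder agrees with `p` at the nodes and is reproduced by
  -- interpolation.
  have hdiv : p %ₘ W + W * (p /ₘ W) = p := modByMonic_add_div p W
  have hquot : intg (W * (p /ₘ W)) = 0 := by
    rw [hW', smul_mul_assoc, map_smul, ← hW', horth, smul_zero]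
    rw [natDegree_divByMonic _ hWm, hWd]
    omega
  have hr : p %ₘ W ∈ degreeLE ℝ N := by
    rw [mem_degreeLE]
    have h := degree_modByMonic_lt p hWm
    rw [degree_eq_natDegree hWm.ne_zero, hWd] at h
    exact (degree_le_iff_coeff_zero _ _).2 fun m hm => coeff_eq_zero_of_degree_lt
      (h.trans_le (by exact_mod_cast hm))
  have hev : ∀ x ∈ lglNodes N, (p %ₘ W).eval x = p.eval x := by
    intro x hx
    conv_rhs => rw [← hdiv]
    rw [eval_add, eval_mul, eval_nodal hx, zero_mul, add_zero]
  have hI := lglInterp_eval (by omega : 1 ≤ N) hr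
  rw [← hdiv, map_add, hquot, add_zero, hdiv, ← hI, lglInterp, Lagrange.interpolate_apply, map_sum]
  refine Finset.sum_congr rfl fun x hx => ?_
  rw [← smul_eq_C_mul, map_smul, smul_eq_mul, hev x hx, lglWeight]

/-- Exactness is applied to a polynomial that is nonnegative on `[0, 1]` and vanishes at all nodes
but `x`. Squaring the product over the other interior nodes and adding the factors `X`, `1 - X` of
the other end points stays within degree `2 N - 1`. -/
lemma lglWeight_nonneg {N : ℕ} (hN : 2 ≤ N) {x : ℝ} (hx : x ∈ lglNodes N) :
    0 ≤ lglWeight N x := by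
  obtain ⟨t, ht, hmem, hS, -⟩ := exists_lglNodes (by omega : 1 ≤ N)
  have key : ∀ p : ℝ[X], p.natDegree + 1 ≤ 2 * N → (∀ y ∈ lglNodes N, y ≠ x → p.eval y = 0) →
      0 < p.eval x → (∀ y ∈ Icc (0 : ℝ) 1, 0 ≤ p.eval y) → 0 ≤ lglWeight N x := by
    intro p hp hz hpos hnn
    have h := intg_eq_sum hN p hp
    rw [Finset.sum_eq_single x (fun y hy hyx => by rw [hz y hy hyx, zero_mul])
      (fun hc => absurd hx hc)] at h
    have h2 := intg_nonneg hnn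
    rw [h] at h2
    exact nonneg_of_mul_nonneg_right h2 hpos
  have h1X : (1 - X : ℝ[X]).natDegree ≤ 1 := (natDegree_sub_le _ _).trans (by simp)
  have hx' := hx
  rw [hS] at hx'
  simp only [Finset.mem_insert] at hx'
  rcases hx' with rfl | rfl | hxt
  · refine key ((1 - X) * (∏ y ∈ t, (X - C y)) ^ 2) ?_ ?_ ?_ ?_
    · have h2 := natDegree_mul_le (p := (1 - X : ℝ[X])) (q := (∏ y ∈ t, (X - C y)) ^ 2)
      have h3 := natDegree_pow_le (p := ∏ y ∈ t, (X - C y)) (n := 2)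
      rw [natDegree_nodal] at h3
      omega
    · intro y hy hy0
      rw [hS] at hy
      simp only [Finset.mem_insert, hy0, false_or] at hy
      rcases hy with rfl | hy
      · simp
      · rw [eval_mul, eval_pow, eval_nodal hy]; simp
    · have : (∏ y ∈ t, (X - C y)).eval (0 : ℝ) ≠ 0 := by
        rw [eval_prod, Finset.prod_ne_zero_iff]
        intro y hy
        simpa using (hmem y hy).1.ne'
      simp only [eval_mul, eval_sub, eval_one, eval_X, eval_pow]
      positivity
    · intro y hy
      simp only [eval_mul, eval_sub, eval_one, eval_X, eval_pow]
      exact mul_nonneg (by linarith [hy.2]) (sq_nonneg _)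
  · refine key (X * (∏ y ∈ t, (X - C y)) ^ 2) ?_ ?_ ?_ ?_
    · have h2 := natDegree_mul_le (p := (X : ℝ[X])) (q := (∏ y ∈ t, (X - C y)) ^ 2)
      have h3 := natDegree_pow_le (p := ∏ y ∈ t, (X - C y)) (n := 2)
      rw [natDegree_nodal] at h3
      rw [natDegree_X] at h2
      omega
    · intro y hy hy0
      rw [hS] at hy
      simp only [Finset.mem_insert, hy0, false_or] at hy
      rcases hy with rfl | hy
      · simp
      · rw [eval_mul, eval_pow, eval_nodal hy]; simp
    · have : (∏ y ∈ t, (X - C y)).eval (1 : ℝ) ≠ 0 := by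
        rw [eval_prod, Finset.prod_ne_zero_iff]
        intro y hy
        simpa [sub_eq_zero] using (hmem y hy).2.ne'
      simp only [eval_mul, eval_X, eval_pow]
      positivity
    · intro y hy
      simp only [eval_mul, eval_X, eval_pow]
      exact mul_nonneg hy.1 (sq_nonneg _)
  · refine key (X * (1 - X) * (∏ y ∈ t.erase x, (X - C y)) ^ 2) ?_ ?_ ?_ ?_
    · have h2 := natDegree_mul_le (p := X * (1 - X : ℝ[X]))
        (q := (∏ y ∈ t.erase x, (X - C y)) ^ 2)
      have h3 := natDegree_pow_le (p := ∏ y ∈ t.erase x, (X - C y)) (n := 2)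
      have h4 := natDegree_mul_le (p := (X : ℝ[X])) (q := 1 - X)
      rw [natDegree_nodal, Finset.card_erase_of_mem hxt] at h3
      rw [natDegree_X] at h4
      omega
    · intro y hy hy0
      rw [hS] at hy
      simp only [Finset.mem_insert] at hy
      rcases hy with rfl | rfl | hy
      · simp
      · simp
      · rw [eval_mul, eval_pow, eval_nodal (Finset.mem_erase.2 ⟨hy0, hy⟩)]; simp
    · have : (∏ y ∈ t.erase x, (X - C y)).eval x ≠ 0 := by
        rw [eval_prod, Finset.prod_ne_zero_iff]
        intro y hy
        simpa [sub_eq_zero] using (Finset.ne_of_mem_erase hy).symm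
      have h0 := (hmem x hxt).1
      have h1 : 0 < 1 - x := sub_pos.2 (hmem x hxt).2
      simp only [eval_mul, eval_sub, eval_one, eval_X, eval_pow]
      positivity
    · intro y hy
      simp only [eval_mul, eval_sub, eval_one, eval_X, eval_pow]
      exact mul_nonneg (mul_nonneg hy.1 (by linarith [hy.2])) (sq_nonneg _)

/-- The quadrature overestimates the integral of the square of a polynomial of degree `N`. -/
lemma intg_sq_le_sum {N : ℕ} (hN : 2 ≤ N) {q : ℝ[X]} (hq : q.natDegree ≤ N) :
    intg (q ^ 2) ≤ ∑ x ∈ lglNodes N, q.eval x ^ 2 * lglWeight N x := by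
  obtain ⟨t, ht, hmem, hS, -⟩ := exists_lglNodes (by omega : 1 ≤ N)
  set V : ℝ[X] := X * (1 - X) * (∏ y ∈ t, (X - C y)) ^ 2 with hV
  set V' : ℝ[X] := X * ((X - C 1) * (∏ y ∈ t, (X - C y)) ^ 2) with hV'
  have hVV : V = -V' := by rw [hV, hV', C_1]; ring
  have hm : V'.Monic := monic_X.mul ((monic_X_sub_C 1).mul ((monic_nodal t).pow 2))
  have hd : V'.natDegree = 2 * N := by
    rw [hV', monic_X.natDegree_mul ((monic_X_sub_C 1).mul ((monic_nodal t).pow 2)),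
      (monic_X_sub_C 1).natDegree_mul ((monic_nodal t).pow 2), (monic_nodal t).natDegree_pow,
      natDegree_nodal, natDegree_X, natDegree_X_sub_C]
    omega
  have hc : V'.coeff (2 * N) = 1 := by rw [← hd]; exact hm
  -- `q ^ 2` may have degree `2 N`, one too many for exactness. `V` has leading coefficient `-1` in
  -- degree `2 N`, so the added multiple cancels the top term. It changes no nodal value, and being
  -- nonnegative on `[0, 1]` it only increases the integral.
  set p : ℝ[X] := q ^ 2 + C (q.coeff N ^ 2) * V with hp
  have hpd : p.natDegree + 1 ≤ 2 * N := by
    have h1 : p.natDegree ≤ 2 * N := by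
      refine natDegree_add_le_of_degree_le ((natDegree_pow_le).trans (by omega)) ?_
      refine (natDegree_C_mul_le _ _).trans ?_
      rw [hVV, natDegree_neg, hd]
    have h2 : p.coeff (2 * N) = 0 := by
      rw [hp, coeff_add, coeff_pow_of_natDegree_le hq, hVV, coeff_C_mul, coeff_neg, hc]
      ring
    have h3 : p.natDegree ≠ 2 * N := by
      intro h
      have : p.leadingCoeff = 0 := by rw [leadingCoeff, h, h2]
      rw [leadingCoeff_eq_zero] at this
      rw [this, natDegree_zero] at h
      omega
    omega
  have hle : intg (q ^ 2) ≤ intg p := by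
    rw [hp, map_add, le_add_iff_nonneg_right]
    refine intg_nonneg fun y hy => ?_
    simp only [hV, eval_mul, eval_sub, eval_one, eval_X, eval_pow, eval_C]
    exact mul_nonneg (sq_nonneg _)
      (mul_nonneg (mul_nonneg hy.1 (by linarith [hy.2])) (sq_nonneg _))
  refine hle.trans_eq ?_
  rw [intg_eq_sum hN p hpd]
  refine Finset.sum_congr rfl fun x hx => ?_
  have hVx : V.eval x = 0 := by
    rw [hS] at hx
    simp only [Finset.mem_insert] at hx
    rcases hx with rfl | rfl | hx
    · simp [hV]
    · simp [hV]
    · rw [hV, eval_mul, eval_pow, eval_nodal hx]; simp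
  rw [hp, eval_add, eval_mul, hVx, mul_zero, add_zero, eval_pow]

/-- Stability of the Legendre–Gauss–Lobatto interpolation. -/
lemma intg_lglInterp_sq_le {N : ℕ} (hN : 2 ≤ N) {g : ℝ → ℝ} {c : ℝ}
    (hg : ∀ x ∈ Icc (0 : ℝ) 1, |g x| ≤ c) : intg (lglInterp N g ^ 2) ≤ c ^ 2 := by
  have hd : (lglInterp N g).natDegree ≤ N :=
    natDegree_le_of_degree_le (degree_lglInterp (by omega) g)
  refine (intg_sq_le_sum hN hd).trans ?_
  have h1 : ∑ x ∈ lglNodes N, lglWeight N x = 1 := by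
    have := intg_eq_sum hN (C 1) (by rw [natDegree_C]; omega)
    simp only [eval_C, one_mul, intg_C] at this
    exact this.symm
  calc ∑ x ∈ lglNodes N, (lglInterp N g).eval x ^ 2 * lglWeight N x
      ≤ ∑ x ∈ lglNodes N, c ^ 2 * lglWeight N x := by
        refine Finset.sum_le_sum fun x hx => mul_le_mul_of_nonneg_right ?_ (lglWeight_nonneg hN hx)
        rw [eval_lglInterp g hx, ← sq_abs]
        exact pow_le_pow_left₀ (abs_nonneg _) (hg x (lglNodes_subset (by omega) hx)) 2
    _ = c ^ 2 := by rw [← Finset.mul_sum, h1, mul_one]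

/-! ### The energy estimate of one step -/

lemma IsTrial.natDegree_le {N : ℕ} {u : ℝ[X]} (h : IsTrial N u) : u.natDegree ≤ N + 2 :=
  natDegree_le_of_degree_le (mem_degreeLE.1 h.1)

lemma IsTrial.second_mem {N : ℕ} {u : ℝ[X]} (h : IsTrial N u) :
    derivative (derivative u) ∈ degreeLE ℝ N := by
  rw [mem_degreeLE]
  refine degree_le_of_natDegree_le ?_
  have h1 := natDegree_derivative_le u
  have h2 := natDegree_derivative_le (derivative u)
  have h3 := h.natDegree_le
  omega

lemma isTrial_of_natDegree_le {N : ℕ} {u : ℝ[X]} (h : u.natDegree ≤ N + 2)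
    (h0 : u.derivative.eval 0 = 0) (h1 : u.derivative.eval 1 = 0) : IsTrial N u :=
  ⟨mem_degreeLE.2 (degree_le_of_natDegree_le h), h0, h1⟩

lemma IsTrial.sub {N : ℕ} {u w : ℝ[X]} (hu : IsTrial N u) (hw : IsTrial N w) :
    IsTrial N (u - w) :=
  ⟨Submodule.sub_mem _ hu.1 hw.1, by simp [hu.2.1, hw.2.1], by simp [hu.2.2, hw.2.2]⟩

lemma IsTrial.intg_mul_second {N : ℕ} {u : ℝ[X]} (h : IsTrial N u) (b : ℝ[X]) :
    intg (b * derivative (derivative u)) = -intg (derivative b * derivative u) := by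
  have h1 := intg_derivative (b * derivative u)
  rw [derivative_mul, map_add, eval_mul, eval_mul, h.2.1, h.2.2] at h1
  linarith

/-- The `G`-norm energy of two consecutive errors in the two-step backward difference method. -/
def energy (a b : ℝ[X]) : ℝ :=
  intg (derivative a ^ 2) + intg ((2 * derivative a - derivative b) ^ 2)
    + intg a ^ 2 + (2 * intg a - intg b) ^ 2

lemma energy_nonneg (a b : ℝ[X]) : 0 ≤ energy a b := by
  have h1 := intg_sq_nonneg (derivative a)
  have h2 := intg_sq_nonneg (2 * derivative a - derivative b)
  unfold energy; positivity

/-- The variance of `k` is nonnegative. -/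
lemma sq_integral_le {k : ℝ → ℝ} (hk : ContinuousOn k (Icc 0 1)) :
    (∫ ρ in (0 : ℝ)..1, k ρ) ^ 2 ≤ ∫ ρ in (0 : ℝ)..1, k ρ ^ 2 := by
  set m := ∫ ρ in (0 : ℝ)..1, k ρ with hm
  have hk' : ContinuousOn k (uIcc 0 1) := by rwa [uIcc_of_le zero_le_one]
  have h1 : IntervalIntegrable k MeasureTheory.volume 0 1 := hk'.intervalIntegrable
  have h2 : IntervalIntegrable (fun ρ => k ρ ^ 2) MeasureTheory.volume 0 1 :=
    (hk'.pow 2).intervalIntegrable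
  have h0 : 0 ≤ ∫ ρ in (0 : ℝ)..1, (k ρ ^ 2 - 2 * m * k ρ + m ^ 2) :=
    intervalIntegral.integral_nonneg zero_le_one fun ρ _ => by nlinarith [sq_nonneg (k ρ - m)]
  rw [intervalIntegral.integral_add (h2.sub (h1.const_mul _)) (by simp),
    intervalIntegral.integral_sub h2 (h1.const_mul _), intervalIntegral.integral_const_mul,
    ← hm] at h0
  simp at h0
  nlinarith

/-- The stability estimate of BDF2. Convection and residual are collected in `k = Res - G e₂'`. The
test function `e₂''` bounds the gradients and the test function `1` bounds the mean, both in terms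
of `∫ k ^ 2`, which in turn is bounded by the new energy and `η`. The new energy on the right is
dealt with later by a small step size. -/
lemma energy_step {N : ℕ} {hs d d₀ Γ η : ℝ} (hhs : 0 ≤ hs) (hd₀ : 0 < d₀) (hd : d₀ ≤ d)
    {e₀ e₁ e₂ : ℝ[X]} (h₂ : IsTrial N e₂) {G Res : ℝ → ℝ} (hG : ContinuousOn G (Icc 0 1))
    (hΓ : ∀ ρ ∈ Icc (0 : ℝ) 1, |G ρ| ≤ Γ) (hRes : ContinuousOn Res (Icc 0 1))
    (hη : ∫ ρ in (0 : ℝ)..1, Res ρ ^ 2 ≤ η)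
    (heq : ∀ w ∈ degreeLE ℝ N, ∫ ρ in (0 : ℝ)..1,
      (e₂.eval ρ - (4 * e₁.eval ρ - e₀.eval ρ) / 3 - hs * d * (derivative (derivative e₂)).eval ρ
        + hs * (G ρ * (derivative e₂).eval ρ)) * w.eval ρ
      = hs * ∫ ρ in (0 : ℝ)..1, Res ρ * w.eval ρ) :
    energy e₂ e₁ ≤ energy e₁ e₀
      + ((3 / (2 * d₀) + 3) * (2 * Γ ^ 2 + 2) + 3) * hs * (energy e₂ e₁ + η) := by
  have hu : uIcc (0 : ℝ) 1 = Icc 0 1 := uIcc_of_le zero_le_one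
  have hpc : ∀ p : ℝ[X], ContinuousOn (fun ρ => p.eval ρ) (Icc (0 : ℝ) 1) :=
    fun p => p.continuous.continuousOn
  have hdpos : 0 < d := hd₀.trans_le hd
  set k : ℝ → ℝ := fun ρ => Res ρ - G ρ * (derivative e₂).eval ρ with hk
  have hkc : ContinuousOn k (Icc 0 1) := hRes.sub (hG.fun_mul (hpc _))
  set b : ℝ[X] := e₂ - (1 / 3 : ℝ) • (4 * e₁ - e₀) with hb
  set K := ∫ ρ in (0 : ℝ)..1, k ρ ^ 2 with hK
  set A := intg (derivative e₂ ^ 2) with hA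
  have hA0 : 0 ≤ A := intg_sq_nonneg _
  have hK0 : 0 ≤ K := intervalIntegral.integral_nonneg zero_le_one fun _ _ => sq_nonneg _
  have hη0 : 0 ≤ η := le_trans
    (intervalIntegral.integral_nonneg zero_le_one fun _ _ => sq_nonneg _) hη
  have ii : ∀ {f : ℝ → ℝ}, ContinuousOn f (Icc 0 1) →
      IntervalIntegrable f MeasureTheory.volume 0 1 := fun hf =>
    ContinuousOn.intervalIntegrable (by rwa [hu])
  have hKle : K ≤ 2 * η + 2 * Γ ^ 2 * A := by
    have h1 : K ≤ ∫ ρ in (0 : ℝ)..1, (2 * Res ρ ^ 2 + 2 * Γ ^ 2 * (derivative e₂ ^ 2).eval ρ) := by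
      refine intervalIntegral.integral_mono_on zero_le_one (ii (hkc.fun_pow 2))
        (ii (((hRes.fun_pow 2).const_mul 2).add ((hpc _).const_mul _))) fun ρ hρ => ?_
      have h2 : (G ρ * (derivative e₂).eval ρ) ^ 2 ≤ Γ ^ 2 * (derivative e₂).eval ρ ^ 2 := by
        rw [mul_pow]
        refine mul_le_mul_of_nonneg_right ?_ (sq_nonneg _)
        rw [← sq_abs]
        exact pow_le_pow_left₀ (abs_nonneg _) (hΓ ρ hρ) 2
      simp only [hk, eval_pow]
      nlinarith [sq_nonneg (Res ρ + G ρ * (derivative e₂).eval ρ)]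
    rw [intervalIntegral.integral_add (ii ((hRes.fun_pow 2).const_mul 2)) (ii ((hpc _).const_mul _)),
      intervalIntegral.integral_const_mul, intervalIntegral.integral_const_mul, ← intg_apply,
      ← hA] at h1
    linarith
  have hmain : ∀ w ∈ degreeLE ℝ N, intg (b * w) - hs * d * intg (derivative (derivative e₂) * w)
      = hs * ∫ ρ in (0 : ℝ)..1, k ρ * w.eval ρ := by
    intro w hw
    have h1 : ∫ ρ in (0 : ℝ)..1, k ρ * w.eval ρ = (∫ ρ in (0 : ℝ)..1, Res ρ * w.eval ρ)
        - ∫ ρ in (0 : ℝ)..1, (G ρ * (derivative e₂).eval ρ) * w.eval ρ := by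
      rw [← intervalIntegral.integral_sub (ii (hRes.fun_mul (hpc w)))
        (ii ((hG.fun_mul (hpc _)).fun_mul (hpc w)))]
      refine intervalIntegral.integral_congr fun ρ _ => ?_
      simp only [hk]; ring
    rw [h1, mul_sub, ← heq w hw, ← intervalIntegral.integral_const_mul,
      ← intervalIntegral.integral_sub _ (ii (((hG.fun_mul (hpc _)).fun_mul (hpc w)).const_mul hs)),
      ← smul_eq_mul (hs * d), ← map_smul, ← map_sub, intg_apply]
    · refine intervalIntegral.integral_congr fun ρ _ => ?_
      simp only [hb, eval_sub, eval_mul, eval_smul, smul_eq_mul, eval_ofNat]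
      ring
    · refine ii (ContinuousOn.mul ?_ (hpc w))
      exact (((hpc e₂).sub ((((hpc e₁).const_mul 4).sub (hpc e₀)).div_const 3)).sub
        ((hpc _).const_mul _)).add ((hG.fun_mul (hpc _)).const_mul hs)
  -- the gradient part
  have hgrad : intg (derivative b * derivative e₂) ≤ hs / (4 * d₀) * K := by
    -- With `w = e₂''`, integration by parts gives `∫ b' e₂' = -hs d ∫ e₂''² - hs ∫ k e₂''`, and
    -- completing the square absorbs the last integral.
    have h1 := hmain _ h₂.second_mem
    rw [h₂.intg_mul_second] at h1
    have h2 : -(∫ ρ in (0 : ℝ)..1, k ρ * (derivative (derivative e₂)).eval ρ)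
        ≤ 1 / (4 * d) * K + d * intg (derivative (derivative e₂) * derivative (derivative e₂)) := by
      rw [intg_apply, ← intervalIntegral.integral_neg, ← intervalIntegral.integral_const_mul,
        ← intervalIntegral.integral_const_mul,
        ← intervalIntegral.integral_add (ii ((hkc.fun_pow 2).const_mul _)) (ii ((hpc _).const_mul _))]
      refine intervalIntegral.integral_mono_on zero_le_one (ii (hkc.fun_mul (hpc _)).fun_neg)
        (ii (((hkc.fun_pow 2).const_mul _).add ((hpc _).const_mul _))) fun ρ _ => ?_
      rw [eval_mul]
      set z := (derivative (derivative e₂)).eval ρ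
      have : 1 / (4 * d) * k ρ ^ 2 + d * (z * z) + k ρ * z = d * (z + k ρ / (2 * d)) ^ 2 := by
        field_simp; ring
      nlinarith [mul_nonneg hdpos.le (sq_nonneg (z + k ρ / (2 * d)))]
    have h3 : 1 / (4 * d) * K ≤ 1 / (4 * d₀) * K := by gcongr
    have h4 := mul_le_mul_of_nonneg_left (h2.trans (add_le_add_left h3 _)) hhs
    have h5 : hs / (4 * d₀) * K = hs * (1 / (4 * d₀) * K) := by ring
    rw [h5]
    nlinarith
  have hgrad' : intg (derivative e₂ ^ 2) + intg ((2 * derivative e₂ - derivative e₁) ^ 2)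
      ≤ intg (derivative e₁ ^ 2) + intg ((2 * derivative e₁ - derivative e₀) ^ 2)
        + 3 / (2 * d₀) * hs * K := by
    -- The `G`-stability identity `2 (3a - 4b + c) a = a² + (2a - b)² - b² - (2b - c)² + (a - 2b +
    -- c)²`, applied to the three gradients.
    have hid : (6 : ℝ) • (derivative b * derivative e₂)
        = derivative e₂ ^ 2 + (2 * derivative e₂ - derivative e₁) ^ 2
          - derivative e₁ ^ 2 - (2 * derivative e₁ - derivative e₀) ^ 2
          + (derivative e₂ - 2 * derivative e₁ + derivative e₀) ^ 2 := by
      refine funext fun x => ?_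
      simp only [hb, derivative_sub, derivative_smul, derivative_mul, derivative_ofNat, eval_smul,
        eval_mul, eval_sub, eval_add, eval_pow, smul_eq_mul, eval_ofNat, zero_mul, zero_add]
      ring
    have h1 := congrArg intg hid
    simp only [map_add, map_sub, map_smul, smul_eq_mul] at h1
    have h2 := intg_sq_nonneg (derivative e₂ - 2 * derivative e₁ + derivative e₀)
    have h3 : 3 / (2 * d₀) * hs * K = 6 * (hs / (4 * d₀) * K) := by ring
    linarith
  -- the mean value
  have hmean : intg e₂ ^ 2 + (2 * intg e₂ - intg e₁) ^ 2
      ≤ intg e₁ ^ 2 + (2 * intg e₁ - intg e₀) ^ 2 + 3 * hs * (K + intg e₂ ^ 2) := by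
    -- The gradients do not see constants. With `w = 1` the diffusion term drops out by the Neumann
    -- conditions, leaving a scalar BDF2 recursion for the mean.
    have h1 := hmain 1 (by rw [mem_degreeLE, degree_one]; exact_mod_cast Nat.zero_le N)
    simp only [mul_one, intg_derivative, h₂.2.1, h₂.2.2, sub_zero, mul_zero, eval_one] at h1
    have h2 : intg b = intg e₂ - (4 * intg e₁ - intg e₀) / 3 := by
      have h4 : (4 * e₁ : ℝ[X]) = (4 : ℝ) • e₁ := by
        rw [smul_eq_C_mul, map_ofNat]
      rw [hb, h4, map_sub, map_smul, map_sub, map_smul, smul_eq_mul, smul_eq_mul]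
      ring
    rw [h2] at h1
    have h3 := sq_integral_le hkc
    rw [← hK] at h3
    set c := ∫ ρ in (0 : ℝ)..1, k ρ
    have h4 : 2 * (3 * intg e₂ - 4 * intg e₁ + intg e₀) * intg e₂ ≤ 3 * hs * (K + intg e₂ ^ 2) := by
      have h5 : 3 * intg e₂ - 4 * intg e₁ + intg e₀ = 3 * hs * c := by linarith
      rw [h5]
      have h6 : 2 * c * intg e₂ ≤ K + intg e₂ ^ 2 := by nlinarith [sq_nonneg (c - intg e₂)]
      nlinarith [mul_le_mul_of_nonneg_left h6 (by linarith : 0 ≤ 3 * hs)]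
    nlinarith [sq_nonneg (intg e₂ - 2 * intg e₁ + intg e₀)]
  have hE1 : A ≤ energy e₂ e₁ := by
    have := intg_sq_nonneg (2 * derivative e₂ - derivative e₁)
    unfold energy; nlinarith [sq_nonneg (intg e₂), sq_nonneg (2 * intg e₂ - intg e₁)]
  have hE2 : intg e₂ ^ 2 ≤ energy e₂ e₁ := by
    have := intg_sq_nonneg (2 * derivative e₂ - derivative e₁)
    unfold energy; nlinarith [sq_nonneg (2 * intg e₂ - intg e₁)]
  have hKE : K ≤ (2 * Γ ^ 2 + 2) * (energy e₂ e₁ + η) := by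
    nlinarith [mul_nonneg (sq_nonneg Γ) hη0, mul_le_mul_of_nonneg_left hE1 (sq_nonneg Γ),
      energy_nonneg e₂ e₁]
  have hsum : energy e₂ e₁ ≤ energy e₁ e₀ + hs * ((3 / (2 * d₀) + 3) * K + 3 * intg e₂ ^ 2) := by
    simp only [energy]
    nlinarith
  refine hsum.trans ?_
  rw [mul_comm _ hs, mul_assoc]
  gcongr
  have h5 : 0 ≤ 3 / (2 * d₀) + 3 := by positivity
  nlinarith [mul_le_mul_of_nonneg_left hKE h5]

/-- The energy of the error controls the error uniformly. -/
lemma abs_eval_le_of_intg {e : ℝ[X]} {c : ℝ} (hc : 0 ≤ c) (h1 : intg (derivative e ^ 2) ≤ c ^ 2)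
    (h2 : |intg e| ≤ c) : ∀ ρ ∈ Icc (0 : ℝ) 1, |e.eval ρ| ≤ 2 * c := by
  -- The oscillation of `e` is at most `∫ |e'|`, which Cauchy–Schwarz bounds by `c`; so `e` stays
  -- within `c` of its mean.
  have hosc : ∀ x ∈ Icc (0 : ℝ) 1, ∀ y ∈ Icc (0 : ℝ) 1, |e.eval x - e.eval y| ≤ c := by
    intro x hx y hy
    have hq : ∫ ρ in (0 : ℝ)..1, |(derivative e).eval ρ| ≤ c := by
      refine (abs_le_of_sq_le_sq' ?_ hc).2
      refine (sq_integral_le (derivative e).continuous.abs.continuousOn).trans ?_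
      simpa [intg_apply] using h1
    rw [← intervalIntegral.integral_eq_sub_of_hasDerivAt (fun z _ => e.hasDerivAt z)
      (intervalIntegrable_eval _ y x)]
    rw [← Real.norm_eq_abs]
    refine (intervalIntegral.norm_integral_le_abs_integral_norm).trans ?_
    refine le_trans ?_ hq
    simp only [Real.norm_eq_abs]
    rw [← abs_of_nonneg (intervalIntegral.integral_nonneg (μ := MeasureTheory.volume)
      (zero_le_one' ℝ) fun ρ _ => abs_nonneg ((derivative e).eval ρ))]
    refine intervalIntegral.abs_integral_mono_interval ?_ ?_ ?_
    · rw [uIoc_of_le (zero_le_one' ℝ), uIoc]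
      exact Ioc_subset_Ioc (le_min hy.1 hx.1) (max_le hy.2 hx.2)
    · exact Eventually.of_forall fun ρ => abs_nonneg _
    · exact (derivative e).continuous.abs.intervalIntegrable _ _
  intro ρ hρ
  have h3 : |e.eval ρ - intg e| ≤ c := by
    rw [abs_sub_le_iff]
    constructor
    · have : intg (C (e.eval ρ - c)) ≤ intg e := intg_mono fun x hx => by
        rw [eval_C]; linarith [(abs_sub_le_iff.1 (hosc ρ hρ x hx)).1]
      rw [intg_C] at this; linarith
    · have : intg e ≤ intg (C (e.eval ρ + c)) := intg_mono fun x hx => by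
        rw [eval_C]; linarith [(abs_sub_le_iff.1 (hosc ρ hρ x hx)).2]
      rw [intg_C] at this; linarith
  have := abs_add_le (e.eval ρ - intg e) (intg e)
  rw [sub_add_cancel] at this
  linarith

/-! ### Solvability of one step -/

/-- The antiderivative of a polynomial which vanishes at `0`. -/
def antideriv : ℝ[X] →ₗ[ℝ] ℝ[X] :=
  Polynomial.lsum fun n => ((n : ℝ) + 1)⁻¹ • monomial (n + 1)

lemma antideriv_monomial (n : ℕ) (a : ℝ) :
    antideriv (monomial n a) = ((n : ℝ) + 1)⁻¹ • monomial (n + 1) a := by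
  simp [antideriv, Polynomial.lsum, sum_monomial_index]

lemma derivative_antideriv (p : ℝ[X]) : derivative (antideriv p) = p := by
  induction p using Polynomial.induction_on' with
  | add p q hp hq => rw [map_add, derivative_add, hp, hq]
  | monomial n a =>
    rw [antideriv_monomial, derivative_smul, derivative_monomial, smul_monomial]
    have : ((n : ℝ) + 1) ≠ 0 := by positivity
    simp
    field_simp

lemma antideriv_eval_zero (p : ℝ[X]) : (antideriv p).eval 0 = 0 := by
  induction p using Polynomial.induction_on' with
  | add p q hp hq => rw [map_add, eval_add, hp, hq, add_zero]
  | monomial n a => rw [antideriv_monomial]; simp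

lemma natDegree_antideriv_le (p : ℝ[X]) : (antideriv p).natDegree ≤ p.natDegree + 1 := by
  by_contra! h
  have h1 := natDegree_derivative (antideriv p)
  rw [derivative_antideriv] at h1
  omega

/-- The trial function with second derivative `p - ∫ p` and value `c` at `0`. -/
def trialOf (p : ℝ[X]) (c : ℝ) : ℝ[X] := antideriv (antideriv (p - C (intg p))) + C c

lemma derivative_trialOf (p : ℝ[X]) (c : ℝ) :
    derivative (trialOf p c) = antideriv (p - C (intg p)) := by
  rw [trialOf, derivative_add, derivative_antideriv, derivative_C, add_zero]

lemma second_trialOf (p : ℝ[X]) (c : ℝ) :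
    derivative (derivative (trialOf p c)) = p - C (intg p) := by
  rw [derivative_trialOf, derivative_antideriv]

lemma trialOf_eval_zero (p : ℝ[X]) (c : ℝ) : (trialOf p c).eval 0 = c := by
  rw [trialOf, eval_add, antideriv_eval_zero, eval_C, zero_add]

lemma isTrial_trialOf {N : ℕ} {p : ℝ[X]} (hp : p ∈ degreeLE ℝ N) (c : ℝ) :
    IsTrial N (trialOf p c) := by
  refine isTrial_of_natDegree_le ?_ ?_ ?_
  · have h0 := natDegree_le_of_degree_le (mem_degreeLE.1 hp)
    have h1 := natDegree_antideriv_le (p - C (intg p))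
    have h2 := natDegree_antideriv_le (antideriv (p - C (intg p)))
    have h3 : (p - C (intg p)).natDegree = p.natDegree := natDegree_sub_C
    rw [trialOf, natDegree_add_C]
    omega
  · rw [derivative_trialOf, antideriv_eval_zero]
  · have h := intg_derivative (antideriv (p - C (intg p)))
    rw [derivative_antideriv, antideriv_eval_zero, map_sub, intg_C, sub_self, sub_zero] at h
    rw [derivative_trialOf, ← h]

instance finiteDimensional_degreeLE (N : ℕ) : FiniteDimensional ℝ (degreeLE ℝ (N : ℕ)) := by
  rw [show degreeLE ℝ (N : ℕ) = degreeLT ℝ (N + 1) by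
    ext p
    rw [mem_degreeLE, mem_degreeLT, degree_lt_iff_coeff_zero, degree_le_iff_coeff_zero]
    refine forall_congr' fun m => ?_
    rw [Nat.cast_lt, Nat.lt_iff_add_one_le]]
  exact Module.Finite.equiv (degreeLTEquiv ℝ (N + 1)).symm

/-- An injective bilinear problem on polynomials of degree at most `N` is solvable. -/
lemma exists_solution {N : ℕ} (B : degreeLE ℝ (N : ℕ) →ₗ[ℝ] Module.Dual ℝ (degreeLE ℝ (N : ℕ)))
    (hB : ∀ p, B p = 0 → p = 0) (φ : Module.Dual ℝ (degreeLE ℝ (N : ℕ))) : ∃ p, B p = φ := by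
  have hinj : Function.Injective B := (injective_iff_map_eq_zero B).2 hB
  exact (LinearMap.injective_iff_surjective_of_finrank_eq_finrank
    Subspace.dual_finrank_eq.symm).1 hinj φ

/-- Testing with a continuous function. -/
def testWith (N : ℕ) (f : ℝ → ℝ) (hf : ContinuousOn f (Icc 0 1)) :
    Module.Dual ℝ (degreeLE ℝ (N : ℕ)) where
  toFun w := ∫ ρ in (0 : ℝ)..1, f ρ * (w : ℝ[X]).eval ρ
  map_add' w z := by
    have ii : ∀ p : ℝ[X], IntervalIntegrable (fun ρ => f ρ * p.eval ρ) MeasureTheory.volume 0 1 :=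
      fun p => ContinuousOn.intervalIntegrable (by
        rw [uIcc_of_le zero_le_one]; exact hf.mul p.continuous.continuousOn)
    simp only [Submodule.coe_add, eval_add, mul_add]
    exact intervalIntegral.integral_add (ii _) (ii _)
  map_smul' c w := by
    simp only [Submodule.coe_smul, eval_smul, smul_eq_mul, RingHom.id_apply,
      mul_left_comm _ c, intervalIntegral.integral_const_mul]

lemma exists_isOrthProj (N : ℕ) {u : ℝ → ℝ} (hu : ContinuousOn u (Icc 0 1)) :
    ∃ q, IsOrthProj N u q := by
  let B : degreeLE ℝ (N : ℕ) →ₗ[ℝ] Module.Dual ℝ (degreeLE ℝ (N : ℕ)) :=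
    { toFun := fun q => intg ∘ₗ LinearMap.mulLeft ℝ (q : ℝ[X]) ∘ₗ (degreeLE ℝ (N : ℕ)).subtype
      map_add' := fun p q => by ext w; simp [add_mul]
      map_smul' := fun c p => by ext w; simp }
  have hBa : ∀ q w, B q w = intg ((q : ℝ[X]) * w) := fun q w => rfl
  obtain ⟨q, hq⟩ := exists_solution B (fun q hq => by
    have := hBa q q
    rw [hq, LinearMap.zero_apply, ← pow_two] at this
    exact Subtype.ext (eq_zero_of_intg_sq this.symm)) (testWith N u hu)
  refine ⟨q, q.2, fun w hw => ?_⟩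
  have h1 := LinearMap.congr_fun hq ⟨w, hw⟩
  rw [hBa] at h1
  have h2 : intg ((q : ℝ[X]) * w) = ∫ ρ in (0 : ℝ)..1, u ρ * w.eval ρ := h1
  have h3 : ∀ ρ : ℝ, ((q : ℝ[X]).eval ρ - u ρ) * w.eval ρ
      = ((q : ℝ[X]) * w).eval ρ - u ρ * w.eval ρ := fun ρ => by rw [eval_mul]; ring
  simp only [h3]
  rw [intervalIntegral.integral_sub (intervalIntegrable_eval _ 0 1), ← intg_apply, h2, sub_self]
  exact ContinuousOn.intervalIntegrable (by
    rw [uIcc_of_le zero_le_one]; exact hu.mul w.continuous.continuousOn)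

/-- The operator of one implicit step. -/
def stepOp (hs d : ℝ) (G : ℝ → ℝ) (u : ℝ[X]) (ρ : ℝ) : ℝ :=
  u.eval ρ - hs * d * (derivative (derivative u)).eval ρ + hs * (G ρ * (derivative u).eval ρ)

lemma continuousOn_stepOp {hs d : ℝ} {G : ℝ → ℝ} (hG : ContinuousOn G (Icc 0 1)) (u : ℝ[X]) :
    ContinuousOn (stepOp hs d G u) (Icc 0 1) :=
  (u.continuous.continuousOn.sub ((Polynomial.continuous _).continuousOn.const_mul _)).add
    ((hG.mul (Polynomial.continuous _).continuousOn).const_mul _)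

/-- Testing with `u''` gives `(1 - hs Γ² / (2 d)) ∫ u'² + (hs d / 2) ∫ u''² ≤ 0`. Smallness of `hs`
forces `u' = 0`; then `u` is constant and may be tested with itself. -/
lemma eq_zero_of_stepOp {N : ℕ} {hs d Γ : ℝ} (hhs : 0 < hs) (hd : 0 < d) {G : ℝ → ℝ}
    (hG : ContinuousOn G (Icc 0 1)) (hΓ : ∀ ρ ∈ Icc (0 : ℝ) 1, |G ρ| ≤ Γ)
    (hsmall : hs * Γ ^ 2 < 2 * d) {u : ℝ[X]} (hu : IsTrial N u)
    (hint : ∀ w ∈ degreeLE ℝ (N : ℕ),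
      ∫ ρ in (0 : ℝ)..1, stepOp hs d G u ρ * w.eval ρ = 0) : u = 0 := by
  have ii : ∀ {f : ℝ → ℝ}, ContinuousOn f (Icc 0 1) →
      IntervalIntegrable f MeasureTheory.volume 0 1 := fun hf =>
    ContinuousOn.intervalIntegrable (by rwa [uIcc_of_le zero_le_one])
  have h1 := hint _ hu.second_mem
  have hA := intg_sq_nonneg (derivative u)
  have hneg : 0 ≤ ∫ ρ in (0 : ℝ)..1, (-(stepOp hs d G u ρ * (derivative (derivative u)).eval ρ)
      + (u * derivative (derivative u)).eval ρ + (hs * Γ ^ 2 / (2 * d)) * (derivative u ^ 2).eval ρ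
      - (hs * d / 2) * (derivative (derivative u) ^ 2).eval ρ) := by
    refine intervalIntegral.integral_nonneg zero_le_one fun ρ hρ => ?_
    simp only [stepOp, eval_mul, eval_pow]
    set a := u.eval ρ
    set b := (derivative u).eval ρ
    set c := (derivative (derivative u)).eval ρ
    have h2 : G ρ ^ 2 ≤ Γ ^ 2 := by
      rw [← sq_abs]
      exact pow_le_pow_left₀ (abs_nonneg _) (hΓ ρ hρ) 2
    -- Pointwise form of Young's inequality for the convection term: the difference of the two sides
    -- is a square plus the slack in `|G| ≤ Γ`.
    have h3 : -((a - hs * d * c + hs * (G ρ * b)) * c) + a * c + hs * Γ ^ 2 / (2 * d) * b ^ 2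
        - hs * d / 2 * c ^ 2 = hs / (2 * d) * ((d * c - G ρ * b) ^ 2 + (Γ ^ 2 - G ρ ^ 2) * b ^ 2)
        := by field_simp; ring
    rw [h3]
    have : 0 ≤ (Γ ^ 2 - G ρ ^ 2) * b ^ 2 := mul_nonneg (by linarith) (sq_nonneg _)
    positivity
  have hc1 := (continuousOn_stepOp (hs := hs) (d := d) hG u).fun_mul
    (derivative (derivative u)).continuous.continuousOn
  rw [intervalIntegral.integral_sub (((ii hc1.fun_neg).add (intervalIntegrable_eval _ _ _)).add
      ((intervalIntegrable_eval _ _ _).const_mul _)) ((intervalIntegrable_eval _ _ _).const_mul _),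
    intervalIntegral.integral_add ((ii hc1.fun_neg).add (intervalIntegrable_eval _ _ _))
      ((intervalIntegrable_eval _ _ _).const_mul _),
    intervalIntegral.integral_add (ii hc1.fun_neg) (intervalIntegrable_eval _ _ _),
    intervalIntegral.integral_neg, h1, intervalIntegral.integral_const_mul,
    intervalIntegral.integral_const_mul, ← intg_apply, ← intg_apply, ← intg_apply,
    hu.intg_mul_second, ← pow_two] at hneg
  have hB0 := intg_sq_nonneg (derivative (derivative u))
  have hcoef : hs * Γ ^ 2 / (2 * d) < 1 := by rw [div_lt_one (by positivity)]; exact hsmall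
  have hB1 : 0 ≤ hs * d / 2 * intg (derivative (derivative u) ^ 2) := by positivity
  have hzero : intg (derivative u ^ 2) = 0 := by nlinarith
  have hu' : derivative u = 0 := eq_zero_of_intg_sq hzero

  have huC : u = C (u.coeff 0) := eq_C_of_derivative_eq_zero hu'
  have h4 := hint u (by
    rw [huC, mem_degreeLE]; exact degree_C_le.trans (by exact_mod_cast Nat.zero_le N))
  refine eq_zero_of_intg_sq (Eq.trans ?_ h4)
  rw [intg_apply]
  refine intervalIntegral.integral_congr fun ρ _ => ?_
  simp only [stepOp, hu', derivative_zero, eval_zero, eval_pow]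
  ring

lemma exists_trial_stepOp {N : ℕ} {hs d Γ : ℝ} (hhs : 0 < hs) (hd : 0 < d) {G : ℝ → ℝ}
    (hG : ContinuousOn G (Icc 0 1)) (hΓ : ∀ ρ ∈ Icc (0 : ℝ) 1, |G ρ| ≤ Γ)
    (hsmall : hs * Γ ^ 2 < 2 * d) {g : ℝ[X]} (hg : g ∈ degreeLE ℝ N) :
    ∃ u, IsTrial N u ∧ IsOrthProj N (stepOp hs d G u) g := by
  -- The trial space is parametrised by polynomials of degree at most `N`: `p - ∫ p` is the second
  -- derivative, and the mean `∫ p`, which would be lost, becomes the value at `0`. This makes `J`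
  -- injective and the problem square.
  let J : degreeLE ℝ (N : ℕ) →ₗ[ℝ] ℝ[X] :=
    { toFun := fun p => trialOf p (intg (p : ℝ[X]))
      map_add' := fun p q => by
        simp only [trialOf, Submodule.coe_add, map_add, map_sub]
        abel
      map_smul' := fun c p => by
        simp only [trialOf, Submodule.coe_smul, map_smul, smul_eq_mul, RingHom.id_apply, smul_add,
          ← smul_eq_C_mul, C_mul]
        rw [← smul_sub, map_smul, map_smul] }
  have hJt : ∀ p, IsTrial N (J p) := fun p => isTrial_trialOf p.2 _
  let B : degreeLE ℝ (N : ℕ) →ₗ[ℝ] Module.Dual ℝ (degreeLE ℝ (N : ℕ)) :=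
    { toFun := fun p => testWith N (stepOp hs d G (J p)) (continuousOn_stepOp hG _)
      map_add' := fun p q => by
        ext w
        have ii : ∀ p, IntervalIntegrable (fun ρ => stepOp hs d G (J p) ρ * (w : ℝ[X]).eval ρ)
            MeasureTheory.volume 0 1 := fun p => ContinuousOn.intervalIntegrable (by
          rw [uIcc_of_le zero_le_one]
          exact (continuousOn_stepOp hG _).fun_mul (Polynomial.continuous _).continuousOn)
        rw [LinearMap.add_apply]
        simp only [testWith, LinearMap.coe_mk, AddHom.coe_mk]
        rw [← intervalIntegral.integral_add (ii p) (ii q)]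
        refine intervalIntegral.integral_congr fun ρ _ => ?_
        simp only [stepOp, map_add, eval_add]
        ring
      map_smul' := fun c p => by
        ext w
        rw [LinearMap.smul_apply]
        simp only [testWith, LinearMap.coe_mk, AddHom.coe_mk, RingHom.id_apply, smul_eq_mul]
        rw [← intervalIntegral.integral_const_mul]
        refine intervalIntegral.integral_congr fun ρ _ => ?_
        simp only [stepOp, map_smul, eval_smul, smul_eq_mul]
        ring }
  have hBa : ∀ p w, B p w = ∫ ρ in (0 : ℝ)..1, stepOp hs d G (J p) ρ * (w : ℝ[X]).eval ρ :=
    fun _ _ => rfl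
  obtain ⟨p, hp⟩ := exists_solution B (fun p hp => by
    have hu : J p = 0 := eq_zero_of_stepOp hhs hd hG hΓ hsmall (hJt p) fun w hw => by
      rw [← hBa p ⟨w, hw⟩, hp]; rfl
    have hu' : trialOf p (intg (p : ℝ[X])) = 0 := hu
    have h1 := second_trialOf (p : ℝ[X]) (intg (p : ℝ[X]))
    have h2 := trialOf_eval_zero (p : ℝ[X]) (intg (p : ℝ[X]))
    rw [hu', eval_zero] at h2
    rw [hu', ← h2, derivative_zero, derivative_zero, C_0, sub_zero] at h1
    exact Subtype.ext h1.symm) (testWith N (fun ρ => g.eval ρ) g.continuous.continuousOn)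
  refine ⟨J p, hJt p, hg, fun w hw => ?_⟩
  have h1 := LinearMap.congr_fun hp ⟨w, hw⟩
  rw [hBa] at h1
  have h2 : ∫ ρ in (0 : ℝ)..1, stepOp hs d G (J p) ρ * w.eval ρ
    = ∫ ρ in (0 : ℝ)..1, g.eval ρ * w.eval ρ := h1
  simp only [sub_mul]
  rw [intervalIntegral.integral_sub, h2, sub_self]
  · exact (g.continuous.mul w.continuous).intervalIntegrable _ _
  · exact ContinuousOn.intervalIntegrable (by
      rw [uIcc_of_le zero_le_one]
      exact (continuousOn_stepOp hG _).mul w.continuous.continuousOn)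

/-- One step of the scheme can be carried out. -/
lemma exists_collocStep {N : ℕ} (hN : 1 ≤ N) {hs d Γ : ℝ} (hhs : 0 < hs) (hd : 0 < d) {G : ℝ → ℝ}
    (hG : ContinuousOn G (Icc 0 1)) (hΓ : ∀ ρ ∈ Icc (0 : ℝ) 1, |G ρ| ≤ Γ)
    (hsmall : hs * Γ ^ 2 < 2 * d) (u₀ u₁ : ℝ[X]) (f₀ f₁ : ℝ → ℝ) :
    ∃ u₂, CollocStep N hs d G u₀ u₁ f₀ f₁ u₂ := by
  obtain ⟨q, hq⟩ := exists_isOrthProj N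
    (u := fun ρ => u₁.eval ρ - (u₀.eval ρ - u₁.eval ρ) / 3)
    (u₁.continuous.sub ((u₀.continuous.sub u₁.continuous).div_const 3)).continuousOn
  obtain ⟨u, hu, hproj⟩ := exists_trial_stepOp hhs hd hG hΓ hsmall
    (lglInterp_mem hN fun ρ => q.eval ρ + hs * (2 * f₁ ρ - f₀ ρ))
  exact ⟨u, hu, q, hq, hproj⟩

/-! ### Mean value estimates -/

lemma abs_sub_le_of_hasDeriv {a b c : ℝ} {f f' : ℝ → ℝ}
    (h : ∀ x ∈ Icc a b, HasDerivWithinAt f (f' x) (Icc a b) x)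
    (hc : ∀ x ∈ Icc a b, |f' x| ≤ c) {x y : ℝ} (hx : x ∈ Icc a b) (hy : y ∈ Icc a b) :
    |f x - f y| ≤ c * |x - y| :=
  (convex_Icc a b).norm_image_sub_le_of_norm_hasDerivWithin_le h hc hy hx

lemma exists_slope {T a b : ℝ} {f f' : ℝ → ℝ}
    (h : ∀ x ∈ Icc 0 T, HasDerivWithinAt f (f' x) (Icc 0 T) x) (ha : 0 ≤ a) (hab : a < b)
    (hb : b ≤ T) : ∃ c ∈ Ioo a b, f' c = (f b - f a) / (b - a) := by
  have hsub : Icc a b ⊆ Icc 0 T := Icc_subset_Icc ha hb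
  refine exists_hasDerivAt_eq_slope f f' hab
    (fun x hx => ((h x (hsub hx)).mono hsub).continuousWithinAt) fun x hx => ?_
  exact ((h x (hsub (Ioo_subset_Icc_self hx))).mono hsub).hasDerivAt (Icc_mem_nhds hx.1 hx.2)

/-- Bounds of a function and of its third derivative bound the derivatives in between. -/
lemma bound_derivatives {T A B : ℝ} (hT : 0 < T) {w z y y' : ℝ → ℝ}
    (h1 : ∀ x ∈ Icc 0 T, HasDerivWithinAt w (z x) (Icc 0 T) x)
    (h2 : ∀ x ∈ Icc 0 T, HasDerivWithinAt z (y x) (Icc 0 T) x)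
    (h3 : ∀ x ∈ Icc 0 T, HasDerivWithinAt y (y' x) (Icc 0 T) x)
    (hA : ∀ x ∈ Icc 0 T, |w x| ≤ A) (hB : ∀ x ∈ Icc 0 T, |y' x| ≤ B) :
    ∀ x ∈ Icc 0 T, |y x| ≤ 36 * A / T ^ 2 + B * T ∧
      |z x| ≤ 6 * A / T + (36 * A / T ^ 2 + B * T) * T := by
  have h0m : (0 : ℝ) ∈ Icc 0 T := ⟨le_rfl, hT.le⟩
  have hA0 : 0 ≤ A := (abs_nonneg _).trans (hA 0 h0m)
  have hB0 : 0 ≤ B := (abs_nonneg _).trans (hB 0 h0m)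
  -- The mean value theorem on the first and on the last third gives two points with a small first
  -- derivative, at distance at least `T / 3`; applied again between them it gives a point `d` with
  -- a small second derivative. The bounds then spread from these points by integration.
  have hslope : ∀ a, 0 ≤ a → a + T / 3 ≤ T → ∃ c ∈ Ioo a (a + T / 3), |z c| ≤ 6 * A / T := by
    intro a ha haT
    obtain ⟨c, hc, hcz⟩ := exists_slope h1 ha (by linarith : a < a + T / 3) haT
    refine ⟨c, hc, ?_⟩
    rw [hcz, add_sub_cancel_left, abs_div, abs_of_pos (by positivity : 0 < T / 3),
      div_le_iff₀ (by positivity)]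
    have e1 := hA a ⟨ha, by linarith⟩
    have e2 := hA (a + T / 3) ⟨by linarith, haT⟩
    have e3 : 6 * A / T * (T / 3) = 2 * A := by field_simp; ring
    rw [e3]
    exact (abs_sub _ _).trans (by linarith)
  obtain ⟨c1, hc1, hz1⟩ := hslope 0 le_rfl (by linarith)
  obtain ⟨c2, hc2, hz2⟩ := hslope (2 * T / 3) (by positivity) (by linarith)
  obtain ⟨d, hd, hyd⟩ := exists_slope h2 hc1.1.le (by linarith [hc1.2, hc2.1] : c1 < c2)
    (by linarith [hc2.2])
  have hgap : T / 3 ≤ c2 - c1 := by linarith [hc1.2, hc2.1]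
  have hyd' : |y d| ≤ 36 * A / T ^ 2 := by
    rw [hyd, abs_div, abs_of_pos (by linarith : 0 < c2 - c1), div_le_iff₀ (by linarith)]
    calc |z c2 - z c1| ≤ |z c2| + |z c1| := abs_sub _ _
      _ ≤ 36 * A / T ^ 2 * (T / 3) := by
        have : 36 * A / T ^ 2 * (T / 3) = 6 * A / T + 6 * A / T := by field_simp; ring
        rw [this]; exact add_le_add hz2 hz1
      _ ≤ _ := by gcongr
  have hdm : d ∈ Icc 0 T := ⟨by linarith [hd.1, hc1.1], by linarith [hd.2, hc2.2]⟩
  have hc1m : c1 ∈ Icc 0 T := ⟨hc1.1.le, by linarith [hc1.2]⟩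
  have hdist : ∀ x ∈ Icc 0 T, ∀ x' ∈ Icc 0 T, |x - x'| ≤ T := fun x hx x' hx' => by
    rw [abs_sub_le_iff]; constructor <;> linarith [hx.1, hx.2, hx'.1, hx'.2]
  have hy : ∀ x ∈ Icc 0 T, |y x| ≤ 36 * A / T ^ 2 + B * T := by
    intro x hx
    have e1 := abs_sub_le_of_hasDeriv h3 hB hx hdm
    have e2 := mul_le_mul_of_nonneg_left (hdist x hx d hdm) hB0
    have e3 := abs_add_le (y x - y d) (y d)
    rw [sub_add_cancel] at e3
    linarith
  refine fun x hx => ⟨hy x hx, ?_⟩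
  have e1 := abs_sub_le_of_hasDeriv h2 hy hx hc1m
  have e2 := mul_le_mul_of_nonneg_left (hdist x hx c1 hc1m)
    (by positivity : 0 ≤ 36 * A / T ^ 2 + B * T)
  have e3 := abs_add_le (z x - z c1) (z c1)
  rw [sub_add_cancel] at e3
  linarith

lemma hasDeriv_shift {T t s k : ℝ} {w z : ℝ → ℝ} (hk : 0 ≤ k)
    (h : ∀ x ∈ Icc 0 T, HasDerivWithinAt w (z x) (Icc 0 T) x) (ht : t ≤ T) (hs : 0 ≤ t - k * s) :
    ∀ σ ∈ Icc 0 s, HasDerivWithinAt (fun σ => w (t - k * σ)) (-k * z (t - k * σ)) (Icc 0 s) σ := by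
  intro σ hσ
  have hmap : MapsTo (fun σ => t - k * σ) (Icc 0 s) (Icc 0 T) := fun τ hτ =>
    ⟨by have := mul_le_mul_of_nonneg_left hτ.2 hk; linarith,
      by have := mul_nonneg hk hτ.1; linarith⟩
  have h1 : HasDerivWithinAt (fun σ => t - k * σ) (-k) (Icc 0 s) σ := by
    have := ((hasDerivAt_id σ).const_mul k).const_sub t
    simpa using this.hasDerivWithinAt
  have h2 := (h _ (hmap hσ)).scomp (h := fun σ => t - k * σ) σ h1 hmap
  rw [smul_eq_mul] at h2
  exact h2

/-- Second differences of a function with Lipschitz derivative. -/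
lemma second_diff_le {T t s B : ℝ} {w z : ℝ → ℝ}
    (h : ∀ x ∈ Icc 0 T, HasDerivWithinAt w (z x) (Icc 0 T) x)
    (hs : 0 ≤ s) (ht : t ≤ T) (hts : 0 ≤ t - 2 * s)
    (hB : ∀ σ ∈ Icc 0 s, |z (t - σ) - z (t - 2 * σ)| ≤ B * σ) (hB0 : 0 ≤ B) :
    |w t - 2 * w (t - s) + w (t - 2 * s)| ≤ 2 * B * s ^ 2 := by
  have d1 := hasDeriv_shift zero_le_one h ht (by linarith : 0 ≤ t - 1 * s)
  have d2 := hasDeriv_shift zero_le_two h ht hts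
  -- The second difference is regarded as a function of the step `σ`: it vanishes at `σ = 0` and has
  -- derivative `2 (z (t - σ) - z (t - 2 σ))`.
  have key := abs_sub_le_of_hasDeriv (c := 2 * B * s)
    (f := fun σ => w t - 2 * w (t - 1 * σ) + w (t - 2 * σ))
    (f' := fun σ => - (2 * (-1 * z (t - 1 * σ))) + -2 * z (t - 2 * σ))
    (fun σ hσ => (((d1 σ hσ).const_mul 2).const_sub (w t)).add (d2 σ hσ))
    (fun σ hσ => by
      have e : -(2 * (-1 * z (t - 1 * σ))) + -2 * z (t - 2 * σ)
        = 2 * (z (t - σ) - z (t - 2 * σ)) := by rw [one_mul]; ring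
      rw [e, abs_mul, abs_two]
      have := (hB σ hσ).trans (mul_le_mul_of_nonneg_left hσ.2 hB0)
      linarith) ⟨hs, le_rfl⟩ ⟨le_rfl, hs⟩
  simp only [one_mul, mul_zero, sub_zero, abs_of_nonneg hs] at key
  calc _ = |w t - 2 * w (t - s) + w (t - 2 * s) - (w t - 2 * w t + w t)| := by ring_nf
    _ ≤ _ := key
    _ = _ := by ring

/-- Consistency of the two-step backward difference formula. -/
lemma bdf_consistency {T t s C : ℝ} {w z : ℝ → ℝ}
    (h : ∀ x ∈ Icc 0 T, HasDerivWithinAt w (z x) (Icc 0 T) x)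
    (hs : 0 ≤ s) (ht : t ≤ T) (hts : 0 ≤ t - 2 * s)
    (hC : ∀ σ ∈ Icc 0 s, |z t - 2 * z (t - σ) + z (t - 2 * σ)| ≤ C * σ ^ 2) (hC0 : 0 ≤ C) :
    |3 * w t - 4 * w (t - s) + w (t - 2 * s) - 2 * s * z t| ≤ 2 * C * s ^ 3 := by
  have d1 := hasDeriv_shift zero_le_one h ht (by linarith : 0 ≤ t - 1 * s)
  have d2 := hasDeriv_shift zero_le_two h ht hts
  have d3 : ∀ σ, HasDerivWithinAt (fun σ => 2 * z t * σ) (2 * z t) (Icc 0 s) σ := fun σ => by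
    simpa using ((hasDerivAt_id σ).const_mul (2 * z t)).hasDerivWithinAt
  -- Again as a function of `σ`: the derivative of the consistency error is `-2` times the second
  -- difference of `z`.
  have key := abs_sub_le_of_hasDeriv (c := 2 * C * s ^ 2)
    (f := fun σ => 3 * w t - 4 * w (t - 1 * σ) + w (t - 2 * σ) - 2 * z t * σ)
    (f' := fun σ => - (4 * (-1 * z (t - 1 * σ))) + -2 * z (t - 2 * σ) - 2 * z t)
    (fun σ hσ => ((((d1 σ hσ).const_mul 4).const_sub (3 * w t)).add (d2 σ hσ)).sub (d3 σ))
    (fun σ hσ => by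
      have e : -(4 * (-1 * z (t - 1 * σ))) + -2 * z (t - 2 * σ) - 2 * z t
        = -2 * (z t - 2 * z (t - σ) + z (t - 2 * σ)) := by rw [one_mul]; ring
      rw [e, abs_mul, abs_neg, abs_two]
      have := (hC σ hσ).trans
        (mul_le_mul_of_nonneg_left (pow_le_pow_left₀ hσ.1 hσ.2 2) hC0)
      linarith) ⟨hs, le_rfl⟩ ⟨le_rfl, hs⟩
  simp only [one_mul, mul_zero, sub_zero, abs_of_nonneg hs] at key
  calc _ = |3 * w t - 4 * w (t - s) + w (t - 2 * s) - 2 * z t * s - (3 * w t - 4 * w t + w t)| := by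
        ring_nf
    _ ≤ _ := key
    _ = _ := by ring

/-! ### Functions on the space-time rectangle -/

lemma exists_bound {T : ℝ} {g : ℝ → ℝ → ℝ}
    (hg : ContinuousOn (fun q : ℝ × ℝ => g q.1 q.2) (Icc 0 1 ×ˢ Icc 0 T)) :
    ∃ B, 0 ≤ B ∧ ∀ ρ ∈ Icc (0 : ℝ) 1, ∀ t ∈ Icc 0 T, |g ρ t| ≤ B := by
  obtain ⟨B, hB⟩ := (isCompact_Icc.prod isCompact_Icc).exists_bound_of_continuousOn hg
  exact ⟨max B 0, le_max_right _ _, fun ρ hρ t ht => (hB (ρ, t) ⟨hρ, ht⟩).trans (le_max_left _ _)⟩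

/-- `Smooth` provides joint regularity only for `∂²u/∂ρ²`. Integrating in `ρ` from a line on which
the function is continuous in time recovers joint continuity of `∂u/∂ρ` (zero at `ρ = 0` by the
Neumann condition) and then of `u`; the velocity is treated from `ρ = 1`. -/
lemma continuousOn_of_hasDeriv {T a : ℝ} {u g : ℝ → ℝ → ℝ} (ha : a ∈ Icc (0 : ℝ) 1)
    (hu : ∀ t ∈ Icc 0 T, ∀ ρ ∈ Icc (0 : ℝ) 1,
      HasDerivWithinAt (fun x => u x t) (g ρ t) (Icc 0 1) ρ)
    (hg : ContinuousOn (fun q : ℝ × ℝ => g q.1 q.2) (Icc 0 1 ×ˢ Icc 0 T))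
    (hua : ContinuousOn (u a) (Icc 0 T)) :
    ContinuousOn (fun q : ℝ × ℝ => u q.1 q.2) (Icc 0 1 ×ˢ Icc 0 T) := by
  obtain ⟨B, hB0, hB⟩ := exists_bound hg
  have hunif := (isCompact_Icc.prod isCompact_Icc).uniformContinuousOn_of_continuous hg
  rw [Metric.uniformContinuousOn_iff] at hunif
  rintro ⟨ρ₀, t₀⟩ ⟨hρ₀, ht₀⟩
  rw [Metric.continuousWithinAt_iff]
  intro ε hε
  obtain ⟨δ₁, hδ₁, h1⟩ := hunif (ε / 4) (by positivity)
  obtain ⟨δ₂, hδ₂, h2⟩ := Metric.continuousOn_iff.1 hua t₀ ht₀ (ε / 4) (by positivity)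
  refine ⟨min (min δ₁ δ₂) (ε / (4 * (B + 1))), by positivity, ?_⟩
  rintro ⟨ρ, t⟩ ⟨hρ, ht⟩ hdist
  rw [Prod.dist_eq, max_lt_iff] at hdist
  have hdt : dist t t₀ < min δ₁ δ₂ := hdist.2.trans_le (min_le_left _ _)
  have hdρ : |ρ - ρ₀| < ε / (4 * (B + 1)) := hdist.1.trans_le (min_le_right _ _)
  have e1 := abs_sub_le_of_hasDeriv (hu t ht) (fun x hx => hB x hx t ht) hρ hρ₀
  have e2 : |(u ρ₀ t - u ρ₀ t₀) - (u a t - u a t₀)| ≤ ε / 4 * |ρ₀ - a| :=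
    abs_sub_le_of_hasDeriv (f := fun x => u x t - u x t₀)
      (fun x hx => (hu t ht x hx).sub (hu t₀ ht₀ x hx)) (fun x hx => by
        have := h1 (x, t) ⟨hx, ht⟩ (x, t₀) ⟨hx, ht₀⟩ (by
          rw [Prod.dist_eq, dist_self, max_lt_iff]
          exact ⟨hδ₁, hdt.trans_le (min_le_left _ _)⟩)
        exact this.le) hρ₀ ha
  have e3 : |u a t - u a t₀| < ε / 4 := h2 t ht (hdt.trans_le (min_le_right _ _))
  have e4 : |ρ₀ - a| ≤ 1 := by
    rw [abs_sub_le_iff]; constructor <;> linarith [hρ₀.1, hρ₀.2, ha.1, ha.2]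
  have e5 : B * |ρ - ρ₀| ≤ ε / 4 := by
    rw [lt_div_iff₀ (by positivity)] at hdρ
    nlinarith [abs_nonneg (ρ - ρ₀)]
  have e6 : u ρ t - u ρ₀ t₀ = (u ρ t - u ρ₀ t) + ((u ρ₀ t - u ρ₀ t₀) - (u a t - u a t₀))
    + (u a t - u a t₀) := by ring
  rw [Real.dist_eq]
  simp only
  rw [e6]
  refine (abs_add_three _ _ _).trans_lt ?_
  have e7 : ε / 4 * |ρ₀ - a| ≤ ε / 4 := mul_le_of_le_one_right (by positivity) e4
  linarith

lemma Smooth.hasDeriv_space {T : ℝ} {u : ℝ → ℝ → ℝ} (h : Smooth T u) {ρ t : ℝ}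
    (ht : t ∈ Icc 0 T) (hρ : ρ ∈ Icc (0 : ℝ) 1) :
    HasDerivWithinAt (fun x => u x t) (dρ u ρ t) (Icc 0 1) ρ :=
  ((h.space t ht).differentiableOn (by norm_num) ρ hρ).hasDerivWithinAt

lemma hasDeriv_iterated {n : WithTop ℕ∞} {k : ℕ} {a b x : ℝ} {f : ℝ → ℝ} (hab : a < b)
    (hf : ContDiffOn ℝ n f (Icc a b)) (hk : (k : WithTop ℕ∞) < n) (hx : x ∈ Icc a b) :
    HasDerivWithinAt (iteratedDerivWithin k f (Icc a b))
      (iteratedDerivWithin (k + 1) f (Icc a b) x) (Icc a b) x := by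
  rw [iteratedDerivWithin_succ]
  exact (hf.differentiableOn_iteratedDerivWithin hk (uniqueDiffOn_Icc hab) x hx).hasDerivWithinAt

lemma Smooth.hasDeriv_grad {T : ℝ} {u : ℝ → ℝ → ℝ} (h : Smooth T u) {ρ t : ℝ}
    (ht : t ∈ Icc 0 T) (hρ : ρ ∈ Icc (0 : ℝ) 1) :
    HasDerivWithinAt (fun x => dρ u x t) (dρρ u ρ t) (Icc 0 1) ρ := by
  have h1 := hasDeriv_iterated zero_lt_one (h.space t ht) (k := 1) (by norm_num) hρ
  exact h1.congr (fun x _ => by rw [iteratedDerivWithin_one, dρ])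
    (by rw [iteratedDerivWithin_one, dρ])

lemma Smooth.continuousOn_second {T : ℝ} {u : ℝ → ℝ → ℝ} (h : Smooth T u) :
    ContinuousOn (fun q : ℝ × ℝ => dρρ u q.1 q.2) (Icc 0 1 ×ˢ Icc 0 T) :=
  h.second.continuousOn

lemma Smooth.continuousOn_grad {T : ℝ} {u : ℝ → ℝ → ℝ} (h : Smooth T u)
    (hbc : ∀ t ∈ Icc 0 T, dρ u 0 t = 0 ∧ dρ u 1 t = 0) :
    ContinuousOn (fun q : ℝ × ℝ => dρ u q.1 q.2) (Icc 0 1 ×ˢ Icc 0 T) :=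
  continuousOn_of_hasDeriv (left_mem_Icc.2 zero_le_one) (fun _ ht _ hρ => h.hasDeriv_grad ht hρ)
    h.continuousOn_second ((continuousOn_const (c := (0 : ℝ))).congr fun t ht => (hbc t ht).1)

lemma Smooth.continuousOn {T : ℝ} {u : ℝ → ℝ → ℝ} (h : Smooth T u)
    (hbc : ∀ t ∈ Icc 0 T, dρ u 0 t = 0 ∧ dρ u 1 t = 0) :
    ContinuousOn (fun q : ℝ × ℝ => u q.1 q.2) (Icc 0 1 ×ˢ Icc 0 T) :=
  continuousOn_of_hasDeriv (left_mem_Icc.2 zero_le_one) (fun _ ht _ hρ => h.hasDeriv_space ht hρ)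
    (h.continuousOn_grad hbc) (h.time 0 (left_mem_Icc.2 zero_le_one)).continuousOn

/-- Lipschitz continuity, second differences and backward difference formula in time. -/
lemma Smooth.time_regularity {T : ℝ} (hT : 0 < T) {u : ℝ → ℝ → ℝ} (h : Smooth T u)
    (hbc : ∀ t ∈ Icc 0 T, dρ u 0 t = 0 ∧ dρ u 1 t = 0) :
    ∃ B, 0 ≤ B ∧ ∀ ρ ∈ Icc (0 : ℝ) 1,
      (∀ s ∈ Icc 0 T, ∀ t ∈ Icc 0 T, |u ρ t - u ρ s| ≤ B * |t - s|) ∧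
      ContinuousOn (dt T u ρ) (Icc 0 T) ∧
      ∀ t s, 0 ≤ s → t ≤ T → 0 ≤ t - 2 * s →
        |u ρ t - 2 * u ρ (t - s) + u ρ (t - 2 * s)| ≤ B * s ^ 2 ∧
        |3 * u ρ t - 4 * u ρ (t - s) + u ρ (t - 2 * s) - 2 * s * dt T u ρ t| ≤ B * s ^ 3 := by
  obtain ⟨A, hA0, hA⟩ := exists_bound (h.continuousOn hbc)
  obtain ⟨B, hB⟩ := h.time_bdd
  have hB0 : 0 ≤ B := (abs_nonneg _).trans
    (hB 0 (left_mem_Icc.2 zero_le_one) 0 (left_mem_Icc.2 hT.le))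
  set Y := 36 * A / T ^ 2 + B * T with hY
  set Z := 6 * A / T + Y * T with hZ
  have hY0 : 0 ≤ Y := by positivity
  have hZ0 : 0 ≤ Z := by positivity
  -- The summands serve in turn the Lipschitz bound, the second differences and the backward
  -- difference formula; in the last, third derivatives bounded by `B` give `2 B` for second
  -- differences of the derivative, then `4 B`.
  refine ⟨Z + 2 * Y + 4 * B, by positivity, fun ρ hρ => ?_⟩
  have h1 : ∀ x ∈ Icc 0 T, HasDerivWithinAt (u ρ) (dt T u ρ x) (Icc 0 T) x := fun x hx =>
    ((h.time ρ hρ).differentiableOn (by norm_num) x hx).hasDerivWithinAt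
  have h2 : ∀ x ∈ Icc 0 T, HasDerivWithinAt (dt T u ρ)
      (iteratedDerivWithin 2 (u ρ) (Icc 0 T) x) (Icc 0 T) x := fun x hx => by
    have := hasDeriv_iterated hT (h.time ρ hρ) (k := 1) (by norm_num) hx
    exact this.congr (fun x _ => by rw [iteratedDerivWithin_one, dt])
      (by rw [iteratedDerivWithin_one, dt])
  have h3 : ∀ x ∈ Icc 0 T, HasDerivWithinAt (iteratedDerivWithin 2 (u ρ) (Icc 0 T))
      (iteratedDerivWithin 3 (u ρ) (Icc 0 T) x) (Icc 0 T) x := fun x hx =>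
    hasDeriv_iterated hT (h.time ρ hρ) (k := 2) (by norm_num) hx
  have hb := bound_derivatives hT h1 h2 h3 (fun x hx => hA ρ hρ x hx) (hB ρ hρ)
  refine ⟨fun s hs t ht => ?_, fun x hx => (h2 x hx).continuousWithinAt, ?_⟩
  · refine (abs_sub_le_of_hasDeriv h1 (fun x hx => (hb x hx).2) ht hs).trans ?_
    rw [← hY, ← hZ]
    exact mul_le_mul_of_nonneg_right (by linarith) (abs_nonneg _)
  · intro t s hs ht hts
    have hm : ∀ σ ∈ Icc 0 s, t - σ ∈ Icc 0 T ∧ t - 2 * σ ∈ Icc 0 T := fun σ hσ =>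
      ⟨⟨by linarith [hσ.2], by linarith [hσ.1]⟩, ⟨by linarith [hσ.2], by linarith [hσ.1]⟩⟩
    have hdiff : ∀ σ ∈ Icc 0 s, |(t - σ) - (t - 2 * σ)| = σ := fun σ hσ => by
      rw [show (t - σ) - (t - 2 * σ) = σ by ring, abs_of_nonneg hσ.1]
    have e1 := second_diff_le h1 hs ht hts (B := Y) (fun σ hσ => by
      refine (abs_sub_le_of_hasDeriv h2 (fun x hx => (hb x hx).1) (hm σ hσ).1
        (hm σ hσ).2).trans_eq ?_
      rw [hdiff σ hσ]) hY0
    have e2 := bdf_consistency h1 hs ht hts (C := 2 * B) (fun σ hσ => by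
      refine second_diff_le h2 hσ.1 ht (hm σ hσ).2.1 (B := B) (fun τ hτ => ?_) hB0
      have hτ' : τ ∈ Icc 0 s := ⟨hτ.1, hτ.2.trans hσ.2⟩
      refine (abs_sub_le_of_hasDeriv h3 (hB ρ hρ) (hm τ hτ').1 (hm τ hτ').2).trans_eq ?_
      rw [hdiff τ hτ']) (by positivity)
    constructor
    · refine e1.trans ?_
      gcongr; linarith
    · refine e2.trans ?_
      gcongr; linarith

/-! ### Approximation by trial functions -/

/-- The Bernstein polynomial of degree `N` of a function on `[0, 1]`. -/
def bern (N : ℕ) (g : ℝ → ℝ) : ℝ[X] :=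
  ∑ k : Fin (N + 1), C (g (k / N)) * bernsteinPolynomial ℝ N k

lemma bern_mem (N : ℕ) (g : ℝ → ℝ) : bern N g ∈ degreeLE ℝ N := by
  refine Submodule.sum_mem _ fun k _ => ?_
  rw [← smul_eq_C_mul]
  refine Submodule.smul_mem _ _ (mem_degreeLE.2 (degree_le_of_natDegree_le ?_))
  have h1X : (1 - X : ℝ[X]).natDegree ≤ 1 := (natDegree_sub_le _ _).trans (by simp)
  have hk : (k : ℕ) ≤ N := Nat.lt_succ_iff.1 k.2
  have h1 : ((N.choose k : ℝ[X]) * X ^ (k : ℕ)).natDegree ≤ (k : ℕ) := by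
    rw [← C_eq_natCast]; exact natDegree_C_mul_X_pow_le _ _
  have h2 := natDegree_mul_le (p := (N.choose k : ℝ[X]) * X ^ (k : ℕ)) (q := (1 - X) ^ (N - k))
  have h3 : ((1 - X : ℝ[X]) ^ (N - k)).natDegree ≤ N - k :=
    natDegree_pow_le.trans (by nlinarith)
  rw [bernsteinPolynomial]
  omega

/-- Uniform convergence of the Bernstein polynomials in the space variable. -/
lemma exists_bern_rate {T : ℝ} {g : ℝ → ℝ → ℝ}
    (hg : ContinuousOn (fun q : ℝ × ℝ => g q.1 q.2) (Icc 0 1 ×ˢ Icc 0 T)) :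
    ∃ ω : ℕ → ℝ, (∀ N, 0 ≤ ω N) ∧ Tendsto ω atTop (𝓝 0) ∧ ∀ N, ∀ t ∈ Icc 0 T,
      ∀ ρ ∈ Icc (0 : ℝ) 1, |(bern N fun x => g x t).eval ρ - g ρ t| ≤ ω N := by
  let G : C(unitInterval × Icc 0 T, ℝ) := ⟨fun q => g q.1 q.2, by
    refine hg.comp_continuous (f := fun q : unitInterval × Icc 0 T => ((q.1 : ℝ), (q.2 : ℝ)))
      (by fun_prop) fun q => ⟨q.1.2, q.2.2⟩⟩
  -- Uniformity in `t` comes for free from Bernstein's theorem for the curried function, with values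
  -- in the Banach space of continuous functions of time.
  obtain ⟨f, hf⟩ : ∃ f : C(unitInterval, C(Icc 0 T, ℝ)), ∀ x t, f x t = g x t :=
    ⟨G.curry, fun _ _ => rfl⟩
  have hlim := (tendsto_iff_norm_sub_tendsto_zero (E := C(unitInterval, C(Icc 0 T, ℝ)))
    (f := fun n => bernsteinApproximation n f) (a := atTop) (b := f)).1
    (bernsteinApproximation_uniform f)
  refine ⟨fun N => ‖bernsteinApproximation N f - f‖, fun N => norm_nonneg (bernsteinApproximation N f - f), hlim, ?_⟩
  intro N t ht ρ hρ
  have h1 := ((bernsteinApproximation N f - f) ⟨ρ, hρ⟩).norm_coe_le_norm ⟨t, ht⟩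
  have h2 := (bernsteinApproximation N f - f).norm_coe_le_norm ⟨ρ, hρ⟩
  have h3 : (bern N fun x => g x t).eval ρ - g ρ t
      = (bernsteinApproximation N f - f) ⟨ρ, hρ⟩ ⟨t, ht⟩ := by
    rw [ContinuousMap.sub_apply, ContinuousMap.sub_apply, bernsteinApproximation.apply,
      ContinuousMap.sum_apply, bern, eval_finsetSum, hf]
    congr 1
    refine Finset.sum_congr rfl fun k _ => ?_
    rw [eval_mul, eval_C, mul_comm, ContinuousMap.smul_apply, smul_eq_mul, bernstein_apply, hf]
    simp only [bernsteinPolynomial, eval_mul, eval_natCast, eval_pow, eval_X, eval_sub, eval_one]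
    rfl
  rw [h3]
  exact h1.trans h2

lemma abs_le_of_double_deriv {c : ℝ} {z z₁ z₂ : ℝ → ℝ}
    (h1 : ∀ x ∈ Icc (0 : ℝ) 1, HasDerivWithinAt z (z₁ x) (Icc 0 1) x)
    (h2 : ∀ x ∈ Icc (0 : ℝ) 1, HasDerivWithinAt z₁ (z₂ x) (Icc 0 1) x)
    (h0 : z 0 = 0) (h10 : z₁ 0 = 0) (hc : ∀ x ∈ Icc (0 : ℝ) 1, |z₂ x| ≤ c) :
    ∀ x ∈ Icc (0 : ℝ) 1, |z x| ≤ c ∧ |z₁ x| ≤ c := by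
  have h0m : (0 : ℝ) ∈ Icc (0 : ℝ) 1 := left_mem_Icc.2 zero_le_one
  have hc0 : 0 ≤ c := (abs_nonneg _).trans (hc 0 h0m)
  have e1 : ∀ x ∈ Icc (0 : ℝ) 1, |z₁ x| ≤ c := fun x hx => by
    have := abs_sub_le_of_hasDeriv h2 hc hx h0m
    rw [h10, sub_zero, sub_zero, abs_of_nonneg hx.1] at this
    exact this.trans (mul_le_of_le_one_right hc0 hx.2)
  refine fun x hx => ⟨?_, e1 x hx⟩
  have := abs_sub_le_of_hasDeriv h1 e1 hx h0m
  rw [h0, sub_zero, sub_zero, abs_of_nonneg hx.1] at this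
  exact this.trans (mul_le_of_le_one_right hc0 hx.2)

/-- Approximating the second derivative gives a trial function approximating in `C²`. -/
lemma trialOf_close {p : ℝ[X]} {c : ℝ} {u u₁ u₂ : ℝ → ℝ}
    (h1 : ∀ x ∈ Icc (0 : ℝ) 1, HasDerivWithinAt u (u₁ x) (Icc 0 1) x)
    (h2 : ∀ x ∈ Icc (0 : ℝ) 1, HasDerivWithinAt u₁ (u₂ x) (Icc 0 1) x)
    (hu₂ : ContinuousOn u₂ (Icc 0 1)) (h10 : u₁ 0 = 0) (h11 : u₁ 1 = 0)
    (hc : ∀ x ∈ Icc (0 : ℝ) 1, |p.eval x - u₂ x| ≤ c) :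
    ∀ x ∈ Icc (0 : ℝ) 1, |(trialOf p (u 0)).eval x - u x| ≤ 2 * c ∧
      |(derivative (trialOf p (u 0))).eval x - u₁ x| ≤ 2 * c ∧
      |(derivative (derivative (trialOf p (u 0)))).eval x - u₂ x| ≤ 2 * c := by
  -- By the Neumann conditions `u₂` has mean zero, so subtracting the mean of `p` costs at most
  -- another `c`.
  have hint : ∫ x in (0 : ℝ)..1, u₂ x = 0 := by
    rw [intervalIntegral.integral_eq_sub_of_hasDerivAt_of_le zero_le_one
      (fun x hx => (h2 x hx).continuousWithinAt)
      (fun x hx => (h2 x (Ioo_subset_Icc_self hx)).hasDerivAt (Icc_mem_nhds hx.1 hx.2))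
      (ContinuousOn.intervalIntegrable (by rwa [uIcc_of_le zero_le_one])), h10, h11, sub_zero]
  have hmean : |intg p| ≤ c := by
    have e1 : intg p = ∫ x in (0 : ℝ)..1, (p.eval x - u₂ x) := by
      rw [intervalIntegral.integral_sub (intervalIntegrable_eval p 0 1)
        (ContinuousOn.intervalIntegrable (by rwa [uIcc_of_le zero_le_one])), hint, sub_zero,
        intg_apply]
    rw [e1]
    have := intervalIntegral.norm_integral_le_of_norm_le_const (a := (0 : ℝ)) (b := 1)
      (f := fun x => p.eval x - u₂ x) (C := c) (fun x hx => by
        rw [uIoc_of_le zero_le_one] at hx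
        exact hc x (Ioc_subset_Icc_self hx))
    simpa using this
  have hsec : ∀ x ∈ Icc (0 : ℝ) 1,
      |(derivative (derivative (trialOf p (u 0)))).eval x - u₂ x| ≤ 2 * c := fun x hx => by
    rw [second_trialOf, eval_sub, eval_C, sub_right_comm]
    exact (abs_sub _ _).trans (by linarith [hc x hx])
  have key := abs_le_of_double_deriv
    (z := fun x => (trialOf p (u 0)).eval x - u x)
    (fun x hx => ((trialOf p (u 0)).hasDerivAt x).hasDerivWithinAt.sub (h1 x hx))
    (fun x hx => ((derivative (trialOf p (u 0))).hasDerivAt x).hasDerivWithinAt.sub (h2 x hx))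
    (by rw [trialOf_eval_zero, sub_self])
    (by rw [derivative_trialOf, antideriv_eval_zero, h10, sub_zero]) hsec
  exact fun x hx => ⟨(key x hx).1, (key x hx).2, hsec x hx⟩

lemma trialOf_sub (p q : ℝ[X]) (c d : ℝ) :
    trialOf p c - trialOf q d = trialOf (p - q) (c - d) := by
  simp only [trialOf, map_sub]
  abel

/-- Needed for the Lipschitz bound in time: a jointly continuous time derivative of `∂²u/∂ρ²` can
itself be approximated uniformly by Bernstein polynomials. -/
lemma Smooth.hasDeriv_second_time {T : ℝ} (hT : 0 < T) {u : ℝ → ℝ → ℝ} (h : Smooth T u) :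
    ∃ g' : ℝ → ℝ → ℝ, ContinuousOn (fun q : ℝ × ℝ => g' q.1 q.2) (Icc 0 1 ×ˢ Icc 0 T) ∧
      ∀ ρ ∈ Icc (0 : ℝ) 1, ∀ t ∈ Icc 0 T,
        HasDerivWithinAt (fun t => dρρ u ρ t) (g' ρ t) (Icc 0 T) t := by
  set Q : Set (ℝ × ℝ) := Icc 0 1 ×ˢ Icc 0 T
  have hQ : UniqueDiffOn ℝ Q := (uniqueDiffOn_Icc zero_lt_one).prod (uniqueDiffOn_Icc hT)
  refine ⟨fun ρ t => fderivWithin ℝ (fun q : ℝ × ℝ => dρρ u q.1 q.2) Q (ρ, t) (0, 1), ?_, ?_⟩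
  · exact (h.second.continuousOn_fderivWithin hQ le_rfl).clm_apply continuousOn_const
  · intro ρ hρ t ht
    have h1 := ((h.second.differentiableOn one_ne_zero) (ρ, t) ⟨hρ, ht⟩).hasFDerivWithinAt
    have h2 : HasDerivWithinAt (fun t : ℝ => (ρ, t)) ((0 : ℝ), (1 : ℝ)) (Icc 0 T) t :=
      ((hasDerivAt_const t ρ).prodMk (hasDerivAt_id t)).hasDerivWithinAt
    exact h1.comp_hasDerivWithinAt t h2 fun s hs => ⟨hρ, hs⟩

/-- The trial functions `U t` are within `ω` of `u` in `C²`, and the error is Lipschitz in time with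
constant `ω`. -/
structure IsApprox (T : ℝ) (N : ℕ) (ω : ℝ) (u : ℝ → ℝ → ℝ) (U : ℝ → ℝ[X]) : Prop where
  trial : ∀ t ∈ Icc 0 T, IsTrial N (U t)
  close : ∀ t ∈ Icc 0 T, ∀ ρ ∈ Icc (0 : ℝ) 1, |(U t).eval ρ - u ρ t| ≤ ω ∧
    |(derivative (U t)).eval ρ - dρ u ρ t| ≤ ω ∧
    |(derivative (derivative (U t))).eval ρ - dρρ u ρ t| ≤ ω
  time : ∀ t ∈ Icc 0 T, ∀ s ∈ Icc 0 T, ∀ ρ ∈ Icc (0 : ℝ) 1,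
    |((U t).eval ρ - u ρ t) - ((U s).eval ρ - u ρ s)| ≤ ω * |t - s|

/-- Trial functions approximating a smooth function uniformly in time, with an error that is
Lipschitz in time with small constant. -/
lemma Smooth.exists_approx {T : ℝ} (hT : 0 < T) {u : ℝ → ℝ → ℝ} (h : Smooth T u)
    (hbc : ∀ t ∈ Icc 0 T, dρ u 0 t = 0 ∧ dρ u 1 t = 0) :
    ∃ ω : ℕ → ℝ, (∀ N, 0 ≤ ω N) ∧ Tendsto ω atTop (𝓝 0) ∧
      ∀ N, ∃ U : ℝ → ℝ[X], IsApprox T N (ω N) u U := by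
  obtain ⟨g', hg', hder⟩ := h.hasDeriv_second_time hT
  obtain ⟨ω₁, h10, h1t, h1⟩ := exists_bern_rate h.continuousOn_second
  obtain ⟨ω₂, h20, h2t, h2⟩ := exists_bern_rate hg'
  refine ⟨fun N => 2 * ω₁ N + 2 * ω₂ N, fun N => by linarith [h10 N, h20 N], ?_, fun N =>
    ⟨fun t => trialOf (bern N fun x => dρρ u x t) (u 0 t),
      fun t ht => isTrial_trialOf (bern_mem N _) _, fun t ht ρ hρ => ?_,
      fun t ht s hs ρ hρ => ?_⟩⟩
  · simpa using (h1t.const_mul 2).add (h2t.const_mul 2)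
  · have hcont : ContinuousOn (fun x => dρρ u x t) (Icc 0 1) :=
      h.continuousOn_second.comp (f := fun x => (x, t)) (by fun_prop) fun x hx => ⟨hx, ht⟩
    have key := trialOf_close (fun x hx => h.hasDeriv_space ht hx)
      (fun x hx => h.hasDeriv_grad ht hx) hcont (hbc t ht).1 (hbc t ht).2 (h1 N t ht) ρ hρ
    have := h20 N
    exact ⟨key.1.trans (by linarith), key.2.1.trans (by linarith), key.2.2.trans (by linarith)⟩
  · have hcont : ∀ t ∈ Icc 0 T, ContinuousOn (fun x => dρρ u x t) (Icc 0 1) := fun t ht =>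
      h.continuousOn_second.comp (f := fun x => (x, t)) (by fun_prop) fun x hx => ⟨hx, ht⟩
    -- The Bernstein operator acts in `ρ` alone and commutes with the time derivative, so the time
    -- derivative of the approximation error is the Bernstein error of `g'`, at most `ω₂ N`.
    have hclose : ∀ x ∈ Icc (0 : ℝ) 1,
        |((bern N fun x => dρρ u x t) - bern N fun x => dρρ u x s).eval x
          - (dρρ u x t - dρρ u x s)| ≤ ω₂ N * |t - s| := by
      intro x hx
      have hd : ∀ τ ∈ Icc 0 T, HasDerivWithinAt
          (fun τ => (bern N fun x => dρρ u x τ).eval x - dρρ u x τ)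
          ((bern N fun x => g' x τ).eval x - g' x τ) (Icc 0 T) τ := by
        intro τ hτ
        refine HasDerivWithinAt.sub ?_ (hder x hx τ hτ)
        simp only [bern, eval_finsetSum, eval_mul, eval_C]
        refine HasDerivWithinAt.fun_sum fun k _ => HasDerivWithinAt.mul_const (hder _ ?_ τ hτ) _
        have hk : (k : ℕ) ≤ N := Nat.lt_succ_iff.1 k.2
        exact ⟨by positivity, div_le_one_of_le₀ (by exact_mod_cast hk) (Nat.cast_nonneg _)⟩
      have := abs_sub_le_of_hasDeriv hd (fun τ hτ => h2 N τ hτ x hx) ht hs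
      rw [eval_sub]
      refine le_trans (le_of_eq ?_) this
      congr 1; ring
    have key := (trialOf_close (u := fun x => u x t - u x s)
      (fun x hx => (h.hasDeriv_space ht hx).sub (h.hasDeriv_space hs hx))
      (fun x hx => (h.hasDeriv_grad ht hx).sub (h.hasDeriv_grad hs hx))
      ((hcont t ht).sub (hcont s hs)) (by rw [(hbc t ht).1, (hbc s hs).1, sub_zero])
      (by rw [(hbc t ht).2, (hbc s hs).2, sub_zero]) hclose ρ hρ).1
    rw [← trialOf_sub, eval_sub] at key
    have e : 2 * (ω₂ N * |t - s|) ≤ (2 * ω₁ N + 2 * ω₂ N) * |t - s| := by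
      nlinarith [mul_nonneg (h10 N) (abs_nonneg (t - s))]
    refine le_trans (le_of_eq ?_) (key.trans e)
    congr 1; ring

/-! ### Twice differentiable maps near a compact set -/

/-- A `C²` map is Lipschitz, and its second differences are controlled, uniformly near a compact
set. -/
lemma exists_lipschitz_near {E F : Type*} [NormedAddCommGroup E] [NormedSpace ℝ E]
    [NormedAddCommGroup F] [NormedSpace ℝ F] {Φ : E → F} {S : Set E} (hS : IsCompact S)
    (hΦ : ∀ x ∈ S, ContDiffAt ℝ 2 Φ x) :
    ∃ r > 0, ∃ C, 0 ≤ C ∧ ∀ x ∈ S, ∀ y, ‖y - x‖ ≤ r →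
      ContinuousAt Φ y ∧ ‖Φ y - Φ x‖ ≤ C * ‖y - x‖ ∧
      ∀ z, ‖z - x‖ ≤ r → ‖Φ y - (2 : ℝ) • Φ x + Φ z‖
        ≤ C * (‖y - x‖ ^ 2 + ‖z - x‖ ^ 2 + ‖y - (2 : ℝ) • x + z‖) := by
  refine hS.induction_on (p := fun S => ∃ r > 0, ∃ C, 0 ≤ C ∧ ∀ x ∈ S, ∀ y, ‖y - x‖ ≤ r →
      ContinuousAt Φ y ∧ ‖Φ y - Φ x‖ ≤ C * ‖y - x‖ ∧
      ∀ z, ‖z - x‖ ≤ r → ‖Φ y - (2 : ℝ) • Φ x + Φ z‖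
        ≤ C * (‖y - x‖ ^ 2 + ‖z - x‖ ^ 2 + ‖y - (2 : ℝ) • x + z‖))
    ⟨1, one_pos, 0, le_rfl, by simp⟩ ?_ ?_ ?_
  · rintro s t hst ⟨r, hr, C, hC, h⟩
    exact ⟨r, hr, C, hC, fun x hx => h x (hst hx)⟩
  · rintro s t ⟨r, hr, C, hC, h⟩ ⟨r', hr', C', hC', h'⟩
    refine ⟨min r r', lt_min hr hr', max C C', hC.trans (le_max_left _ _), ?_⟩
    rintro x (hx | hx) y hy
    · obtain ⟨h1, h2, h3⟩ := h x hx y (hy.trans (min_le_left _ _))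
      refine ⟨h1, h2.trans (by gcongr; exact le_max_left _ _), fun z hz =>
        (h3 z (hz.trans (min_le_left _ _))).trans (by gcongr; exact le_max_left _ _)⟩
    · obtain ⟨h1, h2, h3⟩ := h' x hx y (hy.trans (min_le_right _ _))
      refine ⟨h1, h2.trans (by gcongr; exact le_max_right _ _), fun z hz =>
        (h3 z (hz.trans (min_le_right _ _))).trans (by gcongr; exact le_max_right _ _)⟩
  · intro x₀ hx₀
    -- Locally the derivative is Lipschitz. Compactness of `S` glues the local statements, with the
    -- smaller radius and the larger constant.
    obtain ⟨K, s, hs, hK⟩ := ((hΦ x₀ hx₀).fderiv_right (m := 1) (by norm_num)).exists_lipschitzOnWith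
    have hev : ∀ᶠ y in 𝓝 x₀, ContDiffAt ℝ 2 Φ y ∧ y ∈ s :=
      ((hΦ x₀ hx₀).eventually (by simp)).and hs
    obtain ⟨δ, hδ, hball⟩ := Metric.eventually_nhds_iff_ball.1 hev
    have hdiff : ∀ y ∈ Metric.ball x₀ δ, DifferentiableAt ℝ Φ y := fun y hy =>
      (hball y hy).1.differentiableAt two_ne_zero
    have hLip : ∀ y ∈ Metric.ball x₀ δ, ∀ z ∈ Metric.ball x₀ δ,
        ‖fderiv ℝ Φ y - fderiv ℝ Φ z‖ ≤ K * ‖y - z‖ := fun y hy z hz => by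
      rw [← dist_eq_norm, ← dist_eq_norm]
      exact hK.dist_le_mul _ (hball y hy).2 _ (hball z hz).2
    have hx₀b : x₀ ∈ Metric.ball x₀ δ := Metric.mem_ball_self hδ
    set B := ‖fderiv ℝ Φ x₀‖ + K * δ with hB
    have hB0 : 0 ≤ B := by positivity
    have hbound : ∀ y ∈ Metric.ball x₀ δ, ‖fderiv ℝ Φ y‖ ≤ B := fun y hy => by
      have h1 := hLip y hy x₀ hx₀b
      have h2 : ‖y - x₀‖ ≤ δ := by rw [← dist_eq_norm]; exact (Metric.mem_ball.1 hy).le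
      have h3 : (K : ℝ) * ‖y - x₀‖ ≤ K * δ := by gcongr
      have h4 := norm_add_le (fderiv ℝ Φ y - fderiv ℝ Φ x₀) (fderiv ℝ Φ x₀)
      rw [sub_add_cancel] at h4
      linarith
    have htaylor : ∀ x ∈ Metric.ball x₀ δ, ∀ y ∈ Metric.ball x₀ δ,
        ‖Φ y - Φ x - fderiv ℝ Φ x (y - x)‖ ≤ K * ‖y - x‖ ^ 2 := by
      intro x hx y hy
      have hconv : Convex ℝ (Metric.ball x₀ δ ∩ Metric.closedBall x ‖y - x‖) :=
        (convex_ball _ _).inter (convex_closedBall _ _)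
      have := hconv.norm_image_sub_le_of_norm_fderiv_le' (𝕜 := ℝ) (f := Φ) (φ := fderiv ℝ Φ x)
        (C := K * ‖y - x‖) (fun w hw => hdiff w hw.1) (fun w hw => (hLip w hw.1 x hx).trans (by
          gcongr; rw [← dist_eq_norm]; exact hw.2))
        (x := x) (y := y) ⟨hx, Metric.mem_closedBall_self (norm_nonneg _)⟩
        ⟨hy, by rw [Metric.mem_closedBall, dist_eq_norm]⟩
      rw [pow_two, ← mul_assoc]
      exact this
    refine ⟨Metric.ball x₀ (δ / 2), mem_nhdsWithin_of_mem_nhds (Metric.ball_mem_nhds _ (by positivity)),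
      δ / 4, by positivity, B + K, by positivity, ?_⟩
    have hmem : ∀ x ∈ Metric.ball x₀ (δ / 2), ∀ y, ‖y - x‖ ≤ δ / 4 → y ∈ Metric.ball x₀ δ := by
      intro x hx y hy
      rw [Metric.mem_ball] at hx ⊢
      rw [← dist_eq_norm] at hy
      linarith [dist_triangle y x x₀]
    intro x hx y hy
    have hxb : x ∈ Metric.ball x₀ δ := hmem x hx x (by rw [sub_self, norm_zero]; positivity)
    have hyb := hmem x hx y hy
    refine ⟨(hdiff y hyb).continuousAt, ?_, fun z hz => ?_⟩
    · refine ((convex_ball x₀ δ).norm_image_sub_le_of_norm_fderiv_le (𝕜 := ℝ) hdiff hbound hxb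
        hyb).trans ?_
      gcongr
      exact le_add_of_nonneg_right K.2
    · have hzb := hmem x hx z hz
      -- A second difference is two quadratic Taylor remainders at the middle point plus the
      -- derivative applied to the second difference of the arguments.
      have e : Φ y - (2 : ℝ) • Φ x + Φ z = (Φ y - Φ x - fderiv ℝ Φ x (y - x))
          + (Φ z - Φ x - fderiv ℝ Φ x (z - x)) + fderiv ℝ Φ x (y - (2 : ℝ) • x + z) := by
        have : fderiv ℝ Φ x (y - (2 : ℝ) • x + z) = fderiv ℝ Φ x (y - x) + fderiv ℝ Φ x (z - x) := by
          rw [← map_add]; congr 1; module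
        rw [this]; module
      rw [e]
      refine (norm_add₃_le).trans ?_
      have h1 := htaylor x hxb y hyb
      have h2 := htaylor x hxb z hzb
      have h3 := ((fderiv ℝ Φ x).le_opNorm (y - (2 : ℝ) • x + z)).trans
        (mul_le_mul_of_nonneg_right (hbound x hxb) (norm_nonneg _))
      have h4 := mul_nonneg hB0 (sq_nonneg ‖y - x‖)
      have h5 := mul_nonneg hB0 (sq_nonneg ‖z - x‖)
      have h6 := mul_nonneg K.coe_nonneg (norm_nonneg (y - (2 : ℝ) • x + z))
      nlinarith

/-! ### Uniform regularity in time -/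

/-- Lipschitz continuity in `t` for short times, uniformly in `ρ`. -/
def UnifLip {E : Type*} [NormedAddCommGroup E] (T : ℝ) (x : ℝ → ℝ → E) : Prop :=
  ∃ s₀ > 0, ∃ B, 0 ≤ B ∧ ∀ ρ ∈ Icc (0 : ℝ) 1, ∀ s ∈ Icc 0 T, ∀ t ∈ Icc 0 T, |t - s| ≤ s₀ →
    ‖x ρ t - x ρ s‖ ≤ B * |t - s|

/-- Second differences in `t` of the size of the square of the step, uniformly in `ρ`. -/
def UnifSecond {E : Type*} [NormedAddCommGroup E] [NormedSpace ℝ E] (T : ℝ) (x : ℝ → ℝ → E) :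
    Prop :=
  ∃ s₀ > 0, ∃ B, 0 ≤ B ∧ ∀ ρ ∈ Icc (0 : ℝ) 1, ∀ t s, 0 ≤ s → s ≤ s₀ → t ≤ T → 0 ≤ t - 2 * s →
    ‖x ρ t - (2 : ℝ) • x ρ (t - s) + x ρ (t - 2 * s)‖ ≤ B * s ^ 2

lemma exists_common {n : ℕ} {s B : Fin (n + 1) → ℝ} (hs : ∀ i, 0 < s i) (hB : ∀ i, 0 ≤ B i) :
    ∃ s₀ > 0, ∃ B₀, 0 ≤ B₀ ∧ ∀ i, s₀ ≤ s i ∧ B i ≤ B₀ := by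
  obtain ⟨i, hi⟩ := Finite.exists_min s
  exact ⟨s i, hs i, ∑ j, B j, Finset.sum_nonneg fun j _ => hB j, fun j =>
    ⟨hi j, Finset.single_le_sum (fun k _ => hB k) (Finset.mem_univ j)⟩⟩

lemma UnifLip.pi {n : ℕ} {T : ℝ} {x : ℝ → ℝ → Fin (n + 1) → ℝ}
    (h : ∀ i, UnifLip T fun ρ t => x ρ t i) : UnifLip T x := by
  choose s hs B hB h using h
  obtain ⟨s₀, hs₀, B₀, hB₀, hle⟩ := exists_common hs hB
  refine ⟨s₀, hs₀, B₀, hB₀, fun ρ hρ s' hs' t ht hst => ?_⟩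
  rw [pi_norm_le_iff_of_nonneg (by positivity)]
  exact fun i => (h i ρ hρ s' hs' t ht (hst.trans (hle i).1)).trans (by gcongr; exact (hle i).2)

lemma UnifSecond.pi {n : ℕ} {T : ℝ} {x : ℝ → ℝ → Fin (n + 1) → ℝ}
    (h : ∀ i, UnifSecond T fun ρ t => x ρ t i) : UnifSecond T x := by
  choose s hs B hB h using h
  obtain ⟨s₀, hs₀, B₀, hB₀, hle⟩ := exists_common hs hB
  refine ⟨s₀, hs₀, B₀, hB₀, fun ρ hρ t s' hs' hss ht hts => ?_⟩
  rw [pi_norm_le_iff_of_nonneg (by positivity)]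
  exact fun i => (h i ρ hρ t s' hs' (hss.trans (hle i).1) ht hts).trans
    (by gcongr; exact (hle i).2)

lemma UnifLip.comp {E F : Type*} [NormedAddCommGroup E] [NormedSpace ℝ E]
    [NormedAddCommGroup F] [NormedSpace ℝ F] {T : ℝ} {x : ℝ → ℝ → E} {Φ : E → F} {S : Set E}
    (h : UnifLip T x) (hS : IsCompact S) (hΦ : ∀ x ∈ S, ContDiffAt ℝ 2 Φ x)
    (hx : ∀ ρ ∈ Icc (0 : ℝ) 1, ∀ t ∈ Icc 0 T, x ρ t ∈ S) : UnifLip T fun ρ t => Φ (x ρ t) := by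
  obtain ⟨r, hr, C, hC, hΦ'⟩ := exists_lipschitz_near hS hΦ
  obtain ⟨s₀, hs₀, B, hB, h⟩ := h
  refine ⟨min s₀ (r / (B + 1)), by positivity, C * B, by positivity, fun ρ hρ s hs t ht hst => ?_⟩
  have h1 := h ρ hρ s hs t ht (hst.trans (min_le_left _ _))
  have h2 : B * |t - s| ≤ r := by
    have := hst.trans (min_le_right _ _)
    rw [le_div_iff₀ (by positivity)] at this
    nlinarith [abs_nonneg (t - s)]
  refine (hΦ' _ (hx ρ hρ s hs) _ (h1.trans h2)).2.1.trans ?_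
  rw [mul_assoc]
  gcongr

/-- The middle time serves as base point. For short steps the neighbouring states stay in the region
where `Φ` is controlled; the squared increments and the second difference of `x` are both `O(s²)`.
-/
lemma UnifSecond.comp {E F : Type*} [NormedAddCommGroup E] [NormedSpace ℝ E]
    [NormedAddCommGroup F] [NormedSpace ℝ F] {T : ℝ} {x : ℝ → ℝ → E} {Φ : E → F} {S : Set E}
    (h' : UnifSecond T x) (h : UnifLip T x) (hS : IsCompact S)
    (hΦ : ∀ x ∈ S, ContDiffAt ℝ 2 Φ x)
    (hx : ∀ ρ ∈ Icc (0 : ℝ) 1, ∀ t ∈ Icc 0 T, x ρ t ∈ S) : UnifSecond T fun ρ t => Φ (x ρ t) := by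
  obtain ⟨r, hr, C, hC, hΦ'⟩ := exists_lipschitz_near hS hΦ
  obtain ⟨s₀, hs₀, B, hB, h⟩ := h
  obtain ⟨s₁, hs₁, B', hB', h'⟩ := h'
  refine ⟨min s₁ (min s₀ (r / (B + 1))), by positivity, C * (B ^ 2 + B ^ 2 + B'), by positivity,
    fun ρ hρ t s hs hss ht hts => ?_⟩
  have hsr : s ≤ r / (B + 1) := hss.trans ((min_le_right _ _).trans (min_le_right _ _))
  have hs0 : s ≤ s₀ := hss.trans ((min_le_right _ _).trans (min_le_left _ _))
  have h2 : B * s ≤ r := by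
    rw [le_div_iff₀ (by positivity)] at hsr
    nlinarith
  have m0 : t ∈ Icc 0 T := ⟨by linarith, ht⟩
  have m1 : t - s ∈ Icc 0 T := ⟨by linarith, by linarith⟩
  have m2 : t - 2 * s ∈ Icc 0 T := ⟨hts, by linarith⟩
  have a1 : |t - (t - s)| = s := by rw [sub_sub_cancel, abs_of_nonneg hs]
  have a2 : |t - 2 * s - (t - s)| = s := by
    rw [show t - 2 * s - (t - s) = -s by ring, abs_neg, abs_of_nonneg hs]
  have e1 := h ρ hρ _ m1 _ m0 (by rw [a1]; exact hs0)
  have e2 := h ρ hρ _ m1 _ m2 (by rw [a2]; exact hs0)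
  rw [a1] at e1
  rw [a2] at e2
  have e3 := h' ρ hρ t s hs (hss.trans (min_le_left _ _)) ht hts
  refine ((hΦ' _ (hx ρ hρ _ m1) _ (e1.trans h2)).2.2 _ (e2.trans h2)).trans ?_
  rw [mul_assoc]
  gcongr
  have e1' := pow_le_pow_left₀ (norm_nonneg _) e1 2
  have e2' := pow_le_pow_left₀ (norm_nonneg _) e2 2
  rw [mul_pow] at e1' e2'
  linarith

/-! ### The error equation of one unknown -/

/-- The error equation has the form of `energy_step`. Here `b` approximates the exact right-hand
side `f` by a polynomial which interpolation reproduces, so interpolation acts nontrivially only on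
the small function `2 f₁ - f₀ - b`. The remaining consistency terms enter pointwise; they are needed
only on the open interval, where the differential equation holds. -/
lemma component_step {N : ℕ} (hN : 2 ≤ N) {hs d d₀ dx Γ ε : ℝ} (hhs : 0 < hs) (hd₀ : 0 < d₀)
    (hd : d₀ ≤ d) {G : ℝ → ℝ} (hG : ContinuousOn G (Icc 0 1))
    (hΓ : ∀ ρ ∈ Icc (0 : ℝ) 1, |G ρ| ≤ Γ) {u₀ u₁ u₂ U₀ U₁ U₂ b : ℝ[X]} {f₀ f₁ : ℝ → ℝ}
    (hU₂ : IsTrial N U₂) (hstep : CollocStep N hs d G u₀ u₁ f₀ f₁ u₂)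
    (hb : b ∈ degreeLE ℝ N) {ut u' u'' Gx f : ℝ → ℝ}
    (hpde : ∀ ρ ∈ Ioo (0 : ℝ) 1, ut ρ - dx * u'' ρ + Gx ρ * u' ρ = f ρ)
    (hbf : ∀ ρ ∈ Icc (0 : ℝ) 1, |b.eval ρ - f ρ| ≤ ε)
    (hf : ∀ ρ ∈ Icc (0 : ℝ) 1, |2 * f₁ ρ - f₀ ρ - f ρ| ≤ ε)
    (ht : ∀ ρ ∈ Ioo (0 : ℝ) 1,
      |U₂.eval ρ - (4 * U₁.eval ρ - U₀.eval ρ) / 3 - hs * ut ρ| ≤ hs * ε)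
    (hdiff : ∀ ρ ∈ Ioo (0 : ℝ) 1, |d * (derivative (derivative U₂)).eval ρ - dx * u'' ρ| ≤ ε)
    (hconv : ∀ ρ ∈ Ioo (0 : ℝ) 1, |G ρ * (derivative U₂).eval ρ - Gx ρ * u' ρ| ≤ ε) :
    energy (u₂ - U₂) (u₁ - U₁) ≤ energy (u₁ - U₁) (u₀ - U₀)
      + ((3 / (2 * d₀) + 3) * (2 * Γ ^ 2 + 2) + 3) * hs
        * (energy (u₂ - U₂) (u₁ - U₁) + 40 * ε ^ 2) := by
  obtain ⟨hu₂, q, hq, hproj⟩ := hstep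
  have hpc : ∀ p : ℝ[X], ContinuousOn (fun ρ => p.eval ρ) (Icc (0 : ℝ) 1) :=
    fun p => p.continuous.continuousOn
  have ii : ∀ {f : ℝ → ℝ}, ContinuousOn f (Icc 0 1) →
      IntervalIntegrable f MeasureTheory.volume 0 1 := fun hf =>
    ContinuousOn.intervalIntegrable (by rwa [uIcc_of_le zero_le_one])
  set g : ℝ → ℝ := fun ρ => 2 * f₁ ρ - f₀ ρ - b.eval ρ with hg
  have hg2 : ∀ ρ ∈ Icc (0 : ℝ) 1, |g ρ| ≤ 2 * ε := fun ρ hρ => by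
    have h1 := abs_sub (2 * f₁ ρ - f₀ ρ - f ρ) (b.eval ρ - f ρ)
    have h2 : g ρ = (2 * f₁ ρ - f₀ ρ - f ρ) - (b.eval ρ - f ρ) := by simp only [hg]; ring
    rw [h2]
    linarith [hbf ρ hρ, hf ρ hρ]
  set J := lglInterp N g with hJ
  have hJ2 : intg (J ^ 2) ≤ (2 * ε) ^ 2 := intg_lglInterp_sq_le hN hg2
  have hI : lglInterp N (fun ρ => q.eval ρ + hs * (2 * f₁ ρ - f₀ ρ)) = q + hs • (J + b) := by
    have h1 : (fun ρ => q.eval ρ + hs * (2 * f₁ ρ - f₀ ρ))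
        = (fun ρ => q.eval ρ) + hs • (g + fun ρ => b.eval ρ) := by
      funext ρ
      simp only [Pi.add_apply, Pi.smul_apply, smul_eq_mul, hg]
      ring
    rw [h1, lglInterp_add, lglInterp_smul, lglInterp_add, lglInterp_eval (by omega) hq.1,
      lglInterp_eval (by omega) hb]
  set rest : ℝ → ℝ := fun ρ => b.eval ρ
    - (stepOp hs d G U₂ ρ - (4 * U₁.eval ρ - U₀.eval ρ) / 3) / hs with hrest
  have hrestc : ContinuousOn rest (Icc 0 1) :=
    (hpc b).fun_sub (((continuousOn_stepOp hG U₂).fun_sub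
      ((((hpc U₁).const_mul 4).fun_sub (hpc U₀)).div_const 3)).div_const hs)
  have hrest4 : ∀ ρ ∈ Ioo (0 : ℝ) 1, |rest ρ| ≤ 4 * ε := by
    intro ρ hρ
    have h1 := ht ρ hρ
    have h2 : |(U₂.eval ρ - (4 * U₁.eval ρ - U₀.eval ρ) / 3 - hs * ut ρ) / hs| ≤ ε := by
      rw [abs_div, abs_of_pos hhs, div_le_iff₀ hhs, mul_comm ε]; exact h1
    have h3 : rest ρ = (b.eval ρ - f ρ)
        - (U₂.eval ρ - (4 * U₁.eval ρ - U₀.eval ρ) / 3 - hs * ut ρ) / hs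
        + (d * (derivative (derivative U₂)).eval ρ - dx * u'' ρ)
        - (G ρ * (derivative U₂).eval ρ - Gx ρ * u' ρ) := by
      simp only [hrest, stepOp]
      rw [← hpde ρ hρ]
      field_simp
      ring
    rw [h3]
    have e1 := abs_le.1 (hbf ρ (Ioo_subset_Icc_self hρ))
    have e2 := abs_le.1 h2
    have e3 := abs_le.1 (hdiff ρ hρ)
    have e4 := abs_le.1 (hconv ρ hρ)
    rw [abs_le]
    constructor <;> linarith [e1.1, e1.2, e2.1, e2.2, e3.1, e3.2, e4.1, e4.2]
  -- `40 = 2 · 2² + 2 · 4²`: the interpolation part is at most `2 ε` in `L²`, and the rest is a sum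
  -- of four terms of size `ε`.
  have hReq : ∫ ρ in (0 : ℝ)..1, (J.eval ρ + rest ρ) ^ 2 ≤ 40 * ε ^ 2 := by
    have h1 : ∫ ρ in (0 : ℝ)..1, (J.eval ρ + rest ρ) ^ 2
        ≤ ∫ ρ in (0 : ℝ)..1, (2 * (J ^ 2).eval ρ + 2 * (4 * ε) ^ 2) := by
      refine intervalIntegral.integral_mono_on_of_le_Ioo zero_le_one
        (ii (((hpc J).fun_add hrestc).fun_pow 2))
        (ii (((hpc _).const_mul 2).fun_add continuousOn_const)) fun ρ hρ => ?_
      have h2 : rest ρ ^ 2 ≤ (4 * ε) ^ 2 := by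
        rw [← sq_abs]; exact pow_le_pow_left₀ (abs_nonneg _) (hrest4 ρ hρ) 2
      rw [eval_pow]
      nlinarith [sq_nonneg (J.eval ρ - rest ρ)]
    rw [intervalIntegral.integral_add (ii ((hpc _).const_mul 2)) (ii continuousOn_const),
      intervalIntegral.integral_const_mul, ← intg_apply] at h1
    simp only [intervalIntegral.integral_const, smul_eq_mul, sub_zero, one_mul] at h1
    nlinarith
  refine energy_step hhs.le hd₀ hd (hu₂.sub hU₂) hG hΓ ((hpc J).fun_add hrestc) hReq ?_
  intro w hw
  have h1 := hproj.2 w hw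
  have h2 := hq.2 w hw
  rw [hI] at h1
  have hc1 : ContinuousOn (fun ρ => (q + hs • (J + b)).eval ρ - (u₂.eval ρ
      - hs * d * (derivative (derivative u₂)).eval ρ
      + hs * (G ρ * (derivative u₂).eval ρ))) (Icc 0 1) :=
    (hpc _).fun_sub (continuousOn_stepOp hG u₂)
  have hc2 : ContinuousOn (fun ρ => q.eval ρ - (u₁.eval ρ - (u₀.eval ρ - u₁.eval ρ) / 3))
      (Icc 0 1) := (hpc q).fun_sub ((hpc u₁).fun_sub (((hpc u₀).fun_sub (hpc u₁)).div_const 3))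
  rw [← intervalIntegral.integral_const_mul]
  have h3 := intervalIntegral.integral_sub (ii (hc2.fun_mul (hpc w))) (ii (hc1.fun_mul (hpc w)))
  rw [h1, h2, sub_zero] at h3
  rw [← sub_eq_zero, ← intervalIntegral.integral_sub _
    (ii ((((hpc J).fun_add hrestc).fun_mul (hpc w)).const_mul hs))]
  · refine Eq.trans ?_ h3
    refine intervalIntegral.integral_congr fun ρ _ => ?_
    simp only [hrest, stepOp, eval_sub, eval_add, eval_smul, smul_eq_mul, derivative_sub]
    field_simp
    ring
  · refine ii (ContinuousOn.fun_mul ?_ (hpc w))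
    exact (((hpc _).fun_sub ((((hpc _).const_mul 4).fun_sub (hpc _)).div_const 3)).fun_sub
        ((hpc _).const_mul _)).fun_add ((hG.fun_mul (hpc _)).const_mul hs)

/-! ### The nonlinearities as maps of the state `(ρ, R, v₀, v, L, H, F)` -/

/-- The derivative of the velocity. -/
def velField (p : Params) (x : Fin 7 → ℝ) : ℝ :=
  (1 - x 1) * fv p (x 0) (x 1) (x 4) (x 5) (x 6)

/-- Reaction terms, convection coefficients and diffusion coefficient. -/
def field (p : Params) (x : Fin 7 → ℝ) : Fin 6 → ℝ :=
  ![fL p (x 0) (x 1) (x 2) (x 4) (x 6), fH p (x 0) (x 1) (x 2) (x 5) (x 6),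
    fF p (x 0) (x 1) (x 2) (x 3) (x 4) (x 5) (x 6), convL p (x 0) (x 1) (x 2),
    convF p (x 0) (x 1) (x 2) (x 3), 1 / (1 - x 1) ^ 2]

/-- States with positive radii at which no denominator vanishes. -/
structure Admissible (p : Params) (x : Fin 7 → ℝ) : Prop where
  pos : 0 ≤ x 0
  front : x 1 ∈ Ioo (0 : ℝ) 1
  denL : p.K1 + hatL p (x 0) (x 1) (x 4) ≠ 0
  denF : p.K2 + hatF p (x 0) (x 1) (x 6) ≠ 0
  denH : p.del + hatH p (x 0) (x 1) (x 5) ≠ 0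

lemma weight_ne_zero (a ρ R : ℝ) : weight a ρ R ≠ 0 := (Real.exp_pos _).ne'

lemma Admissible.contDiffAt_velField {p : Params} {x : Fin 7 → ℝ} (h : Admissible p x) :
    ContDiffAt ℝ 2 (velField p) x := by
  have h1 := h.denH
  unfold hatH weight at h1
  unfold velField fv hatL hatF hatH weight
  fun_prop (disch := assumption)

lemma Admissible.contDiffAt_field {p : Params} {x : Fin 7 → ℝ} (h : Admissible p x)
    (hM0 : p.M0 ≠ 0) : ContDiffAt ℝ 2 (field p) x := by
  have hL := h.denL
  have hF := h.denF
  have hH := h.denH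
  have hR : 1 - x 1 ≠ 0 := (sub_pos.2 h.front.2).ne'
  have hR2 : (1 - x 1) ^ 2 ≠ 0 := pow_ne_zero 2 hR
  have hMH : p.M0 * (p.del + hatH p (x 0) (x 1) (x 5)) ≠ 0 := mul_ne_zero hM0 hH
  -- This is `1 - R` times the physical radius `R + ρ (1 - R)`, which is positive because `0 < R <
  -- 1` and `0 ≤ ρ`.
  have hden : x 0 * (1 - x 1) ^ 2 + x 1 * (1 - x 1) ≠ 0 := by
    have := sub_pos.2 h.front.2
    have h1 := h.pos
    have h2 := h.front.1
    positivity
  have hwa := weight_ne_zero p.alpha (x 0) (x 1)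
  have hwb := weight_ne_zero p.beta (x 0) (x 1)
  unfold hatL weight at hL
  unfold hatF weight at hF
  unfold hatH weight at hH hMH
  unfold weight at hwa hwb
  rw [contDiffAt_pi]
  intro i
  fin_cases i
  · simp only [field, fL, reactL, hatL, hatF, weight, zeroth, drift]
    simp only [Fin.zero_eta, Matrix.cons_val_zero]
    fun_prop (disch := assumption)
  · simp only [field, fH, reactH, hatH, hatF, weight, zeroth, drift]
    simp
    fun_prop (disch := assumption)
  · simp only [field, fF, reactF, hatL, hatH, hatF, weight, zeroth, drift]
    simp
    fun_prop (disch := assumption)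
  · simp only [field, convL, drift]
    simp
    fun_prop (disch := assumption)
  · simp only [field, convF, drift]
    simp
    fun_prop (disch := assumption)
  · simp only [field]
    simp
    fun_prop (disch := assumption)

/-! ### Regularity of the exact solution -/

/-- The state of the exact solution. -/
def state (L H F v : ℝ → ℝ → ℝ) (R : ℝ → ℝ) (ρ t : ℝ) : Fin 7 → ℝ :=
  ![ρ, R t, v 0 t, v ρ t, L ρ t, H ρ t, F ρ t]

/-- The state of the exact solution without velocities. -/
def velState (L H F : ℝ → ℝ → ℝ) (R : ℝ → ℝ) (ρ t : ℝ) : Fin 7 → ℝ :=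
  ![ρ, R t, 0, 0, L ρ t, H ρ t, F ρ t]

lemma continuousOn_fin7 {α : Type*} [TopologicalSpace α] {s : Set α} {a b c d e f g : α → ℝ}
    (ha : ContinuousOn a s) (hb : ContinuousOn b s) (hc : ContinuousOn c s)
    (hd : ContinuousOn d s) (he : ContinuousOn e s) (hf : ContinuousOn f s)
    (hg : ContinuousOn g s) :
    ContinuousOn (fun q => (![a q, b q, c q, d q, e q, f q, g q] : Fin 7 → ℝ)) s := by
  rw [continuousOn_pi]
  intro i
  fin_cases i <;> assumption

lemma unifLip_fin7 {T : ℝ} {a b c d e f g : ℝ → ℝ → ℝ} (ha : UnifLip T a) (hb : UnifLip T b)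
    (hc : UnifLip T c) (hd : UnifLip T d) (he : UnifLip T e) (hf : UnifLip T f)
    (hg : UnifLip T g) :
    UnifLip T fun ρ t => (![a ρ t, b ρ t, c ρ t, d ρ t, e ρ t, f ρ t, g ρ t] : Fin 7 → ℝ) := by
  refine UnifLip.pi fun i => ?_
  fin_cases i <;> assumption

lemma unifSecond_fin7 {T : ℝ} {a b c d e f g : ℝ → ℝ → ℝ} (ha : UnifSecond T a)
    (hb : UnifSecond T b) (hc : UnifSecond T c) (hd : UnifSecond T d) (he : UnifSecond T e)
    (hf : UnifSecond T f) (hg : UnifSecond T g) :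
    UnifSecond T fun ρ t => (![a ρ t, b ρ t, c ρ t, d ρ t, e ρ t, f ρ t, g ρ t] : Fin 7 → ℝ) := by
  refine UnifSecond.pi fun i => ?_
  fin_cases i <;> assumption

lemma unifLip_const {T : ℝ} (a : ℝ → ℝ) : UnifLip T fun ρ _ => a ρ :=
  ⟨1, one_pos, 0, le_rfl, fun ρ _ s _ t _ _ => by simp⟩

lemma unifSecond_const {T : ℝ} (a : ℝ → ℝ) : UnifSecond T fun ρ _ => a ρ :=
  ⟨1, one_pos, 0, le_rfl, fun ρ _ t s _ _ _ _ => by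
    rw [smul_eq_mul, show a ρ - 2 * a ρ + a ρ = 0 by ring]; simp⟩

lemma Smooth.unifLip {T : ℝ} (hT : 0 < T) {u : ℝ → ℝ → ℝ} (h : Smooth T u)
    (hbc : ∀ t ∈ Icc 0 T, dρ u 0 t = 0 ∧ dρ u 1 t = 0) : UnifLip T u := by
  obtain ⟨B, hB, hreg⟩ := h.time_regularity hT hbc
  exact ⟨1, one_pos, B, hB, fun ρ hρ s hs t ht _ => (hreg ρ hρ).1 s hs t ht⟩

lemma Smooth.unifSecond {T : ℝ} (hT : 0 < T) {u : ℝ → ℝ → ℝ} (h : Smooth T u)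
    (hbc : ∀ t ∈ Icc 0 T, dρ u 0 t = 0 ∧ dρ u 1 t = 0) : UnifSecond T u := by
  obtain ⟨B, hB, hreg⟩ := h.time_regularity hT hbc
  exact ⟨1, one_pos, B, hB, fun ρ hρ t s hs _ ht hts => ((hreg ρ hρ).2.2 t s hs ht hts).1⟩

lemma abs_le_of_hasDeriv_of_one {c : ℝ} {f f' : ℝ → ℝ}
    (h : ∀ x ∈ Icc (0 : ℝ) 1, HasDerivWithinAt f (f' x) (Icc 0 1) x) (h1 : f 1 = 0)
    (hc : ∀ x ∈ Icc (0 : ℝ) 1, |f' x| ≤ c) : ∀ x ∈ Icc (0 : ℝ) 1, |f x| ≤ c := by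
  intro x hx
  have h1m : (1 : ℝ) ∈ Icc (0 : ℝ) 1 := right_mem_Icc.2 zero_le_one
  have hc0 : 0 ≤ c := (abs_nonneg _).trans (hc 1 h1m)
  have := abs_sub_le_of_hasDeriv h hc hx h1m
  rw [h1, sub_zero] at this
  refine this.trans (mul_le_of_le_one_right hc0 ?_)
  rw [abs_sub_le_iff]; constructor <;> linarith [hx.1, hx.2]

/-- The velocity inherits time regularity from its spatial derivative, since all differences vanish
at `ρ = 1`. -/
lemma UnifLip.of_hasDeriv {T : ℝ} {u g : ℝ → ℝ → ℝ}
    (hu : ∀ t ∈ Icc 0 T, ∀ ρ ∈ Icc (0 : ℝ) 1,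
      HasDerivWithinAt (fun x => u x t) (g ρ t) (Icc 0 1) ρ)
    (h1 : ∀ t ∈ Icc 0 T, u 1 t = 0) (hg : UnifLip T g) : UnifLip T u := by
  obtain ⟨s₀, hs₀, B, hB, h⟩ := hg
  exact ⟨s₀, hs₀, B, hB, fun ρ hρ s hs t ht hst =>
    abs_le_of_hasDeriv_of_one (f := fun x => u x t - u x s)
      (fun x hx => (hu t ht x hx).sub (hu s hs x hx)) (by rw [h1 t ht, h1 s hs, sub_zero])
      (fun x hx => h x hx s hs t ht hst) ρ hρ⟩

lemma UnifSecond.of_hasDeriv {T : ℝ} {u g : ℝ → ℝ → ℝ}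
    (hu : ∀ t ∈ Icc 0 T, ∀ ρ ∈ Icc (0 : ℝ) 1,
      HasDerivWithinAt (fun x => u x t) (g ρ t) (Icc 0 1) ρ)
    (h1 : ∀ t ∈ Icc 0 T, u 1 t = 0) (hg : UnifSecond T g) : UnifSecond T u := by
  obtain ⟨s₀, hs₀, B, hB, h⟩ := hg
  refine ⟨s₀, hs₀, B, hB, fun ρ hρ t s hs hss ht hts => ?_⟩
  have m0 : t ∈ Icc 0 T := ⟨by linarith, ht⟩
  have m1 : t - s ∈ Icc 0 T := ⟨by linarith, by linarith⟩
  have m2 : t - 2 * s ∈ Icc 0 T := ⟨hts, by linarith⟩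
  exact abs_le_of_hasDeriv_of_one (f := fun x => u x t - 2 * u x (t - s) + u x (t - 2 * s))
      (fun x hx => ((hu t m0 x hx).sub ((hu _ m1 x hx).const_mul 2)).add (hu _ m2 x hx))
      (by rw [h1 _ m0, h1 _ m1, h1 _ m2]; ring)
      (fun x hx => h x hx t s hs hss ht hts) ρ hρ

section

variable {p : Params} {T ε : ℝ} {φL φH φF : ℝ → ℝ} {L H F v : ℝ → ℝ → ℝ} {R : ℝ → ℝ}

lemma IsSolution.admissible_state (h : IsSolution p T ε φL φH φF L H F v R) {ρ t : ℝ}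
    (hρ : ρ ∈ Icc (0 : ℝ) 1) (ht : t ∈ Icc 0 T) : Admissible p (state L H F v R ρ t) :=
  ⟨hρ.1, h.front_mem t ht, h.denL ρ hρ t ht, h.denF ρ hρ t ht, h.denH ρ hρ t ht⟩

lemma IsSolution.admissible_velState (h : IsSolution p T ε φL φH φF L H F v R) {ρ t : ℝ}
    (hρ : ρ ∈ Icc (0 : ℝ) 1) (ht : t ∈ Icc 0 T) : Admissible p (velState L H F R ρ t) :=
  ⟨hρ.1, h.front_mem t ht, h.denL ρ hρ t ht, h.denF ρ hρ t ht, h.denH ρ hρ t ht⟩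

lemma IsSolution.continuousOn_R (h : IsSolution p T ε φL φH φF L H F v R) :
    ContinuousOn R (Icc 0 T) := fun t ht => (h.eqR t ht).continuousWithinAt

lemma continuousOn_time {f : ℝ → ℝ} (h : ContinuousOn f (Icc 0 T)) :
    ContinuousOn (fun q : ℝ × ℝ => f q.2) (Icc 0 1 ×ˢ Icc 0 T) :=
  h.comp continuousOn_snd fun _ hq => hq.2

lemma IsSolution.continuousOn_velState (h : IsSolution p T ε φL φH φF L H F v R) :
    ContinuousOn (fun q : ℝ × ℝ => velState L H F R q.1 q.2) (Icc 0 1 ×ˢ Icc 0 T) :=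
  continuousOn_fin7 continuousOn_fst (continuousOn_time h.continuousOn_R) continuousOn_const
    continuousOn_const (h.smoothL.continuousOn h.bcL) (h.smoothH.continuousOn h.bcH)
    (h.smoothF.continuousOn h.bcF)

lemma IsSolution.continuousOn_velField (h : IsSolution p T ε φL φH φF L H F v R) :
    ContinuousOn (fun q : ℝ × ℝ => velField p (velState L H F R q.1 q.2)) (Icc 0 1 ×ˢ Icc 0 T) :=
  fun q hq => ContinuousAt.comp_continuousWithinAt
    (f := fun q : ℝ × ℝ => velState L H F R q.1 q.2) (x := q)
    (h.admissible_velState hq.1 hq.2).contDiffAt_velField.continuousAt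
    (h.continuousOn_velState q hq)

lemma IsSolution.continuousOn_v (h : IsSolution p T ε φL φH φF L H F v R) :
    ContinuousOn (fun q : ℝ × ℝ => v q.1 q.2) (Icc 0 1 ×ˢ Icc 0 T) :=
  continuousOn_of_hasDeriv (right_mem_Icc.2 zero_le_one) h.eqv h.continuousOn_velField
    ((continuousOn_const (c := (0 : ℝ))).congr fun t ht => h.bcv t ht)

lemma IsSolution.continuousOn_v_zero (h : IsSolution p T ε φL φH φF L H F v R) :
    ContinuousOn (v 0) (Icc 0 T) :=
  h.continuousOn_v.comp (f := fun t : ℝ => ((0 : ℝ), t)) (by fun_prop)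
    fun _ ht => ⟨left_mem_Icc.2 zero_le_one, ht⟩

lemma IsSolution.continuousOn_state (h : IsSolution p T ε φL φH φF L H F v R) :
    ContinuousOn (fun q : ℝ × ℝ => state L H F v R q.1 q.2) (Icc 0 1 ×ˢ Icc 0 T) :=
  continuousOn_fin7 continuousOn_fst (continuousOn_time h.continuousOn_R)
    (continuousOn_time h.continuousOn_v_zero) h.continuousOn_v
    (h.smoothL.continuousOn h.bcL) (h.smoothH.continuousOn h.bcH)
    (h.smoothF.continuousOn h.bcF)

lemma IsSolution.continuousOn_field (h : IsSolution p T ε φL φH φF L H F v R)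
    (hM0 : p.M0 ≠ 0) (i : Fin 6) :
    ContinuousOn (fun q : ℝ × ℝ => field p (state L H F v R q.1 q.2) i)
      (Icc 0 1 ×ˢ Icc 0 T) := fun q hq =>
  ContinuousAt.comp_continuousWithinAt (f := fun q : ℝ × ℝ => state L H F v R q.1 q.2) (x := q)
    ((continuous_apply i).continuousAt.comp
      ((h.admissible_state hq.1 hq.2).contDiffAt_field hM0).continuousAt)
    (h.continuousOn_state q hq)

/-- The set of states of the exact solution. -/
def states (T : ℝ) (L H F v : ℝ → ℝ → ℝ) (R : ℝ → ℝ) : Set (Fin 7 → ℝ) :=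
  (fun q : ℝ × ℝ => state L H F v R q.1 q.2) '' (Icc 0 1 ×ˢ Icc 0 T)

/-- The set of states of the exact solution without velocities. -/
def velStates (T : ℝ) (L H F : ℝ → ℝ → ℝ) (R : ℝ → ℝ) : Set (Fin 7 → ℝ) :=
  (fun q : ℝ × ℝ => velState L H F R q.1 q.2) '' (Icc 0 1 ×ˢ Icc 0 T)

lemma IsSolution.isCompact_states (h : IsSolution p T ε φL φH φF L H F v R) :
    IsCompact (states T L H F v R) :=
  (isCompact_Icc.prod isCompact_Icc).image_of_continuousOn h.continuousOn_state

lemma IsSolution.isCompact_velStates (h : IsSolution p T ε φL φH φF L H F v R) :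
    IsCompact (velStates T L H F R) :=
  (isCompact_Icc.prod isCompact_Icc).image_of_continuousOn h.continuousOn_velState

lemma IsSolution.contDiffAt_field (h : IsSolution p T ε φL φH φF L H F v R) (hM0 : p.M0 ≠ 0) :
    ∀ x ∈ states T L H F v R, ContDiffAt ℝ 2 (field p) x := by
  rintro _ ⟨q, hq, rfl⟩
  exact (h.admissible_state hq.1 hq.2).contDiffAt_field hM0

lemma IsSolution.contDiffAt_velField (h : IsSolution p T ε φL φH φF L H F v R) :
    ∀ x ∈ velStates T L H F R, ContDiffAt ℝ 2 (velField p) x := by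
  rintro _ ⟨q, hq, rfl⟩
  exact (h.admissible_velState hq.1 hq.2).contDiffAt_velField

lemma state_mem {ρ t : ℝ} (hρ : ρ ∈ Icc (0 : ℝ) 1) (ht : t ∈ Icc 0 T) :
    state L H F v R ρ t ∈ states T L H F v R := ⟨(ρ, t), ⟨hρ, ht⟩, rfl⟩

lemma velState_mem {ρ t : ℝ} (hρ : ρ ∈ Icc (0 : ℝ) 1) (ht : t ∈ Icc 0 T) :
    velState L H F R ρ t ∈ velStates T L H F R := ⟨(ρ, t), ⟨hρ, ht⟩, rfl⟩

/-- Start of a bootstrap without circularity: `R` is Lipschitz because `v` is bounded; then `v` is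
Lipschitz, since its derivative depends on `velState` alone; then `R` and `v` have second
differences of order two. This is why the velocities are left out of `velState`. -/
lemma IsSolution.unifLip_R (h : IsSolution p T ε φL φH φF L H F v R) :
    UnifLip T fun _ t => R t := by
  obtain ⟨B, hB0, hB⟩ := exists_bound h.continuousOn_v
  exact ⟨1, one_pos, B, hB0, fun ρ hρ s hs t ht _ =>
    abs_sub_le_of_hasDeriv h.eqR (fun x hx => hB 0 (left_mem_Icc.2 zero_le_one) x hx) ht hs⟩

lemma IsSolution.unifLip_velState (hT : 0 < T) (h : IsSolution p T ε φL φH φF L H F v R) :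
    UnifLip T (velState L H F R) :=
  unifLip_fin7 (unifLip_const fun ρ => ρ) h.unifLip_R (unifLip_const fun _ => 0)
    (unifLip_const fun _ => 0) (h.smoothL.unifLip hT h.bcL) (h.smoothH.unifLip hT h.bcH)
    (h.smoothF.unifLip hT h.bcF)

lemma IsSolution.unifLip_v (hT : 0 < T) (h : IsSolution p T ε φL φH φF L H F v R) :
    UnifLip T v :=
  UnifLip.of_hasDeriv (g := fun ρ t => velField p (velState L H F R ρ t)) h.eqv h.bcv
    ((h.unifLip_velState hT).comp h.isCompact_velStates h.contDiffAt_velField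
      fun _ hρ _ ht => velState_mem hρ ht)

lemma IsSolution.unifSecond_R (hT : 0 < T) (h : IsSolution p T ε φL φH φF L H F v R) :
    UnifSecond T fun _ t => R t := by
  obtain ⟨s₀, hs₀, B, hB, hv⟩ := h.unifLip_v hT
  refine ⟨s₀, hs₀, 2 * B, by positivity, fun ρ hρ t s hs hss ht hts => ?_⟩
  refine second_diff_le h.eqR hs ht hts (fun σ hσ => ?_) hB
  have e : |t - σ - (t - 2 * σ)| = σ := by
    rw [show t - σ - (t - 2 * σ) = σ by ring, abs_of_nonneg hσ.1]
  have := hv 0 (left_mem_Icc.2 zero_le_one) (t - 2 * σ) ⟨by linarith [hσ.2], by linarith [hσ.1]⟩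
    (t - σ) ⟨by linarith [hσ.2], by linarith [hσ.1]⟩ (by rw [e]; exact hσ.2.trans hss)
  rwa [e] at this

lemma IsSolution.unifSecond_velState (hT : 0 < T) (h : IsSolution p T ε φL φH φF L H F v R) :
    UnifSecond T (velState L H F R) :=
  unifSecond_fin7 (unifSecond_const fun ρ => ρ) (h.unifSecond_R hT) (unifSecond_const fun _ => 0)
    (unifSecond_const fun _ => 0) (h.smoothL.unifSecond hT h.bcL)
    (h.smoothH.unifSecond hT h.bcH) (h.smoothF.unifSecond hT h.bcF)

lemma IsSolution.unifSecond_v (hT : 0 < T) (h : IsSolution p T ε φL φH φF L H F v R) :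
    UnifSecond T v :=
  UnifSecond.of_hasDeriv (g := fun ρ t => velField p (velState L H F R ρ t)) h.eqv h.bcv
    ((h.unifSecond_velState hT).comp (h.unifLip_velState hT) h.isCompact_velStates
      h.contDiffAt_velField fun _ hρ _ ht => velState_mem hρ ht)

lemma UnifLip.at_zero {u : ℝ → ℝ → ℝ} (h : UnifLip T u) : UnifLip T fun _ t => u 0 t := by
  obtain ⟨s₀, hs₀, B, hB, hv⟩ := h
  exact ⟨s₀, hs₀, B, hB, fun _ _ => hv 0 (left_mem_Icc.2 zero_le_one)⟩

lemma UnifSecond.at_zero {u : ℝ → ℝ → ℝ} (h : UnifSecond T u) :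
    UnifSecond T fun _ t => u 0 t := by
  obtain ⟨s₀, hs₀, B, hB, hv⟩ := h
  exact ⟨s₀, hs₀, B, hB, fun _ _ => hv 0 (left_mem_Icc.2 zero_le_one)⟩

lemma IsSolution.unifSecond_field (hT : 0 < T) (h : IsSolution p T ε φL φH φF L H F v R)
    (hM0 : p.M0 ≠ 0) : UnifSecond T fun ρ t => field p (state L H F v R ρ t) := by
  refine UnifSecond.comp (x := state L H F v R) ?_ ?_ h.isCompact_states (h.contDiffAt_field hM0)
    fun _ hρ _ ht => state_mem hρ ht
  · exact unifSecond_fin7 (unifSecond_const fun ρ => ρ) (h.unifSecond_R hT)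
      (h.unifSecond_v hT).at_zero (h.unifSecond_v hT) (h.smoothL.unifSecond hT h.bcL)
      (h.smoothH.unifSecond hT h.bcH) (h.smoothF.unifSecond hT h.bcF)
  · exact unifLip_fin7 (unifLip_const fun ρ => ρ) h.unifLip_R
      (h.unifLip_v hT).at_zero (h.unifLip_v hT) (h.smoothL.unifLip hT h.bcL)
      (h.smoothH.unifLip hT h.bcH) (h.smoothF.unifLip hT h.bcF)

lemma IsSolution.bdf_R (hT : 0 < T) (h : IsSolution p T ε φL φH φF L H F v R) :
    ∃ s₀ > 0, ∃ B, 0 ≤ B ∧ ∀ t s, 0 ≤ s → s ≤ s₀ → t ≤ T → 0 ≤ t - 2 * s →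
      |3 * R t - 4 * R (t - s) + R (t - 2 * s) - 2 * s * v 0 t| ≤ B * s ^ 3 := by
  obtain ⟨s₀, hs₀, B, hB, hv⟩ := h.unifSecond_v hT
  refine ⟨s₀, hs₀, 2 * B, by positivity, fun t s hs hss ht hts => ?_⟩
  exact bdf_consistency h.eqR hs ht hts (fun σ hσ => hv 0 (left_mem_Icc.2 zero_le_one) t σ hσ.1
    (hσ.2.trans hss) ht (by linarith [hσ.2])) hB

/-! ### Stability of the nonlinearities -/

/-- Velocities of perturbations of the exact solution. -/
lemma IsSolution.vel_close (h : IsSolution p T ε φL φH φF L H F v R) :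
    ∃ r > 0, ∃ C, 0 ≤ C ∧ ∀ t ∈ Icc 0 T, ∀ (R' : ℝ) (L' H' F' : ℝ → ℝ) (e : ℝ), e ≤ r →
      |R' - R t| ≤ e → (∀ ρ ∈ Icc (0 : ℝ) 1, |L' ρ - L ρ t| ≤ e) →
      (∀ ρ ∈ Icc (0 : ℝ) 1, |H' ρ - H ρ t| ≤ e) → (∀ ρ ∈ Icc (0 : ℝ) 1, |F' ρ - F ρ t| ≤ e) →
      Continuous L' → Continuous H' → Continuous F' →
      ContinuousOn (fun ρ => (1 - R') * fv p ρ R' (L' ρ) (H' ρ) (F' ρ)) (Icc 0 1) ∧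
      ∀ w : ℝ → ℝ, (∀ ρ ∈ Icc (0 : ℝ) 1, HasDerivWithinAt w
        ((1 - R') * fv p ρ R' (L' ρ) (H' ρ) (F' ρ)) (Icc 0 1) ρ) → w 1 = 0 →
        ∀ ρ ∈ Icc (0 : ℝ) 1, |w ρ - v ρ t| ≤ C * e := by
  obtain ⟨r, hr, C, hC, key⟩ := exists_lipschitz_near h.isCompact_velStates h.contDiffAt_velField
  refine ⟨r, hr, C, hC, fun t ht R' L' H' F' e her hR hL hH hF cL cH cF => ?_⟩
  have he : 0 ≤ e := (abs_nonneg _).trans hR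
  have hclose : ∀ ρ ∈ Icc (0 : ℝ) 1,
      ‖![ρ, R', 0, 0, L' ρ, H' ρ, F' ρ] - velState L H F R ρ t‖ ≤ e := fun ρ hρ => by
    rw [pi_norm_le_iff_of_nonneg he]
    intro i
    fin_cases i
    · simpa [velState] using he
    · exact hR
    · simpa [velState] using he
    · simpa [velState] using he
    · exact hL ρ hρ
    · exact hH ρ hρ
    · exact hF ρ hρ
  refine ⟨fun ρ hρ => ?_, fun w hw hw1 ρ hρ => ?_⟩
  · have h1 := (key _ (velState_mem hρ ht) _ ((hclose ρ hρ).trans her)).1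
    exact ContinuousAt.comp_continuousWithinAt (f := fun ρ => ![ρ, R', 0, 0, L' ρ, H' ρ, F' ρ]) h1
      ((continuousOn_fin7 (s := Icc 0 1) continuousOn_id continuousOn_const continuousOn_const
      continuousOn_const cL.continuousOn cH.continuousOn cF.continuousOn) ρ hρ)
  · refine abs_le_of_hasDeriv_of_one (f := fun ρ => w ρ - v ρ t)
      (fun x hx => (hw x hx).sub (h.eqv t ht x hx)) (by rw [hw1, h.bcv t ht, sub_zero])
      (fun x hx => ?_) ρ hρ
    have h1 := (key _ (velState_mem hx ht) _ ((hclose x hx).trans her)).2.1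
    exact h1.trans (mul_le_mul_of_nonneg_left (hclose x hx) hC)

/-- Reaction terms and coefficients of perturbations of the exact solution. -/
lemma IsSolution.field_close (h : IsSolution p T ε φL φH φF L H F v R) (hM0 : p.M0 ≠ 0) :
    ∃ r > 0, ∃ C, 0 ≤ C ∧ ∀ t ∈ Icc 0 T, ∀ (R' v₀ : ℝ) (v' L' H' F' : ℝ → ℝ) (e : ℝ), e ≤ r →
      |R' - R t| ≤ e → |v₀ - v 0 t| ≤ e → (∀ ρ ∈ Icc (0 : ℝ) 1, |v' ρ - v ρ t| ≤ e) →
      (∀ ρ ∈ Icc (0 : ℝ) 1, |L' ρ - L ρ t| ≤ e) → (∀ ρ ∈ Icc (0 : ℝ) 1, |H' ρ - H ρ t| ≤ e) →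
      (∀ ρ ∈ Icc (0 : ℝ) 1, |F' ρ - F ρ t| ≤ e) →
      ContinuousOn v' (Icc 0 1) → ContinuousOn L' (Icc 0 1) → ContinuousOn H' (Icc 0 1) →
      ContinuousOn F' (Icc 0 1) →
      ∀ i, ContinuousOn (fun ρ => field p ![ρ, R', v₀, v' ρ, L' ρ, H' ρ, F' ρ] i) (Icc 0 1) ∧
        ∀ ρ ∈ Icc (0 : ℝ) 1, |field p ![ρ, R', v₀, v' ρ, L' ρ, H' ρ, F' ρ] i
          - field p (state L H F v R ρ t) i| ≤ C * e := by
  obtain ⟨r, hr, C, hC, key⟩ := exists_lipschitz_near h.isCompact_states (h.contDiffAt_field hM0)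
  refine ⟨r, hr, C, hC, fun t ht R' v₀ v' L' H' F' e her hR hv₀ hv hL hH hF cv cL cH cF i => ?_⟩
  have he : 0 ≤ e := (abs_nonneg _).trans hR
  have hclose : ∀ ρ ∈ Icc (0 : ℝ) 1,
      ‖![ρ, R', v₀, v' ρ, L' ρ, H' ρ, F' ρ] - state L H F v R ρ t‖ ≤ e := fun ρ hρ => by
    rw [pi_norm_le_iff_of_nonneg he]
    intro i
    fin_cases i
    · simpa [state] using he
    · exact hR
    · exact hv₀
    · exact hv ρ hρ
    · exact hL ρ hρ
    · exact hH ρ hρ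
    · exact hF ρ hρ
  refine ⟨fun ρ hρ => ?_, fun x hx => ?_⟩
  · have h1 := (key _ (state_mem hρ ht) _ ((hclose ρ hρ).trans her)).1
    exact ContinuousAt.comp_continuousWithinAt
      (f := fun ρ => ![ρ, R', v₀, v' ρ, L' ρ, H' ρ, F' ρ])
      ((continuous_apply i).continuousAt.comp h1)
      ((continuousOn_fin7 (s := Icc 0 1) continuousOn_id continuousOn_const continuousOn_const
      cv cL cH cF) ρ hρ)
  · have h1 := (key _ (state_mem hx ht) _ ((hclose x hx).trans her)).2.1
    have h2 := norm_le_pi_norm (field p ![x, R', v₀, v' x, L' x, H' x, F' x]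
      - field p (state L H F v R x t)) i
    exact h2.trans (h1.trans (mul_le_mul_of_nonneg_left (hclose x hx) hC))

/-- The differential equations hold up to the final time. -/
lemma eq_of_eq_Ioo {f g : ℝ → ℝ} (hT : 0 < T) (hf : ContinuousOn f (Icc 0 T))
    (hg : ContinuousOn g (Icc 0 T)) (h : ∀ t ∈ Ioo 0 T, f t = g t) :
    ∀ t ∈ Icc 0 T, f t = g t := by
  have := Set.EqOn.of_subset_closure (s := Ioo 0 T) (t := Icc 0 T) h hf hg Ioo_subset_Icc_self
    (by rw [closure_Ioo hT.ne])
  exact this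

/-- The equations are assumed for `0 < t < T` only, but the last step of the scheme is implicit at
`t = T`; continuity in time closes the gap. -/
lemma IsSolution.equations (hT : 0 < T) (h : IsSolution p T ε φL φH φF L H F v R)
    (hM0 : p.M0 ≠ 0) {ρ t : ℝ} (hρ : ρ ∈ Ioo (0 : ℝ) 1) (ht : t ∈ Icc 0 T) :
    dt T L ρ t - field p (state L H F v R ρ t) 5 * dρρ L ρ t
      + field p (state L H F v R ρ t) 3 * dρ L ρ t = field p (state L H F v R ρ t) 0 ∧
    dt T H ρ t - field p (state L H F v R ρ t) 5 * dρρ H ρ t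
      + field p (state L H F v R ρ t) 3 * dρ H ρ t = field p (state L H F v R ρ t) 1 ∧
    dt T F ρ t - p.D * field p (state L H F v R ρ t) 5 * dρρ F ρ t
      + field p (state L H F v R ρ t) 4 * dρ F ρ t = field p (state L H F v R ρ t) 2 := by
  have hρ' := Ioo_subset_Icc_self hρ
  have slice : ∀ {g : ℝ × ℝ → ℝ}, ContinuousOn g (Icc 0 1 ×ˢ Icc 0 T) →
      ContinuousOn (fun t => g (ρ, t)) (Icc 0 T) := fun hg =>
    hg.comp (f := fun t : ℝ => (ρ, t)) (by fun_prop) fun _ hs => ⟨hρ', hs⟩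
  have hfield := fun i => slice (h.continuousOn_field hM0 i)
  have gen : ∀ {u : ℝ → ℝ → ℝ}, Smooth T u → (∀ t ∈ Icc 0 T, dρ u 0 t = 0 ∧ dρ u 1 t = 0) →
      ∀ (c : ℝ) (i : Fin 6), ContinuousOn (fun t => dt T u ρ t
        - c * field p (state L H F v R ρ t) 5 * dρρ u ρ t
        + field p (state L H F v R ρ t) i * dρ u ρ t) (Icc 0 T) := by
    intro u hu hbc c i
    obtain ⟨B, -, hB⟩ := hu.time_regularity hT hbc
    exact ((hB ρ hρ').2.1.fun_sub (((hfield 5).const_mul c).fun_mul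
      (slice hu.continuousOn_second))).fun_add ((hfield i).fun_mul (slice (hu.continuousOn_grad hbc)))
  refine ⟨?_, ?_, ?_⟩
  · have := eq_of_eq_Ioo hT (gen h.smoothL h.bcL 1 3) (hfield 0) (fun s hs => by
      rw [one_mul]; exact h.eqL ρ hρ s hs) t ht
    rwa [one_mul] at this
  · have := eq_of_eq_Ioo hT (gen h.smoothH h.bcH 1 3) (hfield 1) (fun s hs => by
      rw [one_mul]; exact h.eqH ρ hρ s hs) t ht
    rwa [one_mul] at this
  · refine eq_of_eq_Ioo hT (gen h.smoothF h.bcF p.D 4) (hfield 2) (fun s hs => ?_) t ht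
    have := h.eqF ρ hρ s hs
    rw [div_eq_mul_one_div p.D] at this
    exact this

end

section

variable {p : Params} {T ε : ℝ} {φL φH φF : ℝ → ℝ} {L H F v : ℝ → ℝ → ℝ} {R : ℝ → ℝ}

/-! ### Stability and consistency of one step -/

/-- The level `A` is uniformly within `e` of the exact solution at time `t`. -/
structure IsClose (L H F : ℝ → ℝ → ℝ) (R : ℝ → ℝ) (e : ℝ) (A : Level) (t : ℝ) : Prop where
  R : |A.R - R t| ≤ e
  L : ∀ ρ ∈ Icc (0 : ℝ) 1, |A.L.eval ρ - L ρ t| ≤ e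
  H : ∀ ρ ∈ Icc (0 : ℝ) 1, |A.H.eval ρ - H ρ t| ≤ e
  F : ∀ ρ ∈ Icc (0 : ℝ) 1, |A.F.eval ρ - F ρ t| ≤ e

/-- `w` is the velocity that belongs to the level `A`. -/
def IsVelocity (p : Params) (A : Level) (w : ℝ → ℝ) : Prop :=
  (∀ ρ ∈ Icc (0 : ℝ) 1, HasDerivWithinAt w
    ((1 - A.R) * fv p ρ A.R (A.L.eval ρ) (A.H.eval ρ) (A.F.eval ρ)) (Icc 0 1) ρ) ∧ w 1 = 0

/-- The state of a level. -/
def levelState (A : Level) (w : ℝ → ℝ) (ρ : ℝ) : Fin 7 → ℝ :=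
  ![ρ, A.R, w 0, w ρ, A.L.eval ρ, A.H.eval ρ, A.F.eval ρ]

/-- The state at the new level which determines the coefficients of the implicit step. -/
def newState (L H F : ℝ → ℝ → ℝ) (t R₂ : ℝ) (w₀ w₁ : ℝ → ℝ) (ρ : ℝ) : Fin 7 → ℝ :=
  ![ρ, R₂, 2 * w₁ 0 - w₀ 0, 2 * w₁ ρ - w₀ ρ, L ρ t, H ρ t, F ρ t]

lemma exists_antiderivative {g : ℝ → ℝ} (hg : ContinuousOn g (Icc 0 1)) :
    ∃ w : ℝ → ℝ, (∀ ρ ∈ Icc (0 : ℝ) 1, HasDerivWithinAt w (g ρ) (Icc 0 1) ρ) ∧ w 1 = 0 := by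
  have hc : Continuous (IccExtend (zero_le_one' ℝ) (domRestrict (Icc 0 1) g)) :=
    (continuousOn_iff_continuous_domRestrict.1 hg).Icc_extend'
  refine ⟨fun ρ => ∫ x in (1 : ℝ)..ρ, IccExtend (zero_le_one' ℝ) (domRestrict (Icc 0 1) g) x,
    fun ρ hρ => ?_, intervalIntegral.integral_same⟩
  have h1 := (hc.integral_hasStrictDerivAt 1 ρ).hasDerivAt
  rw [IccExtend_of_mem _ _ hρ] at h1
  exact h1.hasDerivWithinAt

lemma IsSolution.exists_velocity (h : IsSolution p T ε φL φH φF L H F v R) :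
    ∃ r > 0, ∀ t ∈ Icc 0 T, ∀ A, IsClose L H F R r A t → ∃ w, IsVelocity p A w := by
  obtain ⟨r, hr, C, hC, key⟩ := h.vel_close
  exact ⟨r, hr, fun t ht A hA => exists_antiderivative (key t ht A.R _ _ _ r le_rfl hA.R hA.L hA.H hA.F
    A.L.continuous A.H.continuous A.F.continuous).1⟩

-- Collects everything about the new level that is fixed before the linear systems are solved: the
-- front, the coefficients and the extrapolated right-hand sides. Stability contributes `e`,
-- consistency contributes `s²`.
set_option maxHeartbeats 1000000 in
lemma IsSolution.pre_step (hT : 0 < T) (h : IsSolution p T ε φL φH φF L H F v R)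
    (hM0 : p.M0 ≠ 0) :
    ∃ C, 0 ≤ C ∧ ∃ r > 0, ∀ t s e A₀ A₁ w₀ w₁ R₂, 0 ≤ s → s ≤ r → t ≤ T → 0 ≤ t - 2 * s → e ≤ r →
      IsClose L H F R e A₀ (t - 2 * s) → IsClose L H F R e A₁ (t - s) →
      IsVelocity p A₀ w₀ → IsVelocity p A₁ w₁ →
      R₂ = A₁.R - (A₀.R - A₁.R) / 3 + 2 * s / 3 * (2 * w₁ 0 - w₀ 0) →
      |3 * (R₂ - R t) - 4 * (A₁.R - R (t - s)) + (A₀.R - R (t - 2 * s))| ≤ C * s * (e + s ^ 2) ∧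
      (∀ i, ContinuousOn (fun ρ => field p (newState L H F t R₂ w₀ w₁ ρ) i) (Icc 0 1) ∧
        ∀ ρ ∈ Icc (0 : ℝ) 1, |field p (newState L H F t R₂ w₀ w₁ ρ) i
          - field p (state L H F v R ρ t) i| ≤ C * (e + s ^ 2)) ∧
      1 / 2 ≤ 1 / (1 - R₂) ^ 2 ∧
      ∀ i, ∀ ρ ∈ Icc (0 : ℝ) 1, |2 * field p (levelState A₁ w₁ ρ) i
        - field p (levelState A₀ w₀ ρ) i - field p (state L H F v R ρ t) i| ≤ C * (e + s ^ 2) := by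
  obtain ⟨rv, hrv, Cv, hCv, hvel⟩ := h.vel_close
  obtain ⟨rf, hrf, Cf, hCf, hfield⟩ := h.field_close hM0
  obtain ⟨s₁, hs₁, B₁, hB₁, hR⟩ := h.bdf_R hT
  obtain ⟨s₂, hs₂, B₂, hB₂, hv⟩ := h.unifSecond_v hT
  obtain ⟨s₃, hs₃, B₃, hB₃, hf⟩ := h.unifSecond_field hT hM0
  obtain ⟨C₁, hC₁⟩ : ∃ C₁, C₁ = 3 + 6 * Cv + 2 * B₂ + B₁ := ⟨_, rfl⟩
  have hC₁0 : 0 ≤ C₁ := by rw [hC₁]; positivity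
  obtain ⟨C₂, hC₂⟩ : ∃ C₂, C₂ = 3 * Cf * (1 + Cv) + B₃ := ⟨_, rfl⟩
  have hC₂0 : 0 ≤ C₂ := by rw [hC₂]; positivity
  -- `r2` and `r7` keep the old and the new states in the neighbourhood of `field_close`; `r8` makes
  -- the error of the diffusion coefficient at most `1 / 2`.
  obtain ⟨r, hr, r1, r2, r3, r4, r5, r6, r7, r8⟩ : ∃ r > 0, r ≤ rv ∧ r ≤ rf / (1 + Cv) ∧ r ≤ s₁ ∧
      r ≤ s₂ ∧ r ≤ s₃ ∧ r ≤ 1 ∧ r ≤ rf / (2 * C₁ + 1) ∧ r ≤ 1 / (4 * Cf * C₁ + 1) := by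
    refine ⟨min rv (min (rf / (1 + Cv)) (min s₁ (min s₂ (min s₃ (min 1 (min (rf / (2 * C₁ + 1))
      (1 / (4 * Cf * C₁ + 1)))))))), by positivity, ?_⟩
    simp only [min_le_iff, le_refl, true_or, or_true, and_self]
  refine ⟨3 * C₁ + Cf * C₁ + C₂, by positivity, r, by positivity, ?_⟩
  intro t s e A₀ A₁ w₀ w₁ R₂ hs hsr ht hts her hA₀ hA₁ hw₀ hw₁ hR₂
  have he : 0 ≤ e := (abs_nonneg _).trans hA₀.R
  have m0 : t ∈ Icc 0 T := ⟨by linarith, ht⟩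
  have m1 : t - s ∈ Icc 0 T := ⟨by linarith, by linarith⟩
  have m2 : t - 2 * s ∈ Icc 0 T := ⟨hts, by linarith⟩
  have z0 : (0 : ℝ) ∈ Icc (0 : ℝ) 1 := left_mem_Icc.2 zero_le_one
  have hs1 : s ≤ 1 := hsr.trans r6
  have hes : e + s ^ 2 ≤ 2 * r := by nlinarith
  have hes0 : 0 ≤ e + s ^ 2 := by positivity
  -- velocities
  have v0 := (hvel _ m2 A₀.R _ _ _ e (her.trans r1) hA₀.R hA₀.L hA₀.H hA₀.F
    A₀.L.continuous A₀.H.continuous A₀.F.continuous).2 w₀ hw₀.1 hw₀.2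
  have v1 := (hvel _ m1 A₁.R _ _ _ e (her.trans r1) hA₁.R hA₁.L hA₁.H hA₁.F
    A₁.L.continuous A₁.H.continuous A₁.F.continuous).2 w₁ hw₁.1 hw₁.2
  have v2 : ∀ ρ ∈ Icc (0 : ℝ) 1, |2 * w₁ ρ - w₀ ρ - v ρ t| ≤ 3 * Cv * e + B₂ * s ^ 2 := by
    intro ρ hρ
    have e1 := abs_le.1 (v0 ρ hρ)
    have e2 := abs_le.1 (v1 ρ hρ)
    have e3 := hv ρ hρ t s hs (hsr.trans r4) ht hts
    rw [smul_eq_mul, Real.norm_eq_abs] at e3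
    have e4 := abs_le.1 e3
    rw [abs_le]
    constructor <;> linarith [e1.1, e1.2, e2.1, e2.2, e4.1, e4.2]
  have v2' : 3 * Cv * e + B₂ * s ^ 2 ≤ C₁ * (e + s ^ 2) := by
    have h1 : 0 ≤ (3 + 3 * Cv + 2 * B₂ + B₁) * e := by positivity
    have h2 : 0 ≤ (3 + 6 * Cv + B₂ + B₁) * s ^ 2 := by positivity
    rw [hC₁]; linarith
  -- the front
  have hRstep : |3 * (R₂ - R t) - 4 * (A₁.R - R (t - s)) + (A₀.R - R (t - 2 * s))|
      ≤ C₁ * s * (e + s ^ 2) := by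
    have e1 := hR t s hs (hsr.trans r3) ht hts
    have e2 : |2 * s * (2 * w₁ 0 - w₀ 0 - v 0 t)| ≤ 2 * s * (3 * Cv * e + B₂ * s ^ 2) := by
      rw [abs_mul, abs_of_nonneg (by positivity : 0 ≤ 2 * s)]
      exact mul_le_mul_of_nonneg_left (v2 0 z0) (by positivity)
    have e3 : 3 * (R₂ - R t) - 4 * (A₁.R - R (t - s)) + (A₀.R - R (t - 2 * s))
        = 2 * s * (2 * w₁ 0 - w₀ 0 - v 0 t)
          - (3 * R t - 4 * R (t - s) + R (t - 2 * s) - 2 * s * v 0 t) := by rw [hR₂]; ring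
    rw [e3]
    refine (abs_sub _ _).trans ((add_le_add e2 e1).trans ?_)
    have h1 : 0 ≤ (3 + 2 * B₂ + B₁) * (s * e) := by positivity
    have h2 : 0 ≤ (3 + 6 * Cv) * s ^ 3 := by positivity
    rw [hC₁]; linarith
  -- Solving the recursion for the new front error costs `5 e` from the two old ones, which is
  -- affordable because `C₁ ≥ 3`.
  have hR2 : |R₂ - R t| ≤ C₁ * (e + s ^ 2) := by
    have e1 := abs_le.1 hRstep
    have e2 := abs_le.1 hA₀.R
    have e3 := abs_le.1 hA₁.R
    have e4 : C₁ * s * (e + s ^ 2) ≤ C₁ * (e + s ^ 2) := by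
      rw [mul_assoc]
      exact mul_le_mul_of_nonneg_left (mul_le_of_le_one_left hes0 hs1) hC₁0
    have e5 : 5 * e ≤ 2 * (C₁ * (e + s ^ 2)) := by
      have h1 : 0 ≤ (6 * Cv + 2 * B₂ + B₁) * (e + s ^ 2) := by positivity
      rw [hC₁]; linarith [sq_nonneg s]
    rw [abs_le]
    constructor <;> linarith [e1.1, e1.2, e2.1, e2.2, e3.1, e3.2]
  have hC1r : C₁ * (e + s ^ 2) ≤ rf := by
    rw [le_div_iff₀ (by positivity)] at r7
    nlinarith
  -- The coefficients of the implicit step do not involve `L`, `H`, `F`, so the exact values can be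
  -- inserted in these slots.
  have hnew := hfield t m0 R₂ (2 * w₁ 0 - w₀ 0) (fun ρ => 2 * w₁ ρ - w₀ ρ) (fun ρ => L ρ t)
    (fun ρ => H ρ t) (fun ρ => F ρ t) (C₁ * (e + s ^ 2)) hC1r hR2 ((v2 0 z0).trans v2')
    (fun ρ hρ => (v2 ρ hρ).trans v2')
    (fun ρ _ => by simp only [sub_self, abs_zero]; positivity)
    (fun ρ _ => by simp only [sub_self, abs_zero]; positivity)
    (fun ρ _ => by simp only [sub_self, abs_zero]; positivity)
    (ContinuousOn.fun_sub (ContinuousOn.const_mul (fun ρ hρ => (hw₁.1 ρ hρ).continuousWithinAt) 2)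
      fun ρ hρ => (hw₀.1 ρ hρ).continuousWithinAt)
    (fun ρ hρ => (h.smoothL.hasDeriv_space m0 hρ).continuousWithinAt)
    (fun ρ hρ => (h.smoothH.hasDeriv_space m0 hρ).continuousWithinAt)
    (fun ρ hρ => (h.smoothF.hasDeriv_space m0 hρ).continuousWithinAt)
  have hlevel : ∀ (τ : ℝ) (A : Level) (w : ℝ → ℝ), τ ∈ Icc 0 T → IsClose L H F R e A τ →
      IsVelocity p A w → (∀ ρ ∈ Icc (0 : ℝ) 1, |w ρ - v ρ τ| ≤ Cv * e) →
      ∀ i, ∀ ρ ∈ Icc (0 : ℝ) 1, |field p (levelState A w ρ) i - field p (state L H F v R ρ τ) i|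
        ≤ Cf * ((1 + Cv) * e) := by
    intro τ A w hτ hA hw hwv i
    have g1 : e ≤ (1 + Cv) * e := by nlinarith [mul_nonneg hCv he]
    have g2 : Cv * e ≤ (1 + Cv) * e := by nlinarith
    have g3 : (1 + Cv) * e ≤ rf := by
      have := her.trans r2
      rw [le_div_iff₀ (by positivity)] at this
      linarith
    exact (hfield τ hτ A.R (w 0) w _ _ _ ((1 + Cv) * e) g3 (hA.R.trans g1)
      ((hwv 0 z0).trans g2) (fun ρ hρ => (hwv ρ hρ).trans g2) (fun ρ hρ => (hA.L ρ hρ).trans g1)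
      (fun ρ hρ => (hA.H ρ hρ).trans g1) (fun ρ hρ => (hA.F ρ hρ).trans g1)
      (fun ρ hρ => (hw.1 ρ hρ).continuousWithinAt) A.L.continuous.continuousOn
      A.H.continuous.continuousOn A.F.continuous.continuousOn i).2
  refine ⟨hRstep.trans ?_, fun i => ⟨(hnew i).1, fun ρ hρ => ((hnew i).2 ρ hρ).trans ?_⟩, ?_, ?_⟩
  · gcongr
    have : 0 ≤ Cf * C₁ := by positivity
    linarith
  · rw [← mul_assoc]
    gcongr
    linarith
  -- Entry `5` is the diffusion coefficient, at least `1` for the exact front since `0 < R < 1`, and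
  -- perturbed by at most `1 / 2`.
  · have e1 := (hnew 5).2 0 z0
    have e2 : Cf * (C₁ * (e + s ^ 2)) ≤ 1 / 2 := by
      rw [le_div_iff₀ (by positivity)] at r8
      have h3 : 0 ≤ Cf * C₁ := by positivity
      nlinarith [mul_le_mul_of_nonneg_left hes h3]
    have e3 : (1 : ℝ) ≤ 1 / (1 - R t) ^ 2 := by
      have hf := h.front_mem t m0
      have h1 : 0 < 1 - R t := by linarith [hf.2]
      rw [le_div_iff₀ (by positivity)]
      nlinarith [hf.1, hf.2]
    have e4 := abs_le.1 (e1.trans e2)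
    change -(1 / 2) ≤ 1 / (1 - R₂) ^ 2 - 1 / (1 - R t) ^ 2 ∧ _ at e4
    linarith [e4.1]
  · intro i ρ hρ
    have e1 := abs_le.1 (hlevel _ A₀ w₀ m2 hA₀ hw₀ v0 i ρ hρ)
    have e2 := abs_le.1 (hlevel _ A₁ w₁ m1 hA₁ hw₁ v1 i ρ hρ)
    -- For the exact solution the extrapolation error is, up to sign, a second difference in time.
    have e3 := (norm_le_pi_norm _ i).trans (hf ρ hρ t s hs (hsr.trans r5) ht hts)
    simp only [Pi.add_apply, Pi.sub_apply, Pi.smul_apply, smul_eq_mul, Real.norm_eq_abs] at e3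
    have e4 := abs_le.1 e3
    have e5 : 3 * (Cf * ((1 + Cv) * e)) + B₃ * s ^ 2 ≤ C₂ * (e + s ^ 2) := by
      have h1 : 0 ≤ B₃ * e := by positivity
      have h2 : 0 ≤ 3 * Cf * (1 + Cv) * s ^ 2 := by positivity
      rw [hC₂]; linarith
    have e6 : 0 ≤ (3 * C₁ + Cf * C₁) * (e + s ^ 2) := by positivity
    rw [abs_le]
    constructor <;> linarith [e1.1, e1.2, e2.1, e2.2, e4.1, e4.2]

end

section

variable {p : Params} {T ε : ℝ} {φL φH φF : ℝ → ℝ} {L H F v : ℝ → ℝ → ℝ} {R : ℝ → ℝ}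

/-! ### Energy estimate for single unknowns and for whole levels -/

lemma mul_sub_mul_le {a b x y c B δ : ℝ} (hab : |a - b| ≤ c) (hb : |b| ≤ B) (hx : |x| ≤ B)
    (hxy : |x - y| ≤ δ) : |a * x - b * y| ≤ c * B + B * δ := by
  have e : a * x - b * y = (a - b) * x + b * (x - y) := by ring
  rw [e]
  refine (abs_add_le _ _).trans ?_
  rw [abs_mul, abs_mul]
  have hB : 0 ≤ B := (abs_nonneg _).trans hb
  have hc : 0 ≤ c := (abs_nonneg _).trans hab
  gcongr

/-- The energy estimate for one unknown of the scheme. -/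
lemma Smooth.component_energy (hT : 0 < T) {u : ℝ → ℝ → ℝ} (hu : Smooth T u)
    (hbc : ∀ t ∈ Icc 0 T, dρ u 0 t = 0 ∧ dρ u 1 t = 0) {d₀ Γ : ℝ} (hd₀ : 0 < d₀) (hΓ0 : 0 ≤ Γ) :
    ∃ C, 0 ≤ C ∧ ∀ N ω U, 2 ≤ N → 0 ≤ ω → ω ≤ 1 → IsApprox T N ω u U →
      ∀ (t s d dx e : ℝ) (G Gx f f₀ f₁ : ℝ → ℝ) (u₀ u₁ u₂ b : ℝ[X]), 0 < s → t ≤ T → 0 ≤ t - 2 * s →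
      d₀ ≤ d → |dx| ≤ Γ → |d - dx| ≤ e → ContinuousOn G (Icc 0 1) →
      (∀ ρ ∈ Icc (0 : ℝ) 1, |G ρ| ≤ Γ) → (∀ ρ ∈ Icc (0 : ℝ) 1, |Gx ρ| ≤ Γ) →
      (∀ ρ ∈ Icc (0 : ℝ) 1, |G ρ - Gx ρ| ≤ e) → b ∈ degreeLE ℝ N →
      (∀ ρ ∈ Icc (0 : ℝ) 1, |b.eval ρ - f ρ| ≤ ω) →
      (∀ ρ ∈ Icc (0 : ℝ) 1, |2 * f₁ ρ - f₀ ρ - f ρ| ≤ e) →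
      (∀ ρ ∈ Ioo (0 : ℝ) 1, dt T u ρ t - dx * dρρ u ρ t + Gx ρ * dρ u ρ t = f ρ) →
      CollocStep N (2 * s / 3) d G u₀ u₁ f₀ f₁ u₂ →
      energy (u₂ - U t) (u₁ - U (t - s)) ≤ energy (u₁ - U (t - s)) (u₀ - U (t - 2 * s))
        + C * s * (energy (u₂ - U t) (u₁ - U (t - s)) + (e + s ^ 2 + ω) ^ 2) := by
  obtain ⟨B, hB0, hB⟩ := hu.time_regularity hT hbc
  obtain ⟨B₁, hB₁0, hB₁⟩ := exists_bound (hu.continuousOn_grad hbc)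
  obtain ⟨B₂, hB₂0, hB₂⟩ := exists_bound hu.continuousOn_second
  obtain ⟨Λ, hΛ⟩ : ∃ Λ, Λ = B₁ + B₂ + 1 + Γ := ⟨_, rfl⟩
  have hΛ0 : 0 ≤ Λ := by rw [hΛ]; positivity
  obtain ⟨c, hc⟩ : ∃ c, c = Λ + B + 2 := ⟨_, rfl⟩
  have hc0 : 0 ≤ c := by rw [hc]; positivity
  refine ⟨((3 / (2 * d₀) + 3) * (2 * Γ ^ 2 + 2) + 3) * (1 + 40 * c ^ 2), by positivity, ?_⟩
  intro N ω U hN hω0 hω1 hU t s d dx e G Gx f f₀ f₁ u₀ u₁ u₂ b hs ht hts hd hdx hdd hGc hGΓ hGxΓ hGG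
    hb hbf hf hpde hstep
  have m0 : t ∈ Icc 0 T := ⟨by linarith, ht⟩
  have m1 : t - s ∈ Icc 0 T := ⟨by linarith, by linarith⟩
  have m2 : t - 2 * s ∈ Icc 0 T := ⟨hts, by linarith⟩
  have he : 0 ≤ e := (abs_nonneg _).trans hdd
  have hΛΓ : Γ ≤ Λ := by rw [hΛ]; linarith
  have hce : e ≤ c * (e + s ^ 2 + ω) := by
    have h1 : 0 ≤ (c - 1) * e := mul_nonneg (by rw [hc]; linarith) he
    have h2 : 0 ≤ c * (s ^ 2 + ω) := by positivity
    linarith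
  have hcω : ω ≤ c * (e + s ^ 2 + ω) := by
    have h1 : 0 ≤ (c - 1) * ω := mul_nonneg (by rw [hc]; linarith) hω0
    have h2 : 0 ≤ c * (s ^ 2 + e) := by positivity
    linarith
  have hcΛ : e * Λ + Λ * ω ≤ c * (e + s ^ 2 + ω) := by
    have h1 : 0 ≤ (B + 2) * (e + s ^ 2 + ω) := by positivity
    have h2 : 0 ≤ Λ * s ^ 2 := by positivity
    rw [hc]; linarith
  have key := component_step hN (hs := 2 * s / 3) (by positivity) hd₀ hd hGc hGΓ
    (U₀ := U (t - 2 * s)) (U₁ := U (t - s)) (ε := c * (e + s ^ 2 + ω)) (ut := fun ρ => dt T u ρ t)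
    (u' := fun ρ => dρ u ρ t) (u'' := fun ρ => dρρ u ρ t) (hU.trial t m0) hstep hb hpde
    (fun ρ hρ => (hbf ρ hρ).trans hcω) (fun ρ hρ => (hf ρ hρ).trans hce) ?_ ?_ ?_
  · refine key.trans (add_le_add_right ?_ _)
    have hE := energy_nonneg (u₂ - U t) (u₁ - U (t - s))
    set E := energy (u₂ - U t) (u₁ - U (t - s))
    have h1 : 2 * s / 3 * (E + 40 * (c * (e + s ^ 2 + ω)) ^ 2)
        ≤ s * ((1 + 40 * c ^ 2) * (E + (e + s ^ 2 + ω) ^ 2)) := by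
      refine mul_le_mul (by linarith) ?_ (by positivity) hs.le
      have h2 : 0 ≤ 40 * c ^ 2 * E := by positivity
      have h3 := sq_nonneg (e + s ^ 2 + ω)
      nlinarith
    have h4 : 0 ≤ (3 / (2 * d₀) + 3) * (2 * Γ ^ 2 + 2) + 3 := by positivity
    have h5 := mul_le_mul_of_nonneg_left h1 h4
    linarith
  · intro ρ hρ
    have hρ' := Ioo_subset_Icc_self hρ
    -- With `δ = U - u`, the extra contribution is `3 δ(t) - 4 δ(t-s) + δ(t-2s) = 3 (δ(t) - δ(t-s))
    -- - (δ(t-s) - δ(t-2s))`, at most `4 ω s`. A mere bound on `δ` would lose the factor `s`.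
    have e1 := abs_le.1 ((hB ρ hρ').2.2 t s hs.le ht hts).2
    have e2 := hU.time t m0 (t - s) m1 ρ hρ'
    have e3 := hU.time (t - s) m1 (t - 2 * s) m2 ρ hρ'
    rw [sub_sub_cancel, abs_of_pos hs] at e2
    rw [show t - s - (t - 2 * s) = s by ring, abs_of_pos hs] at e3
    have e4 := abs_le.1 e2
    have e5 := abs_le.1 e3
    have e6 : (B * s ^ 3 + 4 * (ω * s)) / 3 ≤ 2 * s / 3 * (c * (e + s ^ 2 + ω)) := by
      have h1 : 0 ≤ (Λ + 2) * (s * s ^ 2) := by positivity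
      have h2 : 0 ≤ (Λ + B) * (s * ω) := by positivity
      have h3 : 0 ≤ c * (s * e) := by positivity
      have h4 : 0 ≤ B * s ^ 3 := by positivity
      have h5 : 2 * s / 3 * (c * (e + s ^ 2 + ω)) = 2 / 3 * (c * (s * e))
        + 2 / 3 * ((Λ + B + 2) * (s * s ^ 2)) + 2 / 3 * ((Λ + B + 2) * (s * ω)) := by
        rw [← hc]; ring
      rw [h5]
      linarith
    rw [abs_le]
    constructor <;> linarith [e1.1, e1.2, e4.1, e4.2, e5.1, e5.2]
  · intro ρ hρ
    have hρ' := Ioo_subset_Icc_self hρ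
    have e1 := (hU.close t m0 ρ hρ').2.2
    refine (mul_sub_mul_le hdd (hdx.trans hΛΓ) ?_ e1).trans hcΛ
    have e2 := abs_sub_abs_le_abs_sub ((derivative (derivative (U t))).eval ρ) (dρρ u ρ t)
    rw [hΛ]
    linarith [hB₂ ρ hρ' t m0]
  · intro ρ hρ
    have hρ' := Ioo_subset_Icc_self hρ
    have e1 := (hU.close t m0 ρ hρ').2.1
    refine (mul_sub_mul_le (hGG ρ hρ') ((hGxΓ ρ hρ').trans hΛΓ) ?_ e1).trans hcΛ
    have e2 := abs_sub_abs_le_abs_sub ((derivative (U t)).eval ρ) (dρ u ρ t)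
    rw [hΛ]
    linarith [hB₁ ρ hρ' t m0]

/-- The energy of the errors of two consecutive levels `A`, `B` at times `t` and `s`. -/
def totalEnergy (UL UH UF : ℝ → ℝ[X]) (R : ℝ → ℝ) (A B : Level) (t s : ℝ) : ℝ :=
  energy (A.L - UL t) (B.L - UL s) + energy (A.H - UH t) (B.H - UH s)
    + energy (A.F - UF t) (B.F - UF s)
    + ((A.R - R t) ^ 2 + (2 * (A.R - R t) - (B.R - R s)) ^ 2)

lemma totalEnergy_nonneg (UL UH UF : ℝ → ℝ[X]) (R : ℝ → ℝ) (A B : Level) (t s : ℝ) :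
    0 ≤ totalEnergy UL UH UF R A B t s := by
  have h1 := energy_nonneg (A.L - UL t) (B.L - UL s)
  have h2 := energy_nonneg (A.H - UH t) (B.H - UH s)
  have h3 := energy_nonneg (A.F - UF t) (B.F - UF s)
  unfold totalEnergy
  positivity

/-- The energy controls `a` and `2 a - b` uniformly by `2 η`, and `b = 2 a - (2 a - b)`. -/
lemma abs_eval_le_of_energy {a b : ℝ[X]} {η : ℝ} (hη : 0 ≤ η) (h : energy a b ≤ η ^ 2) :
    ∀ ρ ∈ Icc (0 : ℝ) 1, |a.eval ρ| ≤ 6 * η ∧ |b.eval ρ| ≤ 6 * η := by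
  have h1 := intg_sq_nonneg (derivative a)
  have h2 := intg_sq_nonneg (2 * derivative a - derivative b)
  have h3 := sq_nonneg (intg a)
  have h4 := sq_nonneg (2 * intg a - intg b)
  unfold energy at h
  have ha := abs_eval_le_of_intg (e := a) hη (by linarith)
    (abs_le_of_sq_le_sq (by linarith) hη)
  have e1 : derivative (2 * a - b) = 2 * derivative a - derivative b := by simp
  have e2 : intg (2 * a - b) = 2 * intg a - intg b := by
    have h4 : (2 * a : ℝ[X]) = (2 : ℝ) • a := by rw [smul_eq_C_mul, map_ofNat]
    rw [h4, map_sub, map_smul, smul_eq_mul]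
  have hab := abs_eval_le_of_intg (e := 2 * a - b) hη (by rw [e1]; linarith)
    (abs_le_of_sq_le_sq (by rw [e2]; linarith) hη)
  intro ρ hρ
  have k1 := abs_le.1 (ha ρ hρ)
  have k2 := hab ρ hρ
  rw [eval_sub, eval_mul, eval_ofNat] at k2
  have k3 := abs_le.1 k2
  refine ⟨(ha ρ hρ).trans (by linarith), ?_⟩
  rw [abs_le]
  constructor <;> linarith [k1.1, k1.2, k3.1, k3.2]

lemma isClose_of_totalEnergy {N : ℕ} {ω η t s : ℝ} {UL UH UF : ℝ → ℝ[X]} {A B : Level}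
    (hUL : IsApprox T N ω L UL) (hUH : IsApprox T N ω H UH) (hUF : IsApprox T N ω F UF)
    (hω : 0 ≤ ω) (hη : 0 ≤ η) (ht : t ∈ Icc 0 T) (hs : s ∈ Icc 0 T)
    (h : totalEnergy UL UH UF R A B t s ≤ η ^ 2) :
    IsClose L H F R (6 * η + ω) A t ∧ IsClose L H F R (6 * η + ω) B s := by
  have h1 := energy_nonneg (A.L - UL t) (B.L - UL s)
  have h2 := energy_nonneg (A.H - UH t) (B.H - UH s)
  have h3 := energy_nonneg (A.F - UF t) (B.F - UF s)
  have h4 := sq_nonneg (A.R - R t)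
  have h5 := sq_nonneg (2 * (A.R - R t) - (B.R - R s))
  unfold totalEnergy at h
  have kL := abs_eval_le_of_energy (a := A.L - UL t) (b := B.L - UL s) hη (by linarith)
  have kH := abs_eval_le_of_energy (a := A.H - UH t) (b := B.H - UH s) hη (by linarith)
  have kF := abs_eval_le_of_energy (a := A.F - UF t) (b := B.F - UF s) hη (by linarith)
  have r1 := abs_le_of_sq_le_sq' (a := A.R - R t) (b := η) (by linarith) hη
  have r2 := abs_le_of_sq_le_sq' (a := 2 * (A.R - R t) - (B.R - R s)) (b := η) (by linarith) hη
  have comb : ∀ {a U : ℝ[X]} {u : ℝ → ℝ → ℝ} {τ ρ : ℝ}, |(a - U).eval ρ| ≤ 6 * η →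
      |U.eval ρ - u ρ τ| ≤ ω → |a.eval ρ - u ρ τ| ≤ 6 * η + ω := by
    intro a U u τ ρ k1 k2
    rw [eval_sub] at k1
    exact (abs_sub_le _ (U.eval ρ) _).trans (add_le_add k1 k2)
  constructor
  · refine ⟨?_, fun ρ hρ => comb (kL ρ hρ).1 (hUL.close t ht ρ hρ).1,
      fun ρ hρ => comb (kH ρ hρ).1 (hUH.close t ht ρ hρ).1,
      fun ρ hρ => comb (kF ρ hρ).1 (hUF.close t ht ρ hρ).1⟩
    rw [abs_le]; constructor <;> linarith [r1.1, r1.2]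
  · refine ⟨?_, fun ρ hρ => comb (kL ρ hρ).2 (hUL.close s hs ρ hρ).1,
      fun ρ hρ => comb (kH ρ hρ).2 (hUH.close s hs ρ hρ).1,
      fun ρ hρ => comb (kF ρ hρ).2 (hUF.close s hs ρ hρ).1⟩
    rw [abs_le]; constructor <;> linarith [r1.1, r1.2, r2.1, r2.2]

/-- Approximants of the exact solution and of its reaction terms, of size `N` and accuracy `ω`. -/
structure IsApproxSolution (p : Params) (T : ℝ) (N : ℕ) (ω : ℝ) (L H F v : ℝ → ℝ → ℝ) (R : ℝ → ℝ)
    (UL UH UF : ℝ → ℝ[X]) : Prop where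
  apprL : IsApprox T N ω L UL
  apprH : IsApprox T N ω H UH
  apprF : IsApprox T N ω F UF
  react : ∀ i, ∀ t ∈ Icc 0 T, ∃ b ∈ degreeLE ℝ N, ∀ ρ ∈ Icc (0 : ℝ) 1,
    |b.eval ρ - field p (state L H F v R ρ t) i| ≤ ω

lemma IsApprox.mono {N : ℕ} {a b : ℝ} {u : ℝ → ℝ → ℝ} {U : ℝ → ℝ[X]} (hU : IsApprox T N a u U)
    (hab : a ≤ b) : IsApprox T N b u U where
  trial := hU.trial
  close t ht ρ hρ := ⟨(hU.close t ht ρ hρ).1.trans hab,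
    (hU.close t ht ρ hρ).2.1.trans hab, (hU.close t ht ρ hρ).2.2.trans hab⟩
  time t ht s hs ρ hρ := (hU.time t ht s hs ρ hρ).trans
    (mul_le_mul_of_nonneg_right hab (abs_nonneg _))

lemma IsSolution.exists_approxSolution (hT : 0 < T) (h : IsSolution p T ε φL φH φF L H F v R)
    (hM0 : p.M0 ≠ 0) :
    ∃ ω : ℕ → ℝ, (∀ N, 0 ≤ ω N) ∧ Tendsto ω atTop (𝓝 0) ∧ ∀ N, ∃ UL UH UF,
      IsApproxSolution p T N (ω N) L H F v R UL UH UF := by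
  obtain ⟨ωL, hL0, hLt, hL⟩ := h.smoothL.exists_approx hT h.bcL
  obtain ⟨ωH, hH0, hHt, hH⟩ := h.smoothH.exists_approx hT h.bcH
  obtain ⟨ωF, hF0, hFt, hF⟩ := h.smoothF.exists_approx hT h.bcF
  choose ωR hR0 hRt hR using fun i => exists_bern_rate (T := T)
    (g := fun ρ t => field p (state L H F v R ρ t) i) (h.continuousOn_field hM0 i)
  have hsum : ∀ N, 0 ≤ ∑ i, ωR i N := fun N => Finset.sum_nonneg fun i _ => hR0 i N
  refine ⟨fun N => ωL N + ωH N + ωF N + ∑ i, ωR i N, fun N => ?_, ?_, fun N => ?_⟩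
  · exact add_nonneg (add_nonneg (add_nonneg (hL0 N) (hH0 N)) (hF0 N)) (hsum N)
  · have := ((hLt.add hHt).add hFt).add (tendsto_finsetSum Finset.univ fun i _ => hRt i)
    simpa using this
  · obtain ⟨UL, hUL⟩ := hL N
    obtain ⟨UH, hUH⟩ := hH N
    obtain ⟨UF, hUF⟩ := hF N
    have k1 := hL0 N
    have k2 := hH0 N
    have k3 := hF0 N
    have k4 := hsum N
    exact ⟨UL, UH, UF,
      { apprL := hUL.mono (by linarith)
        apprH := hUH.mono (by linarith)
        apprF := hUF.mono (by linarith)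
        react := fun i t ht => ⟨_, bern_mem N _, fun ρ hρ => (hR i N t ht ρ hρ).trans (by
          have k5 := Finset.single_le_sum (fun i _ => hR0 i N) (Finset.mem_univ i)
          linarith)⟩ }⟩

end

section

variable {p : Params} {T ε : ℝ} {φL φH φF : ℝ → ℝ} {L H F v : ℝ → ℝ → ℝ} {R : ℝ → ℝ}

/-! ### One step of the scheme -/

/-- The level `A₂` arises from the levels `A₀`, `A₁` with velocities `w₀`, `w₁` by one step of the
scheme. -/
structure IsStep (p : Params) (N : ℕ) (hs : ℝ) (A₀ A₁ : Level) (w₀ w₁ : ℝ → ℝ) (A₂ : Level) :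
    Prop where
  eqR : A₂.R = A₁.R - (A₀.R - A₁.R) / 3 + hs * (2 * w₁ 0 - w₀ 0)
  eqL : CollocStep N hs (1 / (1 - A₂.R) ^ 2) (fun ρ => convL p ρ A₂.R (2 * w₁ 0 - w₀ 0)) A₀.L A₁.L
    (fun ρ => fL p ρ A₀.R (w₀ 0) (A₀.L.eval ρ) (A₀.F.eval ρ))
    (fun ρ => fL p ρ A₁.R (w₁ 0) (A₁.L.eval ρ) (A₁.F.eval ρ)) A₂.L
  eqH : CollocStep N hs (1 / (1 - A₂.R) ^ 2) (fun ρ => convL p ρ A₂.R (2 * w₁ 0 - w₀ 0)) A₀.H A₁.H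
    (fun ρ => fH p ρ A₀.R (w₀ 0) (A₀.H.eval ρ) (A₀.F.eval ρ))
    (fun ρ => fH p ρ A₁.R (w₁ 0) (A₁.H.eval ρ) (A₁.F.eval ρ)) A₂.H
  eqF : CollocStep N hs (p.D / (1 - A₂.R) ^ 2)
    (fun ρ => convF p ρ A₂.R (2 * w₁ 0 - w₀ 0) (2 * w₁ ρ - w₀ ρ)) A₀.F A₁.F
    (fun ρ => fF p ρ A₀.R (w₀ 0) (w₀ ρ) (A₀.L.eval ρ) (A₀.H.eval ρ) (A₀.F.eval ρ))
    (fun ρ => fF p ρ A₁.R (w₁ 0) (w₁ ρ) (A₁.L.eval ρ) (A₁.H.eval ρ) (A₁.F.eval ρ)) A₂.F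

lemma isScheme_iff {M N : ℕ} {hs : ℝ} {S : ℕ → Level} {w : ℕ → ℝ → ℝ} :
    IsScheme p M N hs S w ↔ (∀ n < M, IsVelocity p (S n) (w n)) ∧
      ∀ n, n + 2 ≤ M → IsStep p N hs (S n) (S (n + 1)) (w n) (w (n + 1)) (S (n + 2)) :=
  ⟨fun h => ⟨fun n hn => ⟨h.eqv n hn, h.bcv n hn⟩,
    fun n hn => ⟨h.eqR n hn, h.eqL n hn, h.eqH n hn, h.eqF n hn⟩⟩,
  fun h => ⟨fun n hn => (h.1 n hn).1, fun n hn => (h.1 n hn).2, fun n hn => (h.2 n hn).eqR,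
    fun n hn => (h.2 n hn).eqL, fun n hn => (h.2 n hn).eqH, fun n hn => (h.2 n hn).eqF⟩⟩

lemma IsClose.mono {e e' t : ℝ} {A : Level} (h : IsClose L H F R e A t) (he : e ≤ e') :
    IsClose L H F R e' A t where
  R := h.R.trans he
  L ρ hρ := (h.L ρ hρ).trans he
  H ρ hρ := (h.H ρ hρ).trans he
  F ρ hρ := (h.F ρ hρ).trans he

lemma IsSolution.exists_field_bound (h : IsSolution p T ε φL φH φF L H F v R) (hM0 : p.M0 ≠ 0) :
    ∃ B, 0 ≤ B ∧ ∀ i, ∀ ρ ∈ Icc (0 : ℝ) 1, ∀ t ∈ Icc 0 T,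
      |field p (state L H F v R ρ t) i| ≤ B := by
  choose B hB0 hB using fun i => exists_bound (T := T)
    (g := fun ρ t => field p (state L H F v R ρ t) i) (h.continuousOn_field hM0 i)
  exact ⟨∑ i, B i, Finset.sum_nonneg fun i _ => hB0 i, fun i ρ hρ t ht => (hB i ρ hρ t ht).trans
    (Finset.single_le_sum (fun i _ => hB0 i) (Finset.mem_univ i))⟩

/-- The scalar version of `G`-stability, used for the front. -/
lemma bdf_sq_le {a b c δ s : ℝ} (hs : 0 ≤ s) (h : |3 * a - 4 * b + c| ≤ s * δ) :
    a ^ 2 + (2 * a - b) ^ 2 ≤ b ^ 2 + (2 * b - c) ^ 2 + s * (a ^ 2 + δ ^ 2) := by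
  have h1 : 2 * ((3 * a - 4 * b + c) * a) ≤ s * (a ^ 2 + δ ^ 2) := by
    have h2 : (3 * a - 4 * b + c) * a ≤ s * δ * |a| :=
      (le_abs_self _).trans (by rw [abs_mul]; gcongr)
    have h3 : 0 ≤ s * (|a| - δ) ^ 2 := by positivity
    have h4 := sq_abs a
    nlinarith
  nlinarith [sq_nonneg (a - 2 * b + c)]

set_option maxHeartbeats 1000000 in
/-- Under the smallness assumptions below, a step of the scheme can be carried out, and every such
step obeys the energy estimate. -/
lemma IsSolution.step_estimate (hD : 0 < p.D) (hT : 0 < T)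
    (h : IsSolution p T ε φL φH φF L H F v R) (hM0 : p.M0 ≠ 0) :
    ∃ C, 0 ≤ C ∧ ∃ r > 0, ∀ N ω UL UH UF, 2 ≤ N → 0 ≤ ω → ω ≤ r →
      IsApproxSolution p T N ω L H F v R UL UH UF →
      ∀ t s A₀ A₁ w₀ w₁, 0 < s → s ≤ r → t ≤ T → 0 ≤ t - 2 * s →
      totalEnergy UL UH UF R A₁ A₀ (t - s) (t - 2 * s) ≤ r ^ 2 →
      IsVelocity p A₀ w₀ → IsVelocity p A₁ w₁ →
      (∃ A₂, IsStep p N (2 * s / 3) A₀ A₁ w₀ w₁ A₂) ∧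
      ∀ A₂, IsStep p N (2 * s / 3) A₀ A₁ w₀ w₁ A₂ →
        totalEnergy UL UH UF R A₂ A₁ t (t - s)
          ≤ totalEnergy UL UH UF R A₁ A₀ (t - s) (t - 2 * s)
            + C * s * (totalEnergy UL UH UF R A₂ A₁ t (t - s)
              + (totalEnergy UL UH UF R A₁ A₀ (t - s) (t - 2 * s) + (s ^ 2 + ω) ^ 2)) := by
  obtain ⟨C₁, hC₁, r₁, hr₁, hpre⟩ := h.pre_step hT hM0
  obtain ⟨B, hB0, hB⟩ := h.exists_field_bound hM0
  -- The factor `D + 1` covers both diffusion coefficients, `1` and `D`.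
  obtain ⟨k, hk⟩ : ∃ k, k = (p.D + 1) * C₁ := ⟨_, rfl⟩
  have hk0 : 0 ≤ k := by rw [hk]; positivity
  have hk1 : C₁ ≤ k := by rw [hk]; nlinarith
  obtain ⟨Γ, hΓ⟩ : ∃ Γ, Γ = (p.D + 1) * B + 2 * k := ⟨_, rfl⟩
  have hBΓ : B ≤ (p.D + 1) * B := by nlinarith
  have hΓ0 : 0 ≤ Γ := by rw [hΓ]; positivity
  obtain ⟨CL, hCL, hL⟩ := h.smoothL.component_energy hT h.bcL (d₀ := 1 / 2) (by norm_num) hΓ0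
  obtain ⟨CH, hCH, hH⟩ := h.smoothH.component_energy hT h.bcH (d₀ := 1 / 2) (by norm_num) hΓ0
  obtain ⟨CF, hCF, hF⟩ := h.smoothF.component_energy hT h.bcF (d₀ := p.D / 2) (by positivity) hΓ0
  obtain ⟨Q, hQ⟩ : ∃ Q, Q = 72 * (k + 1) ^ 2 := ⟨_, rfl⟩
  have hQ0 : 0 ≤ Q := by rw [hQ]; positivity
  -- The factor `7` is due to `e = 6 η + ω ≤ 7 r`. The last two conditions yield `hs Γ² < 2 d`,
  -- which makes the linear systems solvable, with `d` at least `1 / 2` or `D / 2`.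
  obtain ⟨r, hr, hrr, hr1, hrΓ, hrD⟩ : ∃ r > 0, 7 * r ≤ r₁ ∧ 7 * r ≤ 1 ∧ r * (Γ ^ 2 + 1) ≤ 1 ∧
      r * (Γ ^ 2 + 1) ≤ p.D := by
    have h1 : 0 < Γ ^ 2 + 1 := by positivity
    refine ⟨min (r₁ / 7) (min (1 / 7) (min (1 / (Γ ^ 2 + 1)) (p.D / (Γ ^ 2 + 1)))), by positivity,
      ?_, ?_, ?_, ?_⟩
    · linarith [min_le_left (r₁ / 7) (min (1 / 7) (min (1 / (Γ ^ 2 + 1)) (p.D / (Γ ^ 2 + 1))))]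
    · linarith [(min_le_right (r₁ / 7) (min (1 / 7) (min (1 / (Γ ^ 2 + 1))
        (p.D / (Γ ^ 2 + 1))))).trans (min_le_left _ _)]
    · rw [← le_div_iff₀ h1]
      exact (min_le_right _ _).trans ((min_le_right _ _).trans (min_le_left _ _))
    · rw [← le_div_iff₀ h1]
      exact (min_le_right _ _).trans ((min_le_right _ _).trans (min_le_right _ _))
  refine ⟨(CL + CH + CF + 1) * (1 + Q), by positivity, r, hr, ?_⟩
  intro N ω UL UH UF hN hω0 hω hU t s A₀ A₁ w₀ w₁ hs hsr ht hts hE hw₀ hw₁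
  have m0 : t ∈ Icc 0 T := ⟨by linarith, ht⟩
  have m1 : t - s ∈ Icc 0 T := ⟨by linarith, by linarith⟩
  have m2 : t - 2 * s ∈ Icc 0 T := ⟨hts, by linarith⟩
  have hE0 := totalEnergy_nonneg UL UH UF R A₁ A₀ (t - s) (t - 2 * s)
  obtain ⟨E₁, hE₁⟩ : ∃ E, E = totalEnergy UL UH UF R A₁ A₀ (t - s) (t - 2 * s) := ⟨_, rfl⟩
  rw [← hE₁] at hE hE0
  obtain ⟨η, hη0, hη⟩ : ∃ η, 0 ≤ η ∧ η ^ 2 = E₁ :=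
    ⟨Real.sqrt E₁, Real.sqrt_nonneg _, Real.sq_sqrt hE0⟩
  have hηr : η ≤ r := le_of_sq_le_sq (by rw [hη]; exact hE) hr.le
  obtain ⟨c1, c0⟩ := isClose_of_totalEnergy hU.apprL hU.apprH hU.apprF hω0 hη0 m1 m2
    (by rw [← hE₁, hη])
  obtain ⟨e, he⟩ : ∃ e, e = 6 * η + ω := ⟨_, rfl⟩
  rw [← he] at c1 c0
  have he0 : 0 ≤ e := by rw [he]; positivity
  have her : e ≤ 7 * r := by rw [he]; linarith
  have hs2 : s ^ 2 ≤ 1 := pow_le_one₀ hs.le (by linarith)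
  have he2 : C₁ * (e + s ^ 2) ≤ k * (e + s ^ 2) := by gcongr
  have hk2 : k * (e + s ^ 2) ≤ 2 * k := by nlinarith
  -- The residual is at most `6 (k + 1) (η + s² + ω)`; its square, with `(x + y)² ≤ 2 (x² + y²)`,
  -- accounts for `72` in `Q`.
  have hsq : (k * (e + s ^ 2) + s ^ 2 + ω) ^ 2 ≤ Q * (E₁ + (s ^ 2 + ω) ^ 2) := by
    have h1 : k * (e + s ^ 2) + s ^ 2 + ω ≤ 6 * (k + 1) * (η + (s ^ 2 + ω)) := by
      have h2 : 0 ≤ k * (5 * s ^ 2 + 5 * ω) := by positivity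
      have h3 := sq_nonneg s
      rw [he]
      linarith
    have h2 : 0 ≤ k * (e + s ^ 2) + s ^ 2 + ω := by positivity
    have h3 := pow_le_pow_left₀ h2 h1 2
    have h4 : (η + (s ^ 2 + ω)) ^ 2 ≤ 2 * (E₁ + (s ^ 2 + ω) ^ 2) := by
      rw [← hη]; linarith [sq_nonneg (η - (s ^ 2 + ω))]
    have h5 : 0 ≤ 36 * (k + 1) ^ 2 := by positivity
    have h6 := mul_le_mul_of_nonneg_left h4 h5
    rw [mul_pow, mul_pow] at h3
    rw [hQ]
    linarith
  have hgen := hpre t s e A₀ A₁ w₀ w₁ _ hs.le (by linarith) ht hts (by linarith) c0 c1 hw₀ hw₁ rfl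
  obtain ⟨R₂, hR₂⟩ : ∃ R₂, R₂ = A₁.R - (A₀.R - A₁.R) / 3 + 2 * s / 3 * (2 * w₁ 0 - w₀ 0) := ⟨_, rfl⟩
  rw [← hR₂] at hgen
  obtain ⟨hRest, hfield, hdiff, hreact⟩ := hgen
  have hold : ∀ i, ∀ ρ ∈ Icc (0 : ℝ) 1, |field p (state L H F v R ρ t) i| ≤ Γ := fun i ρ hρ =>
    (hB i ρ hρ t m0).trans (by rw [hΓ]; linarith)
  have hclose : ∀ i, ∀ ρ ∈ Icc (0 : ℝ) 1, |field p (newState L H F t R₂ w₀ w₁ ρ) i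
      - field p (state L H F v R ρ t) i| ≤ k * (e + s ^ 2) := fun i ρ hρ =>
    ((hfield i).2 ρ hρ).trans he2
  have hnew : ∀ i, ∀ ρ ∈ Icc (0 : ℝ) 1, |field p (newState L H F t R₂ w₀ w₁ ρ) i| ≤ Γ := by
    intro i ρ hρ
    have h1 := abs_sub_abs_le_abs_sub (field p (newState L H F t R₂ w₀ w₁ ρ) i)
      (field p (state L H F v R ρ t) i)
    rw [hΓ]
    linarith [hclose i ρ hρ, hB i ρ hρ t m0]
  have hDe : p.D / (1 - R₂) ^ 2 = p.D * (1 / (1 - R₂) ^ 2) := div_eq_mul_one_div _ _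
  have hDd : p.D / 2 ≤ p.D / (1 - R₂) ^ 2 := by rw [hDe]; nlinarith
  have hsΓ : s * Γ ^ 2 < 1 ∧ s * Γ ^ 2 < p.D := by
    have h1 : s * Γ ^ 2 ≤ r * Γ ^ 2 := by gcongr
    constructor <;> linarith
  constructor
  · obtain ⟨l, hl⟩ := exists_collocStep (N := N) (by omega) (hs := 2 * s / 3) (by positivity)
      (d := 1 / (1 - R₂) ^ 2) (by linarith) (hfield 3).1 (hnew 3) (by linarith) A₀.L A₁.L
      (fun ρ => fL p ρ A₀.R (w₀ 0) (A₀.L.eval ρ) (A₀.F.eval ρ))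
      (fun ρ => fL p ρ A₁.R (w₁ 0) (A₁.L.eval ρ) (A₁.F.eval ρ))
    obtain ⟨g, hg⟩ := exists_collocStep (N := N) (by omega) (hs := 2 * s / 3) (by positivity)
      (d := 1 / (1 - R₂) ^ 2) (by linarith) (hfield 3).1 (hnew 3) (by linarith) A₀.H A₁.H
      (fun ρ => fH p ρ A₀.R (w₀ 0) (A₀.H.eval ρ) (A₀.F.eval ρ))
      (fun ρ => fH p ρ A₁.R (w₁ 0) (A₁.H.eval ρ) (A₁.F.eval ρ))
    obtain ⟨f, hf⟩ := exists_collocStep (N := N) (by omega) (hs := 2 * s / 3) (by positivity)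
      (d := p.D / (1 - R₂) ^ 2) (by linarith) (hfield 4).1 (hnew 4) (by linarith) A₀.F A₁.F
      (fun ρ => fF p ρ A₀.R (w₀ 0) (w₀ ρ) (A₀.L.eval ρ) (A₀.H.eval ρ) (A₀.F.eval ρ))
      (fun ρ => fF p ρ A₁.R (w₁ 0) (w₁ ρ) (A₁.L.eval ρ) (A₁.H.eval ρ) (A₁.F.eval ρ))
    exact ⟨⟨l, g, f, R₂⟩, hR₂, hl, hg, hf⟩
  · intro A₂ hA₂
    have hAR : A₂.R = R₂ := by rw [hR₂]; exact hA₂.eqR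
    have hz : (0 : ℝ) ∈ Icc (0 : ℝ) 1 := ⟨le_rfl, zero_le_one⟩
    have stL := hA₂.eqL
    have stH := hA₂.eqH
    have stF := hA₂.eqF
    rw [hAR] at stL stH stF
    have hfr : ∀ i, ∃ b ∈ degreeLE ℝ N, ∀ ρ ∈ Icc (0 : ℝ) 1,
        |b.eval ρ - field p (state L H F v R ρ t) i| ≤ ω := fun i => hU.react i t m0
    have h5 : ∀ ρ, field p (state L H F v R ρ t) 5 = 1 / (1 - R t) ^ 2 := fun ρ => rfl
    have o5 : |1 / (1 - R t) ^ 2| ≤ Γ := hold 5 0 hz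
    have c5 : |1 / (1 - R₂) ^ 2 - 1 / (1 - R t) ^ 2| ≤ k * (e + s ^ 2) := hclose 5 0 hz
    have o5D : |p.D * (1 / (1 - R t) ^ 2)| ≤ Γ := by
      rw [abs_mul, abs_of_pos hD]
      have h1 : |1 / (1 - R t) ^ 2| ≤ B := hB 5 0 hz t m0
      rw [hΓ]
      nlinarith
    have c5D : |p.D / (1 - R₂) ^ 2 - p.D * (1 / (1 - R t) ^ 2)| ≤ k * (e + s ^ 2) := by
      have h1 : |1 / (1 - R₂) ^ 2 - 1 / (1 - R t) ^ 2| ≤ C₁ * (e + s ^ 2) := (hfield 5).2 0 hz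
      rw [hDe, ← mul_sub, abs_mul, abs_of_pos hD, hk]
      have h2 := mul_le_mul_of_nonneg_left h1 hD.le
      have h3 : 0 ≤ C₁ * (e + s ^ 2) := by positivity
      linarith
    obtain ⟨bL, hbL, hbL'⟩ := hfr 0
    obtain ⟨bH, hbH, hbH'⟩ := hfr 1
    obtain ⟨bF, hbF, hbF'⟩ := hfr 2
    have hω1 : ω ≤ 1 := by linarith
    have keyL := hL N ω UL hN hω0 hω1 hU.apprL t s _ (1 / (1 - R t) ^ 2) (k * (e + s ^ 2)) _
      (fun ρ => field p (state L H F v R ρ t) 3) (fun ρ => field p (state L H F v R ρ t) 0) _ _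
      _ _ _ bL hs ht hts hdiff o5 c5 (hfield 3).1 (hnew 3) (hold 3) (hclose 3) hbL hbL'
      (fun ρ hρ => (hreact 0 ρ hρ).trans he2) (fun ρ hρ => (h.equations hT hM0 hρ m0).1) stL
    have keyH := hH N ω UH hN hω0 hω1 hU.apprH t s _ (1 / (1 - R t) ^ 2) (k * (e + s ^ 2)) _
      (fun ρ => field p (state L H F v R ρ t) 3) (fun ρ => field p (state L H F v R ρ t) 1) _ _
      _ _ _ bH hs ht hts hdiff o5 c5 (hfield 3).1 (hnew 3) (hold 3) (hclose 3) hbH hbH'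
      (fun ρ hρ => (hreact 1 ρ hρ).trans he2) (fun ρ hρ => (h.equations hT hM0 hρ m0).2.1) stH
    have keyF := hF N ω UF hN hω0 hω1 hU.apprF t s _ (p.D * (1 / (1 - R t) ^ 2))
      (k * (e + s ^ 2)) _
      (fun ρ => field p (state L H F v R ρ t) 4) (fun ρ => field p (state L H F v R ρ t) 2) _ _
      _ _ _ bF hs ht hts hDd o5D c5D (hfield 4).1 (hnew 4) (hold 4) (hclose 4) hbF hbF'
      (fun ρ hρ => (hreact 2 ρ hρ).trans he2) (fun ρ hρ => (h.equations hT hM0 hρ m0).2.2) stF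
    have keyR := bdf_sq_le (a := A₂.R - R t) (b := A₁.R - R (t - s)) (c := A₀.R - R (t - 2 * s))
      (δ := C₁ * (e + s ^ 2)) hs.le (by rw [hAR]; linarith)
    have hE₂ : ∃ E, E = totalEnergy UL UH UF R A₂ A₁ t (t - s) := ⟨_, rfl⟩
    obtain ⟨E₂, hE₂⟩ := hE₂
    have nL := energy_nonneg (A₂.L - UL t) (A₁.L - UL (t - s))
    have nH := energy_nonneg (A₂.H - UH t) (A₁.H - UH (t - s))
    have nF := energy_nonneg (A₂.F - UF t) (A₁.F - UF (t - s))
    have nR := sq_nonneg (A₂.R - R t)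
    have nR' := sq_nonneg (2 * (A₂.R - R t) - (A₁.R - R (t - s)))
    have sumE₁ : E₁ = _ := hE₁
    have sumE₂ : E₂ = _ := hE₂
    unfold totalEnergy at sumE₁ sumE₂
    have hX : 0 ≤ E₁ + (s ^ 2 + ω) ^ 2 := by positivity
    have hE₂0 : 0 ≤ E₂ := by rw [sumE₂]; linarith
    have absorb : ∀ {c x y : ℝ}, 0 ≤ c → x ≤ E₂ → y ≤ Q * (E₁ + (s ^ 2 + ω) ^ 2) →
        c * s * (x + y) ≤ c * s * ((1 + Q) * (E₂ + (E₁ + (s ^ 2 + ω) ^ 2))) := by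
      intro c x y hc hx hy
      have h1 : 0 ≤ Q * E₂ := by positivity
      exact mul_le_mul_of_nonneg_left (by linarith) (by positivity)
    have aL := absorb hCL (x := energy (A₂.L - UL t) (A₁.L - UL (t - s))) (by linarith) hsq
    have aH := absorb hCH (x := energy (A₂.H - UH t) (A₁.H - UH (t - s))) (by linarith) hsq
    have aF := absorb hCF (x := energy (A₂.F - UF t) (A₁.F - UF (t - s))) (by linarith) hsq
    have aR := absorb zero_le_one (x := (A₂.R - R t) ^ 2) (by linarith)
      ((pow_le_pow_left₀ (by positivity) (by linarith [sq_nonneg s]) 2).trans hsq :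
        (C₁ * (e + s ^ 2)) ^ 2 ≤ _)
    rw [← hE₁, ← hE₂]
    have total : E₂ ≤ E₁ + (CL * s * ((1 + Q) * (E₂ + (E₁ + (s ^ 2 + ω) ^ 2)))
        + CH * s * ((1 + Q) * (E₂ + (E₁ + (s ^ 2 + ω) ^ 2)))
        + CF * s * ((1 + Q) * (E₂ + (E₁ + (s ^ 2 + ω) ^ 2)))
        + 1 * s * ((1 + Q) * (E₂ + (E₁ + (s ^ 2 + ω) ^ 2)))) := by
      linarith
    linarith

end

section

variable {p : Params} {T ε : ℝ} {φL φH φF : ℝ → ℝ} {L H F v : ℝ → ℝ → ℝ} {R : ℝ → ℝ}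

/-! ### Accumulation of the errors -/

/-- A discrete Gronwall inequality whose recursion is available only as long as the quantity is
small. -/
lemma discrete_gronwall {E : ℕ → ℝ} {C h T r δ : ℝ} {m : ℕ} (hE : ∀ n, 0 ≤ E n) (hC : 0 ≤ C)
    (hh : 0 ≤ h) (hCh : C * h ≤ 1 / 2) (hm : m * h ≤ T)
    (hsmall : Real.exp (4 * C * T) * (E 0 + δ ^ 2) ≤ r ^ 2)
    (hrec : ∀ n, n + 1 < m → E n ≤ r ^ 2 →
      E (n + 1) ≤ E n + C * h * (E (n + 1) + (E n + δ ^ 2))) :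
    ∀ n < m, E n + δ ^ 2 ≤ Real.exp (4 * C * T) * (E 0 + δ ^ 2) := by
  have h0 : 0 ≤ E 0 + δ ^ 2 := add_nonneg (hE 0) (sq_nonneg δ)
  have hle : ∀ n : ℕ, n < m → Real.exp (4 * C * (n * h)) * (E 0 + δ ^ 2)
      ≤ Real.exp (4 * C * T) * (E 0 + δ ^ 2) := by
    intro n hn
    have h1 : (n : ℝ) ≤ m := by exact_mod_cast hn.le
    have h2 : (n : ℝ) * h ≤ T := (mul_le_mul_of_nonneg_right h1 hh).trans hm
    gcongr
  have key : ∀ n < m, E n + δ ^ 2 ≤ Real.exp (4 * C * (n * h)) * (E 0 + δ ^ 2) := by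
    intro n
    induction n with
    | zero => intro _; simp
    | succ n ih =>
      intro hn
      have h1 := ih (by omega)
      have h2 := h1.trans (hle n (by omega))
      -- The induction bound and `hsmall` give `E n ≤ r ^ 2`, which unlocks the recursion.
      have h3 := hrec n hn (by linarith [sq_nonneg δ])
      have hx : 0 ≤ C * h := by positivity
      have h4 : E (n + 1) + δ ^ 2 ≤ (1 + 4 * (C * h)) * (E n + δ ^ 2) := by
        have hY : 0 ≤ E n + δ ^ 2 := add_nonneg (hE n) (sq_nonneg δ)
        have h5 : (E (n + 1) + δ ^ 2) * (1 - C * h) ≤ (1 + C * h) * (E n + δ ^ 2) := by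
          nlinarith [sq_nonneg δ]
        -- For `x = C h ≤ 1 / 2`, `(1 + 4 x) (1 - x) - (1 + x) = 2 x (1 - 2 x) ≥ 0`.
        have h6 : (1 + C * h) * (E n + δ ^ 2)
            ≤ ((1 + 4 * (C * h)) * (E n + δ ^ 2)) * (1 - C * h) := by
          nlinarith [mul_nonneg (mul_nonneg hx (by linarith : 0 ≤ 1 - 2 * (C * h))) hY]
        exact le_of_mul_le_mul_right (h5.trans h6) (by linarith)
      have h7 := Real.add_one_le_exp (4 * (C * h))
      calc E (n + 1) + δ ^ 2 ≤ (1 + 4 * (C * h)) * (E n + δ ^ 2) := h4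
        _ ≤ Real.exp (4 * (C * h)) * (Real.exp (4 * C * (n * h)) * (E 0 + δ ^ 2)) := by
          refine mul_le_mul (by linarith) h1 (add_nonneg (hE n) (sq_nonneg δ)) (Real.exp_pos _).le
        _ = Real.exp (4 * C * ((n + 1 : ℕ) * h)) * (E 0 + δ ^ 2) := by
          rw [← mul_assoc, ← Real.exp_add]
          push_cast
          ring_nf
  exact fun n hn => (key n hn).trans (hle n hn)

/-- The bound is proved for every scheme of any length `m` with `m s ≤ T`. Existence then follows by
induction on `m`: the bound for the part already constructed keeps the last levels close to the
exact solution, so the next velocity and the next level exist. -/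
lemma IsSolution.scheme_estimate (hD : 0 < p.D) (hT : 0 < T)
    (h : IsSolution p T ε φL φH φF L H F v R) (hM0 : p.M0 ≠ 0) :
    ∃ C, 0 ≤ C ∧ ∃ r > 0, ∀ N ω UL UH UF, 2 ≤ N → 0 ≤ ω → ω ≤ r →
      IsApproxSolution p T N ω L H F v R UL UH UF →
      ∀ s A₀ A₁, 0 < s → s ≤ r → s ≤ T →
      Real.exp (4 * C * T) * (totalEnergy UL UH UF R A₁ A₀ s 0 + (s ^ 2 + ω) ^ 2) ≤ r ^ 2 →
      ∀ m : ℕ, m * s ≤ T →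
      (∃ (S : ℕ → Level) (w : ℕ → ℝ → ℝ), S 0 = A₀ ∧ S 1 = A₁ ∧
        IsScheme p m N (2 * s / 3) S w) ∧
      ∀ (S : ℕ → Level) (w : ℕ → ℝ → ℝ), S 0 = A₀ → S 1 = A₁ → IsScheme p m N (2 * s / 3) S w →
        ∀ n < m, totalEnergy UL UH UF R (S (n + 1)) (S n) ((n + 1 : ℕ) * s) (n * s)
            + (s ^ 2 + ω) ^ 2
          ≤ Real.exp (4 * C * T) * (totalEnergy UL UH UF R A₁ A₀ s 0 + (s ^ 2 + ω) ^ 2) := by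
  obtain ⟨C, hC, r₁, hr₁, hstep⟩ := h.step_estimate hD hT hM0
  obtain ⟨r₂, hr₂, hvel⟩ := h.exists_velocity
  obtain ⟨r, hr, hrr₁, hrr₂, hCr⟩ : ∃ r > 0, r ≤ r₁ ∧ 7 * r ≤ r₂ ∧ C * r ≤ 1 / 2 := by
    refine ⟨min r₁ (min (r₂ / 7) (1 / 2 / (C + 1))), by positivity, min_le_left _ _, ?_, ?_⟩
    · linarith [(min_le_right r₁ (min (r₂ / 7) (1 / 2 / (C + 1)))).trans (min_le_left _ _)]
    · have h1 : min r₁ (min (r₂ / 7) (1 / 2 / (C + 1))) ≤ 1 / 2 / (C + 1) :=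
        (min_le_right _ _).trans (min_le_right _ _)
      rw [le_div_iff₀ (by positivity)] at h1
      have h2 : 0 < min r₁ (min (r₂ / 7) (1 / 2 / (C + 1))) := by positivity
      linarith
  refine ⟨C, hC, r, hr, ?_⟩
  intro N ω UL UH UF hN hω0 hω hU s A₀ A₁ hs hsr hsT hsmall
  have hr_sq : r ^ 2 ≤ r₁ ^ 2 := by gcongr
  have bound : ∀ m : ℕ, m * s ≤ T → ∀ (S : ℕ → Level) (w : ℕ → ℝ → ℝ), S 0 = A₀ → S 1 = A₁ →
      IsScheme p m N (2 * s / 3) S w →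
      ∀ n < m, totalEnergy UL UH UF R (S (n + 1)) (S n) ((n + 1 : ℕ) * s) (n * s)
          + (s ^ 2 + ω) ^ 2
        ≤ Real.exp (4 * C * T) * (totalEnergy UL UH UF R A₁ A₀ s 0 + (s ^ 2 + ω) ^ 2) := by
    intro m hm S w hS0 hS1 hS
    rw [isScheme_iff] at hS
    have base : totalEnergy UL UH UF R A₁ A₀ s 0
        = totalEnergy UL UH UF R (S (0 + 1)) (S 0) ((0 + 1 : ℕ) * s) ((0 : ℕ) * s) := by
      simp [hS0, hS1]
    rw [base]
    refine discrete_gronwall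
      (E := fun n => totalEnergy UL UH UF R (S (n + 1)) (S n) ((n + 1 : ℕ) * s) (n * s))
      (fun n => totalEnergy_nonneg ..) hC hs.le
      ((mul_le_mul_of_nonneg_left hsr hC).trans hCr) hm (by rw [← base]; exact hsmall) ?_
    intro n hn hsm
    have ht : ((n + 2 : ℕ) : ℝ) * s ≤ T := by
      have h1 : ((n + 2 : ℕ) : ℝ) ≤ m := by exact_mod_cast hn
      exact (mul_le_mul_of_nonneg_right h1 hs.le).trans hm
    have e1 : ((n + 2 : ℕ) : ℝ) * s - s = (n + 1 : ℕ) * s := by push_cast; ring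
    have e2 : ((n + 2 : ℕ) : ℝ) * s - 2 * s = n * s := by push_cast; ring
    have key := (hstep N ω UL UH UF hN hω0 (hω.trans hrr₁) hU ((n + 2 : ℕ) * s) s (S n) (S (n + 1))
      (w n) (w (n + 1)) hs (hsr.trans hrr₁) ht (by rw [e2]; positivity)
      (by rw [e1, e2]; exact hsm.trans hr_sq) (hS.1 n (by omega)) (hS.1 (n + 1) hn)).2 _
      (hS.2 n hn)
    rw [e1, e2] at key
    exact key
  intro m hm
  refine ⟨?_, bound m hm⟩
  have close : ∀ {A B : Level} {t t' : ℝ}, t ∈ Icc 0 T → t' ∈ Icc 0 T →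
      totalEnergy UL UH UF R A B t t' ≤ r ^ 2 →
      IsClose L H F R r₂ A t ∧ IsClose L H F R r₂ B t' := by
    intro A B t t' ht ht' hE
    have h1 := isClose_of_totalEnergy hU.apprL hU.apprH hU.apprF hω0 hr.le ht ht' hE
    exact ⟨h1.1.mono (by linarith), h1.2.mono (by linarith)⟩
  induction m with
  | zero =>
    refine ⟨fun n => if n = 0 then A₀ else A₁, fun _ _ => 0, rfl, rfl, isScheme_iff.2 ⟨?_, ?_⟩⟩
    · intro n hn; omega
    · intro n hn; omega
  | succ m ih =>
    have hm' : (m : ℝ) * s ≤ T := by push_cast at hm; linarith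
    obtain ⟨S, w, hS0, hS1, hS⟩ := ih hm'
    have hb := bound m hm' S w hS0 hS1 hS
    rw [isScheme_iff] at hS
    -- A scheme of length `m` has velocities of index below `m` but levels up to `m`. Going from
    -- length `0` to `1` therefore adds only the velocity of the starting level `A₀`; every later
    -- extension adds one velocity and one level.
    obtain _ | n := m
    · have h1 : totalEnergy UL UH UF R A₁ A₀ s 0 ≤ r ^ 2 := by
        have h2 := totalEnergy_nonneg UL UH UF R A₁ A₀ s 0
        have h3 := Real.one_le_exp (x := 4 * C * T) (by positivity)
        nlinarith [sq_nonneg (s ^ 2 + ω)]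
      obtain ⟨w', hw'⟩ := hvel 0 ⟨le_rfl, hT.le⟩ A₀
        (close ⟨hs.le, hsT⟩ ⟨le_rfl, hT.le⟩ h1).2
      refine ⟨S, fun _ => w', hS0, hS1, isScheme_iff.2 ⟨?_, ?_⟩⟩
      · intro k hk
        obtain rfl : k = 0 := by omega
        rw [hS0]
        exact hw'
      · intro k hk; omega
    · have h1 := (hb n (by omega)).trans hsmall
      have h2 : totalEnergy UL UH UF R (S (n + 1)) (S n) ((n + 1 : ℕ) * s) (n * s) ≤ r ^ 2 := by
        linarith [sq_nonneg (s ^ 2 + ω)]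
      have e1 : ((n + 1 + 1 : ℕ) : ℝ) * s - s = (n + 1 : ℕ) * s := by push_cast; ring
      have e2 : ((n + 1 + 1 : ℕ) : ℝ) * s - 2 * s = n * s := by push_cast; ring
      have hn0 : (0 : ℝ) ≤ n * s := by positivity
      have hn1 : (n : ℝ) * s ≤ T := by push_cast at hm'; linarith
      obtain ⟨w', hw'⟩ := hvel _ ⟨by positivity, hm'⟩ (S (n + 1))
        (close ⟨by positivity, hm'⟩ ⟨hn0, hn1⟩ h2).1
      obtain ⟨A₂, hA₂⟩ := (hstep N ω UL UH UF hN hω0 (hω.trans hrr₁) hU ((n + 1 + 1 : ℕ) * s) s (S n)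
        (S (n + 1)) (w n) w' hs (hsr.trans hrr₁) hm (by rw [e2]; exact hn0)
        (by rw [e1, e2]; exact h2.trans hr_sq) (hS.1 n (by omega)) hw').1
      refine ⟨Function.update S (n + 2) A₂, Function.update w (n + 1) w', ?_, ?_,
        isScheme_iff.2 ⟨?_, ?_⟩⟩
      · rw [Function.update_of_ne (by omega), hS0]
      · rw [Function.update_of_ne (by omega), hS1]
      · intro k hk
        rw [Function.update_of_ne (by omega)]
        obtain rfl | hk' : k = n + 1 ∨ k < n + 1 := by omega
        · rwa [Function.update_self]
        · rw [Function.update_of_ne (by omega)]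
          exact hS.1 k hk'
      · intro k hk
        rw [Function.update_of_ne (a := k) (by omega), Function.update_of_ne (a := k + 1) (by omega),
          Function.update_of_ne (a := k) (by omega)]
        obtain rfl | hk' : k = n ∨ k + 2 ≤ n + 1 := by omega
        · rwa [Function.update_self, Function.update_self]
        · rw [Function.update_of_ne (by omega), Function.update_of_ne (by omega)]
          exact hS.2 k hk'

/-! ### Energy and the error norms -/

lemma intervalIntegral_sq_le {f g : ℝ → ℝ} {c : ℝ} (hf : ContinuousOn f (Icc 0 1))
    (hg : ContinuousOn g (Icc 0 1)) (h : ∀ ρ ∈ Icc (0 : ℝ) 1, |f ρ - g ρ| ≤ c) :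
    ∫ ρ in (0 : ℝ)..1, f ρ ^ 2 ≤ 2 * (∫ ρ in (0 : ℝ)..1, g ρ ^ 2) + 2 * c ^ 2 := by
  have ii : ∀ {f : ℝ → ℝ}, ContinuousOn f (Icc 0 1) →
      IntervalIntegrable f MeasureTheory.volume 0 1 := fun hf =>
    ContinuousOn.intervalIntegrable (by rwa [uIcc_of_le zero_le_one])
  have h1 : ∫ ρ in (0 : ℝ)..1, f ρ ^ 2 ≤ ∫ ρ in (0 : ℝ)..1, (2 * g ρ ^ 2 + 2 * c ^ 2) := by
    refine intervalIntegral.integral_mono_on zero_le_one (ii (hf.fun_pow 2))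
      (ii (((hg.fun_pow 2).const_mul 2).fun_add continuousOn_const)) fun ρ hρ => ?_
    have h2 : (f ρ - g ρ) ^ 2 ≤ c ^ 2 := by
      rw [← sq_abs]
      exact pow_le_pow_left₀ (abs_nonneg _) (h ρ hρ) 2
    nlinarith [sq_nonneg (f ρ - 2 * g ρ)]
  rw [intervalIntegral.integral_add (ii ((hg.fun_pow 2).const_mul 2)) (ii continuousOn_const),
    intervalIntegral.integral_const_mul] at h1
  simpa using h1

lemma norm2_sq (f : ℝ → ℝ) : norm2 f ^ 2 = ∫ ρ in (0 : ℝ)..1, f ρ ^ 2 :=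
  Real.sq_sqrt (intervalIntegral.integral_nonneg zero_le_one fun _ _ => sq_nonneg _)

lemma norm2_nonneg (f : ℝ → ℝ) : 0 ≤ norm2 f := Real.sqrt_nonneg _

lemma Smooth.continuousOn_slice {u : ℝ → ℝ → ℝ} (hu : Smooth T u) {t : ℝ} (ht : t ∈ Icc 0 T) :
    ContinuousOn (fun ρ => u ρ t) (Icc 0 1) ∧ ContinuousOn (fun ρ => dρ u ρ t) (Icc 0 1) :=
  ⟨(hu.space t ht).continuousOn, fun _ hρ => (hu.hasDeriv_grad ht hρ).continuousWithinAt⟩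

/-- Each level has squared `H¹`-type error at most `4 (b² + ω²)`; expanding `2 a - c` weights the
newer level by `1 + 8` and the older one by `2`, and `11 · 4 = 44`. -/
lemma Smooth.energy_le {N : ℕ} {ω b t s : ℝ} {u : ℝ → ℝ → ℝ} (hu : Smooth T u) {U : ℝ → ℝ[X]}
    (hU : IsApprox T N ω u U) (ht : t ∈ Icc 0 T) (hs : s ∈ Icc 0 T) {a c : ℝ[X]}
    (ha : norm2 (fun ρ => (derivative a).eval ρ - dρ u ρ t) ≤ b)
    (ha' : norm2 (fun ρ => a.eval ρ - u ρ t) ≤ b)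
    (hc : norm2 (fun ρ => (derivative c).eval ρ - dρ u ρ s) ≤ b)
    (hc' : norm2 (fun ρ => c.eval ρ - u ρ s) ≤ b) :
    energy (a - U t) (c - U s) ≤ 44 * (b ^ 2 + ω ^ 2) := by
  have hpc : ∀ p : ℝ[X], ContinuousOn (fun ρ => p.eval ρ) (Icc (0 : ℝ) 1) :=
    fun p => p.continuous.continuousOn
  have single : ∀ {q : ℝ[X]} {τ : ℝ}, τ ∈ Icc 0 T →
      norm2 (fun ρ => (derivative q).eval ρ - dρ u ρ τ) ≤ b →
      norm2 (fun ρ => q.eval ρ - u ρ τ) ≤ b →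
      intg (derivative (q - U τ) ^ 2) + intg (q - U τ) ^ 2 ≤ 4 * b ^ 2 + 4 * ω ^ 2 := by
    intro q τ hτ h1 h2
    obtain ⟨k1, k2⟩ := hu.continuousOn_slice hτ
    have h3 := pow_le_pow_left₀ (norm2_nonneg _) h1 2
    have h4 := pow_le_pow_left₀ (norm2_nonneg _) h2 2
    rw [norm2_sq] at h3 h4
    have h5 := intervalIntegral_sq_le (hpc (derivative (q - U τ))) ((hpc (derivative q)).fun_sub k2)
      (c := ω) fun ρ hρ => by
        have := (hU.close τ hτ ρ hρ).2.1
        rw [abs_sub_comm] at this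
        rw [derivative_sub, eval_sub]
        convert this using 2
        ring
    have h6 := intervalIntegral_sq_le (hpc (q - U τ)) ((hpc q).fun_sub k1)
      (c := ω) fun ρ hρ => by
        have := (hU.close τ hτ ρ hρ).1
        rw [abs_sub_comm] at this
        rw [eval_sub]
        convert this using 2
        ring
    have h7 := sq_integral_le (hpc (q - U τ))
    have h8 : intg (derivative (q - U τ) ^ 2)
        = ∫ ρ in (0 : ℝ)..1, (derivative (q - U τ)).eval ρ ^ 2 := by
      simp only [intg_apply, eval_pow]
    rw [h8, intg_apply]
    linarith
  have h1 := single ht ha ha'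
  have h2 := single hs hc hc'
  have h3 : intg ((2 * derivative (a - U t) - derivative (c - U s)) ^ 2)
      ≤ 8 * intg (derivative (a - U t) ^ 2) + 2 * intg (derivative (c - U s) ^ 2) := by
    have h4 : intg ((2 * derivative (a - U t) - derivative (c - U s)) ^ 2)
        ≤ intg ((8 : ℝ) • derivative (a - U t) ^ 2 + (2 : ℝ) • derivative (c - U s) ^ 2) := by
      refine intg_mono fun x _ => ?_
      simp only [eval_pow, eval_sub, eval_mul, eval_ofNat, eval_add, eval_smul, smul_eq_mul]
      nlinarith [sq_nonneg (2 * (eval x (derivative (a - U t))) + eval x (derivative (c - U s)))]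
    simpa using h4
  have h5 : (2 * intg (a - U t) - intg (c - U s)) ^ 2
      ≤ 8 * intg (a - U t) ^ 2 + 2 * intg (c - U s) ^ 2 := by
    nlinarith [sq_nonneg (2 * intg (a - U t) + intg (c - U s))]
  have h6 := intg_sq_nonneg (derivative (a - U t))
  unfold energy
  linarith

lemma Smooth.norm2_grad_le {N : ℕ} {ω η t : ℝ} {u : ℝ → ℝ → ℝ} (hu : Smooth T u) {U : ℝ → ℝ[X]}
    (hU : IsApprox T N ω u U) (ht : t ∈ Icc 0 T) (hω : 0 ≤ ω) (hη : 0 ≤ η) {a c : ℝ[X]}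
    (h : energy (a - U t) c ≤ η ^ 2) :
    norm2 (fun ρ => (derivative a).eval ρ - dρ u ρ t) ≤ 2 * (η + ω) := by
  have hpc : ∀ p : ℝ[X], ContinuousOn (fun ρ => p.eval ρ) (Icc (0 : ℝ) 1) :=
    fun p => p.continuous.continuousOn
  have h1 := intervalIntegral_sq_le ((hpc (derivative a)).fun_sub (hu.continuousOn_slice ht).2)
    (hpc (derivative (a - U t))) (c := ω) fun ρ hρ => by
      have := (hU.close t ht ρ hρ).2.1
      rw [derivative_sub, eval_sub]
      convert this using 2
      ring
  have h2 : intg (derivative (a - U t) ^ 2)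
      = ∫ ρ in (0 : ℝ)..1, (derivative (a - U t)).eval ρ ^ 2 := by
    simp only [intg_apply, eval_pow]
  rw [← h2, ← norm2_sq] at h1
  have h3 := intg_sq_nonneg (2 * derivative (a - U t) - derivative c)
  unfold energy at h
  refine le_of_sq_le_sq (h1.trans ?_) (by positivity)
  have h4 : 0 ≤ η * ω := by positivity
  nlinarith [sq_nonneg (intg (a - U t)), sq_nonneg (2 * intg (a - U t) - intg c)]

/-- Three unknowns contribute `3 · 44` and the front at most `11 b²`; the sum is rounded up to
`144`. -/
lemma IsSolution.totalEnergy_le (h : IsSolution p T ε φL φH φF L H F v R) {N : ℕ} {ω b t s : ℝ}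
    {UL UH UF : ℝ → ℝ[X]} (hU : IsApproxSolution p T N ω L H F v R UL UH UF) (ht : t ∈ Icc 0 T)
    (hs : s ∈ Icc 0 T) {A B : Level} (hA : IsStart N L H F R b A t) (hB : IsStart N L H F R b B s) :
    totalEnergy UL UH UF R A B t s ≤ 144 * (b ^ 2 + ω ^ 2) := by
  have hA := hA.2.2.2
  have hB := hB.2.2.2
  unfold xi xiZero at hA hB
  have n := norm2_nonneg
  have a1 := n (fun ρ => A.L.derivative.eval ρ - dρ L ρ t)
  have a2 := n (fun ρ => A.H.derivative.eval ρ - dρ H ρ t)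
  have a3 := n (fun ρ => A.F.derivative.eval ρ - dρ F ρ t)
  have a4 := n (fun ρ => A.L.eval ρ - L ρ t)
  have a5 := n (fun ρ => A.H.eval ρ - H ρ t)
  have a6 := n (fun ρ => A.F.eval ρ - F ρ t)
  have a7 := abs_nonneg (A.R - R t)
  have b1 := n (fun ρ => B.L.derivative.eval ρ - dρ L ρ s)
  have b2 := n (fun ρ => B.H.derivative.eval ρ - dρ H ρ s)
  have b3 := n (fun ρ => B.F.derivative.eval ρ - dρ F ρ s)
  have b4 := n (fun ρ => B.L.eval ρ - L ρ s)
  have b5 := n (fun ρ => B.H.eval ρ - H ρ s)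
  have b6 := n (fun ρ => B.F.eval ρ - F ρ s)
  have b7 := abs_nonneg (B.R - R s)
  have eL := h.smoothL.energy_le hU.apprL ht hs (a := A.L) (c := B.L) (b := b)
    (by linarith) (by linarith) (by linarith) (by linarith)
  have eH := h.smoothH.energy_le hU.apprH ht hs (a := A.H) (c := B.H) (b := b)
    (by linarith) (by linarith) (by linarith) (by linarith)
  have eF := h.smoothF.energy_le hU.apprF ht hs (a := A.F) (c := B.F) (b := b)
    (by linarith) (by linarith) (by linarith) (by linarith)
  have rA : (A.R - R t) ^ 2 ≤ b ^ 2 := by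
    rw [← sq_abs]; exact pow_le_pow_left₀ a7 (by linarith) 2
  have rB : (B.R - R s) ^ 2 ≤ b ^ 2 := by
    rw [← sq_abs]; exact pow_le_pow_left₀ b7 (by linarith) 2
  unfold totalEnergy
  nlinarith [sq_nonneg (2 * (A.R - R t) + (B.R - R s)), sq_nonneg ω]

lemma IsSolution.xi_le (h : IsSolution p T ε φL φH φF L H F v R) {N : ℕ} {ω η t s : ℝ}
    {UL UH UF : ℝ → ℝ[X]} (hU : IsApproxSolution p T N ω L H F v R UL UH UF) (ht : t ∈ Icc 0 T)
    (hω : 0 ≤ ω) (hη : 0 ≤ η) {A B : Level} (hE : totalEnergy UL UH UF R A B t s ≤ η ^ 2) :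
    xi L H F R A t ≤ 7 * (η + ω) := by
  have h1 := energy_nonneg (A.L - UL t) (B.L - UL s)
  have h2 := energy_nonneg (A.H - UH t) (B.H - UH s)
  have h3 := energy_nonneg (A.F - UF t) (B.F - UF s)
  have h4 := sq_nonneg (A.R - R t)
  have h5 := sq_nonneg (2 * (A.R - R t) - (B.R - R s))
  unfold totalEnergy at hE
  have kL := h.smoothL.norm2_grad_le hU.apprL ht hω hη (a := A.L) (c := B.L - UL s) (by linarith)
  have kH := h.smoothH.norm2_grad_le hU.apprH ht hω hη (a := A.H) (c := B.H - UH s) (by linarith)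
  have kF := h.smoothF.norm2_grad_le hU.apprF ht hω hη (a := A.F) (c := B.F - UF s) (by linarith)
  have r1 := abs_le_of_sq_le_sq (a := A.R - R t) (b := η) (by linarith) hη
  unfold xi
  linarith

end

end Plaque

end

/-! ### Choice of the constants and conclusion -/

theorem theorem1 (p : Params) (hD : 0 < p.D) (hM0 : p.M0 ≠ 0) (T ε : ℝ) (hT : 0 < T)
    (φL φH φF : ℝ → ℝ) (L H F v : ℝ → ℝ → ℝ) (R : ℝ → ℝ)
    (hsol : IsSolution p T ε φL φH φF L H F v R)
    (C₀ : ℝ) (κ : ℕ → ℝ) (hκ : Tendsto κ atTop (𝓝 0)) :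
    ∃ M₁ > (0 : ℝ), ∃ M₂ > (0 : ℝ), ∃ K : ℕ → ℝ, (∀ N, 0 ≤ K N) ∧ Tendsto K atTop (𝓝 0) ∧
      ∃ h₀ > (0 : ℝ), ∃ N₀ : ℕ, ∀ M N : ℕ, ∀ h hs : ℝ, 1 ≤ M → h = T / M → hs = 2 * h / 3 →
        h ≤ h₀ → N₀ ≤ N →
        ∀ A₀ A₁ : Level, A₀.R = ε →
          IsStart N L H F R (C₀ * (hs ^ 2 + Real.sqrt (κ N))) A₀ 0 →
          IsStart N L H F R (C₀ * (hs ^ 2 + Real.sqrt (κ N))) A₁ h →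
          (∃ (S : ℕ → Level) (w : ℕ → ℝ → ℝ), S 0 = A₀ ∧ S 1 = A₁ ∧ IsScheme p M N hs S w) ∧
          ∀ (S : ℕ → Level) (w : ℕ → ℝ → ℝ), S 0 = A₀ → S 1 = A₁ → IsScheme p M N hs S w →
            ∀ k ≤ M, xi L H F R (S k) (k * h)
              ≤ M₁ * Real.exp (M₂ * T) * (hs ^ 2 + Real.sqrt (K N)) := by
  obtain ⟨ω, hω0, hωt, hω⟩ := hsol.exists_approxSolution hT hM0
  obtain ⟨C, hC, r, hr, hest⟩ := hsol.scheme_estimate hD hT hM0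
  -- `144 C₀² + 144 + 1 ≤ 13² (|C₀| + 1)²` bounds the starting energy together with the consistency
  -- term by `(A y)²`, where `y = h² + q N`.
  obtain ⟨A, hA⟩ : ∃ A, A = 13 * (|C₀| + 1) := ⟨_, rfl⟩
  have hAC : |C₀| ≤ A := by rw [hA]; linarith [abs_nonneg C₀]
  have hA1 : 1 ≤ A := by rw [hA]; linarith [abs_nonneg C₀]
  obtain ⟨P, hP⟩ : ∃ P, P = Real.exp (2 * C * T) := ⟨_, rfl⟩
  have hP1 : 1 ≤ P := by rw [hP]; exact Real.one_le_exp (by positivity)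
  have hP2 : P ^ 2 = Real.exp (4 * C * T) := by
    rw [hP, sq, ← Real.exp_add]; ring_nf
  have hPM : P ≤ Real.exp ((2 * C + 1) * T) := by
    rw [hP]; exact Real.exp_le_exp.2 (by linarith)
  obtain ⟨q, hq⟩ : ∃ q : ℕ → ℝ, q = fun N => ω N + Real.sqrt (κ N) := ⟨_, rfl⟩
  have hq0 : ∀ N, 0 ≤ q N := fun N => by rw [hq]; exact add_nonneg (hω0 N) (Real.sqrt_nonneg _)
  have hqt : Tendsto q atTop (𝓝 0) := by
    rw [hq]; simpa using hωt.add ((Real.continuous_sqrt.tendsto 0).comp hκ)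
  -- With `y ≤ g` the final bound `η = P A y` does not exceed `r`; `h²` and `q N` may use half of
  -- `g` each.
  obtain ⟨g, hg⟩ : ∃ g, g = r / (P * A) := ⟨_, rfl⟩
  have hg0 : 0 < g := by rw [hg]; positivity
  obtain ⟨N₁, hN₁⟩ := eventually_atTop.1
    ((hqt.eventually_lt_const (show 0 < g / 2 by positivity)).and (hqt.eventually_lt_const hr))
  -- `M₁` comes from `14 · 9 / 4 ≤ 32`, where `9 / 4` converts `h²` to `hs²`. The `1` in `M₂`
  -- ensures positivity when `C = 0`, and `K = q²` makes `√K = q`.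
  refine ⟨32 * A, by positivity, 2 * C + 1, by positivity, fun N => q N ^ 2,
    fun N => sq_nonneg _, by simpa using hqt.pow 2, min r (min 1 (g / 2)), by positivity,
    max 2 N₁, ?_⟩
  intro M N h hs hM hh hhs hh₀ hN A₀ A₁ _ hs₀ hs₁
  have hM' : (1 : ℝ) ≤ M := by exact_mod_cast hM
  have hMh : (M : ℝ) * h = T := by rw [hh]; field_simp
  have hpos : 0 < h := by rw [hh]; positivity
  have hhT : h ≤ T := by rw [← hMh]; exact le_mul_of_one_le_left hpos.le hM'
  have hhr : h ≤ r := hh₀.trans (min_le_left _ _)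
  have hh1 : h ≤ 1 := hh₀.trans ((min_le_right _ _).trans (min_le_left _ _))
  have hhg : h ≤ g / 2 := hh₀.trans ((min_le_right _ _).trans (min_le_right _ _))
  obtain ⟨hqg, hqr⟩ := hN₁ N ((le_max_right _ _).trans hN)
  have hN2 : 2 ≤ N := (le_max_left _ _).trans hN
  obtain ⟨UL, UH, UF, hU⟩ := hω N
  have hqN : q N = ω N + Real.sqrt (κ N) := by rw [hq]
  have hκ0 := Real.sqrt_nonneg (κ N)
  have hωN := hω0 N
  obtain ⟨y, hy⟩ : ∃ y, y = h ^ 2 + q N := ⟨_, rfl⟩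
  have hy0 : 0 ≤ y := by rw [hy]; exact add_nonneg (sq_nonneg _) (hq0 N)
  have hyg : y ≤ g := by
    have h1 : h ^ 2 ≤ h := pow_le_of_le_one hpos.le hh1 two_ne_zero
    rw [hy]; linarith
  have m0 : (0 : ℝ) ∈ Icc 0 T := ⟨le_rfl, hT.le⟩
  have mh : h ∈ Icc 0 T := ⟨hpos.le, hhT⟩
  have hsh : hs ^ 2 = 4 / 9 * h ^ 2 := by rw [hhs]; ring
  obtain ⟨b, hb⟩ : ∃ b, b = C₀ * (hs ^ 2 + Real.sqrt (κ N)) := ⟨_, rfl⟩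
  rw [← hb] at hs₀ hs₁
  have hby : |b| ≤ |C₀| * y := by
    rw [hb, abs_mul, abs_of_nonneg (by positivity : 0 ≤ hs ^ 2 + Real.sqrt (κ N))]
    exact mul_le_mul_of_nonneg_left (by rw [hy, hqN, hsh]; linarith [sq_nonneg h]) (abs_nonneg _)
  have hstart : totalEnergy UL UH UF R A₁ A₀ h 0 + (h ^ 2 + ω N) ^ 2 ≤ (A * y) ^ 2 := by
    have h1 := hsol.totalEnergy_le hU mh m0 hs₁ hs₀
    have h2 : b ^ 2 ≤ |C₀| ^ 2 * y ^ 2 := by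
      rw [← mul_pow, ← sq_abs b]; exact pow_le_pow_left₀ (abs_nonneg _) hby 2
    have h3 : ω N ^ 2 ≤ y ^ 2 :=
      pow_le_pow_left₀ hωN (by rw [hy, hqN]; linarith [sq_nonneg h]) 2
    have h4 : (h ^ 2 + ω N) ^ 2 ≤ y ^ 2 :=
      pow_le_pow_left₀ (by positivity) (by rw [hy, hqN]; linarith) 2
    have h5 : 0 ≤ |C₀| * y ^ 2 := by positivity
    have h6 : 0 ≤ |C₀| ^ 2 * y ^ 2 := by positivity
    have h7 : 0 ≤ y ^ 2 := sq_nonneg y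
    rw [hA]
    linarith
  obtain ⟨η, hη⟩ : ∃ η, η = P * (A * y) := ⟨_, rfl⟩
  have hη0 : 0 ≤ η := by rw [hη]; positivity
  have hηr : η ≤ r := by
    rw [hg, le_div_iff₀ (by positivity)] at hyg
    rw [hη]; linarith
  have hηE : Real.exp (4 * C * T) * (totalEnergy UL UH UF R A₁ A₀ h 0 + (h ^ 2 + ω N) ^ 2)
      ≤ η ^ 2 := by
    rw [hη, mul_pow P, hP2]
    exact mul_le_mul_of_nonneg_left hstart (Real.exp_pos _).le
  obtain ⟨hex, hbd⟩ := hest N (ω N) UL UH UF hN2 hωN (by linarith) hU h A₀ A₁ hpos hhr hhT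
    (hηE.trans (pow_le_pow_left₀ hη0 hηr 2)) M hMh.le
  rw [← hhs] at hex hbd
  refine ⟨hex, fun S w hS0 hS1 hS k hk => ?_⟩
  have hAy : A * y ≤ η := by
    rw [hη]; exact le_mul_of_one_le_left (mul_nonneg (zero_le_one.trans hA1) hy0) hP1
  have hyA : y ≤ A * y := le_mul_of_one_le_left hy0 hA1
  have hxi : xi L H F R (S k) (k * h) ≤ 14 * η := by
    -- Level `0` is never the newer of two consecutive levels, so its error is taken from the
    -- starting assumption.
    obtain _ | n := k
    · have h1 := hs₀.2.2.2
      have h2 : 0 ≤ xiZero L H F A₀ 0 :=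
        add_nonneg (add_nonneg (norm2_nonneg _) (norm2_nonneg _)) (norm2_nonneg _)
      have h3 := le_abs_self b
      have h4 := mul_le_mul_of_nonneg_right hAC hy0
      rw [hS0, Nat.cast_zero, zero_mul]
      linarith
    · have h1 := hbd S w hS0 hS1 hS n hk
      have h2 : ((n + 1 : ℕ) : ℝ) * h ≤ T := by
        have h3 : ((n + 1 : ℕ) : ℝ) ≤ M := by exact_mod_cast hk
        rw [← hMh]; gcongr
      have h4 := hsol.xi_le hU ⟨by positivity, h2⟩ hωN hη0 (A := S (n + 1)) (B := S n) (s := n * h)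
        (by linarith [sq_nonneg (h ^ 2 + ω N)])
      have h5 : ω N ≤ y := by rw [hy, hqN]; linarith [sq_nonneg h]
      linarith
  refine hxi.trans ?_
  rw [Real.sqrt_sq (hq0 N)]
  have h1 : y ≤ 9 / 4 * (hs ^ 2 + q N) := by rw [hy, hsh]; linarith [hq0 N]
  have h2 : P * (A * y) ≤ Real.exp ((2 * C + 1) * T) * (A * (9 / 4 * (hs ^ 2 + q N))) := by
    gcongr
  have h3 : 0 ≤ Real.exp ((2 * C + 1) * T) * (A * (hs ^ 2 + q N)) := by
    have := hq0 N
    positivity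
  rw [hη]
  linarith
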